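/- **Setting.** Let $E$ be a Polish space and $\dagger\notin E$ a cemetery state. $B(E)$ is the space of bounded measurable functions $E\to\mathbb C$, and $B_1(E)$ the set of those bounded by $1$. Let $(\xi,\mathbf P_x)$ be a (jointly measurable) Markov process in $E\cup\{\dagger\}$ with $\dagger$ absorbing, $\gamma:E\to[0,\infty)$ bounded and measurable, and for $y\in E$ let $\mathcal P_y$ (expectation $\mathcal E_y$), measurable in $y$, be the law of a finite random collection of offspring $x_1,\dots,x_N\in E$. Let $X_t=\sum_{i=1}^{N_t}\delta_{x_i(t)}$ be a $(\mathbf P,\gamma,\mathcal P)$-branching Markov process: particles move independently as $\xi$, a particle at $y$ branches at rate $\gamma(y)$ and is then replaced by offspring with law $\mathcal P_y$, which evolve independently in the same way. $\mathbb E_{\delta_x}$ is the expectation for one initial particle at $x$, $X_t[f]=\sum_i f(x_i(t))$, $\psi_t[f](x)=\mathbb E_{\delta_x}[X_t[f]]$, and $\psi^{(\ell)}_t[\boldsymbol f](x)=\mathbb E_{\delta_x}\big[\prod_{i=1}^{\ell}X_t[f_i]\big]$ for $\boldsymbol f=(f_1,\dots,f_\ell)\in B(E)^\ell$. **Assumption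 (H1).** There are $m\ge1$, distinct $\lambda_1,\dots,\lambda_m\in\mathbb C$ with $\lambda_1\in(0,\infty)$, $\lambda_1>\mathrm{Re}\lambda_2\ge\dots\ge\mathrm{Re}\lambda_m$, integers $p_i\ge1$, $k_{i,j}\ge1$ and, for $1\le i\le m$, $1\le j\le p_i$, $1\le q\le k_{i,j}$, functions $\varphi^{(q)}_{i,j}\in B(E)$ and bounded linear functionals $\tilde\varphi^{(q)}_{i,j}:B(E)\to\mathbb C$ with $\tilde\varphi_{i,j}^{(q)}[\varphi_{i,j}^{(q)}]=1$ and $\tilde\varphi_{i,j}^{(q)}[\varphi_{i',j'}^{(q')}]=0$ for $(i,j,q)\ne(i',j',q')$, and a linear operator $\mathcal N:B(E)\to B(E)$ such that: $\mathcal N\varphi^{(q)}_{i,1}=0$; for $2\le j\le p_i$, $\mathcal N\varphi_{i,j}^{(q)}=\varphi_{i,j-1}^{(q^*)}$ for some $q^*=q^*(i,j,q)$ that is injective in $q$; $\mathcal Nf=0$ if all $\tilde\varphi_{i,j}^{(q)}[f]$ vanish; and, for all $t\ge0$ and $f\in B(E)$, $$\psi_t[\varphi_{i,j}^{(q)}]=e^{(\lambda_i+\mathcal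 N)t}\varphi_{i,j}^{(q)},\qquad \tilde\varphi_{i,j}^{(q)}[\psi_t[f]]=e^{\lambda_it}\tilde\varphi_{i,j}^{(q)}[e^{\mathcal Nt}f].$$ With $\Phi_{i,j}[f]=\sum_q\tilde\varphi_{i,j}^{(q)}[f]\varphi_{i,j}^{(q)}$ and $\Phi_i=\sum_{j}\Phi_{i,j}$, $$\sup_{x\in E,\,f\in B_1(E)}e^{-\mathrm{Re}\lambda_m t}\Big|\psi_t[f](x)-\sum_{i=1}^m e^{(\lambda_i+\mathcal N)t}\Phi_i[f](x)\Big|\to0\quad(t\to\infty).$$ **Notation.** $\mathrm{Ei}^*(\lambda_i)=\{f\in B(E):\Phi_{i,j}[f]\ne0\text{ for some }j\}$; $\mathrm{Ei}(\lambda_i)=\mathrm{Ei}^*(\lambda_i)\setminus\bigcup\{\mathrm{Ei}^*(\lambda_j):\mathrm{Re}\lambda_j\ge\mathrm{Re}\lambda_i,\ \lambda_j\ne\lambda_i\}$; $\mathrm{Ei}_1(\Lambda_L)=B_1(E)\cap\bigcup_{2\mathrm{Re}\lambda_i>\lambda_1}\mathrm{Ei}(\lambda_i)$. For $f\in\mathrm{Ei}_1(\Lambda_L)$,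 $\nu(f)$ is the unique index with $f\in\mathrm{Ei}(\lambda_{\nu(f)})$, $\lambda(f)=\lambda_{\nu(f)}$, and $p(f)=\max\{i\ge1:\mathcal N^{i-1}f\ne0\}$. For $\boldsymbol f\in\mathrm{Ei}_1(\Lambda_L)^\ell$, $\tilde\lambda(\boldsymbol f)=\sum_i\lambda(f_i)$, $\tilde p(\boldsymbol f)=\sum_ip(f_i)$, $\boldsymbol f^*=(\mathcal N^{p(f_1)-1}f_1,\dots,\mathcal N^{p(f_\ell)-1}f_\ell)$. For a finite set $A$ and a family $g(B,\cdot)$, $B\subseteq A$, of functions on $E$, $$\zeta_A[g](x)=\mathcal E_x\Big[\sum_{\sigma}\ \sum_{i_1,\dots,i_{|\sigma|}}\ \prod_{j=1}^{|\sigma|}g(\sigma_j,x_{i_j})\Big],$$ summed over the partitions $\sigma\ne\{A\}$ of $A$, with blocks $\sigma_1,\dots,\sigma_{|\sigma|}$, and over pairwise distinct $i_1,\dots,i_{|\sigma|}\in\{1,\dots,N\}$. For indices $\nu_1,\dots,\nu_\ell$ with $2\mathrm{Re}\lambda_{\nu_i}>\lambda_1$ and $\boldsymbol h\in B(E)^\ell$,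 put $L_{\{i\}}[\boldsymbol h]=\Phi_{\nu_i}[h_i]$ and, for $A\subseteq[\ell]=\{1,\dots,\ell\}$ with $|A|\ge2$, recursively $$L_A[\boldsymbol h](x)=\int_0^\infty e^{-s\sum_{i\in A}\lambda_{\nu_i}}\,\psi_s\Big[\gamma\,\zeta_A\big[L_\cdot[(e^{-\mathcal Ns}h_1,\dots,e^{-\mathcal Ns}h_\ell)]\big]\Big](x)\,ds .$$ **Theorem 2.1 (Large regime).** Assume (H1) and, for some $k\ge2$, $\sup_{x\in E}\mathcal E_x[N^k]<\infty$. Let $1\le\ell\le k$. Then the products $\prod_{i\le\ell}X_t[f_i]$, $\boldsymbol f\in B(E)^\ell$, are integrable under every $\mathbb P_{\delta_x}$; the integrals defining the $L_A[\boldsymbol h]$ converge absolutely and $L_A[\boldsymbol h]\in B(E)$. Moreover, for $t\ge 0$ let $$\Delta_{\ell,t}=\sup_{x\in E,\ \boldsymbol f\in\mathrm{Ei}_1(\Lambda_L)^\ell}\Big|e^{-\tilde\lambda(\boldsymbol f)t}(1+t)^{-(\tilde p(\boldsymbol f)-\ell)}\psi^{(\ell)}_t[\boldsymbol f](x)-\prod_{j=1}^\ell\frac1{(p(f_j)-1)!}\;L_{[\ell]}[\boldsymbol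 f^*](x)\Big|,$$ where $L_{[\ell]}[\boldsymbol f^*]$ is formed with the indices $\nu_i=\nu(f_i)$. Then $$\sup_{t\ge0}\Delta_{\ell,t}<\infty\qquad\text{and}\qquad\lim_{t\to\infty}\Delta_{\ell,t}=0 .$$ -/

import Mathlib

open MeasureTheory ProbabilityTheory Filter Topology
open scoped NNReal ENNReal

namespace BMP

/-! ### Finite configurations of particles -/

/-- A finite configuration of particles in `E`: a number `N` together with the positions
`x_1, …, x_N`. -/
abbrev Config (E : Type*) : Type _ := Σ n : ℕ, (Fin n → E)

/-- `μ[f] = ∑ᵢ f (xᵢ)`, the integral of `f` against the point measure `μ = ∑ᵢ δ_{xᵢ}`. -/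
noncomputable def pair {E : Type*} (c : Config E) (f : E → ℂ) : ℂ := ∑ i, f (c.2 i)

/-- `∏ᵢ g (xᵢ)`, equal to `1` for the empty configuration. -/
noncomputable def prodOver {E : Type*} (c : Config E) (g : E → ℝ≥0∞) : ℝ≥0∞ := ∏ i, g (c.2 i)

/-- The point measure `∑ᵢ δ_{xᵢ}` of a configuration. -/
noncomputable def toMeasure {E : Type*} [MeasurableSpace E] (c : Config E) : Measure E :=
  ∑ i, Measure.dirac (c.2 i)

/-! ### The motion of a single particle

The state space is `E ∪ {†}`, written `E ⊕ Unit`, with cemetery `† = Sum.inr ()`. -/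

/-- `(ξ, P)` is a (time-homogeneous, measurable) Markov process in `E ∪ {†}` for which `†` is
absorbing: started from `x ∈ E` under `P x`, and for `B ⊆ E`
`P_x (ξ_{s+t} ∈ B | ξ_u, u ≤ s) = P_{ξ_s} (ξ_t ∈ B)`, which is `0` on `{ξ_s = †}`. -/
structure IsMarkovMotion {E Ω₀ : Type*} [MeasurableSpace E] [MeasurableSpace Ω₀]
    (P : Kernel E Ω₀) (ξ : ℝ≥0 → Ω₀ → E ⊕ Unit) : Prop where
  isMarkovKernel : IsMarkovKernel P
  measurable : Measurable fun q : ℝ≥0 × Ω₀ => ξ q.1 q.2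
  start : ∀ x, ∀ᵐ ω ∂(P x), ξ 0 ω = Sum.inl x
  markov : ∀ (x : E) (s t : ℝ≥0) (A : Set Ω₀) (B : Set E),
    MeasurableSet[⨆ (u : ℝ≥0) (_ : u ≤ s), MeasurableSpace.comap (ξ u) inferInstance] A →
    MeasurableSet B →
    P x (A ∩ {ω | ξ (s + t) ω ∈ Sum.inl '' B}) =
      ∫⁻ ω in A, Sum.elim (fun y => P y {ω' | ξ t ω' ∈ Sum.inl '' B}) (fun _ => 0) (ξ s ω) ∂(P x)

/-- The branching rate at a point of `E ∪ {†}`; there is no branching at `†`. -/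
def rate {E : Type*} (γ : E → ℝ≥0) : E ⊕ Unit → ℝ≥0 := Sum.elim γ fun _ => 0

/-- `exp (- ∫₀ᵗ γ(ξ_s) ds)`, the conditional probability given the path `ξ` that the particle has
not branched by time `t`. -/
noncomputable def noBranchProb {E Ω₀ : Type*} (ξ : ℝ≥0 → Ω₀ → E ⊕ Unit) (γ : E → ℝ≥0)
    (t : ℝ≥0) (ω : Ω₀) : ℝ≥0∞ :=
  ENNReal.ofReal (Real.exp (-∫ s in (0 : ℝ)..t, (rate γ (ξ s.toNNReal ω) : ℝ)))

/-! ### Branching Markov processes -/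

/-- `v_t[g](x) = 𝔼_{δ_x} [∏_{i ≤ N_t} g(x_i(t))]`. -/
noncomputable def genFun {E Ω : Type*} [MeasurableSpace E] [MeasurableSpace Ω]
    (Pr : Kernel E Ω) (X : ℝ≥0 → Ω → Config E) (g : E → ℝ≥0∞) (t : ℝ≥0) (x : E) : ℝ≥0∞ :=
  ∫⁻ ω, prodOver (X t ω) g ∂(Pr x)

/-- `X`, under the laws `Pr x = ℙ_{δ_x}`, is a `(P, γ, 𝒫)`-branching Markov process.
`X t ω` lists the particles alive at time `t`. The laws of random point configurations are
described by the functionals `𝔼 [∏ᵢ g(xᵢ)]`, `g : E → [0, 1]`, which determine them.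

* `first_branch`: the initial particle moves as `ξ` and, at position `y`, branches at rate `γ y`.
  Either it has not branched by time `t` (and contributes the particle `ξ_t`, or no particle if
  `ξ_t = †`), or it branches first at some time `s < t` (density `γ(ξ_s) exp(-∫₀ˢ γ(ξ_u)du)`),
  is replaced by offspring with law `𝒫_{ξ_s}`, and the offspring start independent
  copies of the process, observed for the remaining time `t - s`.
* `markov_branching`: given the past of `X` up to time `s`, the particles alive at
  time `s` evolve as independent copies of the process. -/
structure IsBranchingMarkovProcess {E Ω₀ Ω : Type*} [MeasurableSpace E] [MeasurableSpace Ω₀]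
    [MeasurableSpace Ω] (P : Kernel E Ω₀) (ξ : ℝ≥0 → Ω₀ → E ⊕ Unit) (γ : E → ℝ≥0)
    (offspring : Kernel E (Config E)) (Pr : Kernel E Ω) (X : ℝ≥0 → Ω → Config E) : Prop where
  isMarkovKernel : IsMarkovKernel Pr
  measurable : Measurable fun q : ℝ≥0 × Ω => X q.1 q.2
  start : ∀ x, ∀ᵐ ω ∂(Pr x), X 0 ω = ⟨1, fun _ => x⟩
  first_branch : ∀ g : E → ℝ≥0∞, Measurable g → (∀ y, g y ≤ 1) → ∀ (t : ℝ≥0) (x : E),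
    genFun Pr X g t x =
      ∫⁻ ω, (noBranchProb ξ γ t ω * Sum.elim g (fun _ => 1) (ξ t ω) +
        ∫⁻ s in Set.Ioo (0 : ℝ) t,
          noBranchProb ξ γ s.toNNReal ω *
            Sum.elim
              (fun y => (γ y : ℝ≥0∞) *
                ∫⁻ c, prodOver c (genFun Pr X g (t - s.toNNReal)) ∂(offspring y))
              (fun _ => 0) (ξ s.toNNReal ω)) ∂(P x)
  markov_branching : ∀ (x : E) (s t : ℝ≥0) (A : Set Ω),
    MeasurableSet[⨆ (u : ℝ≥0) (_ : u ≤ s),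
      MeasurableSpace.comap (fun ω => toMeasure (X u ω)) inferInstance] A →
    ∀ g : E → ℝ≥0∞, Measurable g → (∀ y, g y ≤ 1) →
      ∫⁻ ω in A, prodOver (X (s + t) ω) g ∂(Pr x) =
        ∫⁻ ω in A, prodOver (X s ω) (genFun Pr X g t) ∂(Pr x)

/-- The expectation semigroup `ψ_t[f](x) = 𝔼_{δ_x} [X_t[f]]`. -/
noncomputable def psi {E Ω : Type*} [MeasurableSpace E] [MeasurableSpace Ω]
    (Pr : Kernel E Ω) (X : ℝ≥0 → Ω → Config E) (t : ℝ≥0) (f : E → ℂ) (x : E) : ℂ :=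
  ∫ ω, pair (X t ω) f ∂(Pr x)

/-- The product moment `ψ_t^{(ℓ)}[f](x) = 𝔼_{δ_x} [∏_{i ≤ ℓ} X_t[f_i]]`. -/
noncomputable def psiProd {E Ω : Type*} [MeasurableSpace E] [MeasurableSpace Ω]
    (Pr : Kernel E Ω) (X : ℝ≥0 → Ω → Config E) {ℓ : ℕ} (t : ℝ≥0) (f : Fin ℓ → E → ℂ) (x : E) : ℂ :=
  ∫ ω, ∏ i, pair (X t ω) (f i) ∂(Pr x)

/-- The branching operator `ζ_A[g](x)`: the expectation under the offspring law at `x` of the sum,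
over partitions `σ ≠ {A}` of `A` and over choices of distinct offspring for the blocks of `σ`, of
the products of the values of `g` on the blocks at the chosen offspring. -/
noncomputable def zeta {E : Type*} [MeasurableSpace E] (offspring : Kernel E (Config E))
    {ι : Type*} [DecidableEq ι] (A : Finset ι) (g : Finset ι → E → ℂ) (x : E) : ℂ :=
  ∫ c, (∑ σ : Finpartition A with σ.parts ≠ {A},
    ∑ e : {B // B ∈ σ.parts} ↪ Fin c.1, ∏ B : {B // B ∈ σ.parts}, g B.1 (c.2 (e B)))
      ∂(offspring x)

/-! ### Bounded functions and the spectral assumption -/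

/-- `B(E)`: the bounded measurable complex-valued functions on `E`. -/
def BddFun (E : Type*) [MeasurableSpace E] : Submodule ℂ (E → ℂ) where
  carrier := {f | Measurable f ∧ ∃ C : ℝ, ∀ x, ‖f x‖ ≤ C}
  add_mem' := by
    rintro f g ⟨hf, C, hC⟩ ⟨hg, D, hD⟩
    exact ⟨hf.add hg, C + D, fun x => (norm_add_le _ _).trans (add_le_add (hC x) (hD x))⟩
  zero_mem' := ⟨measurable_const, 0, fun x => by simp⟩
  smul_mem' := by
    rintro c f ⟨hf, C, hC⟩
    refine ⟨hf.const_smul c, ‖c‖ * C, fun x => ?_⟩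
    rw [Pi.smul_apply, norm_smul]
    exact mul_le_mul_of_nonneg_left (hC x) (norm_nonneg c)

/-- The objects in the spectral assumption, for `m = r + 1` eigenvalues; the
indices `i`, `j`, `k` are shifted to start from `0` (so `lam 0` is `λ_1`, `p i` is `p_i`, `k i j`
is `k_{i,j}`, `phi i j q` is `φ_{i,j}^{(q)}`, and `phiDual i j q` the functional dual to it). -/
structure SpectralData (E : Type*) [MeasurableSpace E] where
  r : ℕ
  lam : Fin (r + 1) → ℂ
  p : Fin (r + 1) → ℕ
  k : (i : Fin (r + 1)) → Fin (p i) → ℕ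
  phi : (i : Fin (r + 1)) → (j : Fin (p i)) → Fin (k i j) → BddFun E
  phiDual : (i : Fin (r + 1)) → (j : Fin (p i)) → Fin (k i j) → BddFun E →ₗ[ℂ] ℂ
  N : Module.End ℂ (BddFun E)

namespace SpectralData

variable {E : Type*} [MeasurableSpace E] (D : SpectralData E)

/-- `Φ_{i,j}[f] = ∑_q φ̃_{i,j}^{(q)}[f] φ_{i,j}^{(q)}`. -/
noncomputable def PhiJ (i : Fin (D.r + 1)) (j : Fin (D.p i)) (f : BddFun E) : BddFun E :=
  ∑ q, D.phiDual i j q f • D.phi i j q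

/-- `Φ_i[f] = ∑_j Φ_{i,j}[f]`. -/
noncomputable def Phi (i : Fin (D.r + 1)) (f : BddFun E) : BddFun E :=
  ∑ j, D.PhiJ i j f

/-- `e^{𝒩 t} f`; the operator `𝒩` of the spectral assumption is nilpotent, so the exponential
series is a finite sum. -/
noncomputable def expN (t : ℝ) (f : BddFun E) : BddFun E :=
  ∑ n ∈ Finset.range (nilpotencyClass D.N), ((t : ℂ) ^ n / (n.factorial : ℂ)) • (D.N ^ n) f

end SpectralData

/-- The spectral assumption (H1) on the semigroup `ψ`. -/
structure AssumptionH1 {E : Type*} [MeasurableSpace E] (ψ : ℝ≥0 → (E → ℂ) → E → ℂ)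
    extends SpectralData E where
  lam_zero_real : (lam 0).im = 0
  lam_zero_pos : 0 < (lam 0).re
  lam_zero_gt : ∀ i, i ≠ 0 → (lam i).re < (lam 0).re
  lam_antitone : Antitone fun i => (lam i).re
  lam_injective : Function.Injective lam
  p_pos : ∀ i, 0 < p i
  k_pos : ∀ i j, 0 < k i j
  phiDual_bounded : ∀ i j q, ∃ C : ℝ, ∀ (f : BddFun E) (M : ℝ),
    (∀ x, ‖(f : E → ℂ) x‖ ≤ M) → ‖phiDual i j q f‖ ≤ C * M
  phiDual_self : ∀ i j q, phiDual i j q (phi i j q) = 1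
  phiDual_other : ∀ (a b : Σ i : Fin (r + 1), Σ j : Fin (p i), Fin (k i j)), a ≠ b →
    phiDual a.1 a.2.1 a.2.2 (phi b.1 b.2.1 b.2.2) = 0
  N_bottom : ∀ (i : Fin (r + 1)) (h : 0 < p i) (q : Fin (k i ⟨0, h⟩)), N (phi i ⟨0, h⟩ q) = 0
  /-- `𝒩 φ_{i,j+1}^{(q)} = φ_{i,j}^{(k^*(q))}`, with `k^*` injective in `q`. -/
  N_shift : ∀ (i : Fin (r + 1)) (j : ℕ) (h : j + 1 < p i),
    ∃ kstar : Fin (k i ⟨j + 1, h⟩) → Fin (k i ⟨j, Nat.lt_of_succ_lt h⟩),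
      Function.Injective kstar ∧
      ∀ q, N (phi i ⟨j + 1, h⟩ q) = phi i ⟨j, Nat.lt_of_succ_lt h⟩ (kstar q)
  /-- `𝒩` vanishes on `ker(λ_m)`, the common kernel of all the functionals. -/
  N_ker : ∀ f : BddFun E, (∀ i j q, phiDual i j q f = 0) → N f = 0
  psi_phi : ∀ i j q (t : ℝ≥0) (x : E),
    ψ t (phi i j q : E → ℂ) x =
      Complex.exp (lam i * (t : ℝ)) * (toSpectralData.expN t (phi i j q) : E → ℂ) x
  /-- `φ̃_{i,j}^{(q)}[ψ_t[f]] = e^{λ_i t} φ̃_{i,j}^{(q)}[e^{𝒩 t} f]`; here `h` is `ψ_t[f]` as an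
  element of `B(E)`. -/
  phiDual_psi : ∀ i j q (t : ℝ≥0) (f h : BddFun E), (h : E → ℂ) = ψ t (f : E → ℂ) →
    phiDual i j q h = Complex.exp (lam i * (t : ℝ)) * phiDual i j q (toSpectralData.expN t f)
  psi_asymp : Tendsto
    (fun t : ℝ≥0 => ⨆ (x : E) (f : BddFun E) (_ : ∀ y, ‖(f : E → ℂ) y‖ ≤ 1),
      ‖(Real.exp (-((lam (Fin.last r)).re * t)) : ℂ) *
        (ψ t (f : E → ℂ) x - ∑ i : Fin (r + 1), Complex.exp (lam i * (t : ℝ)) *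
          (toSpectralData.expN t (toSpectralData.Phi i f) : E → ℂ) x)‖ₑ)
    atTop (𝓝 0)

namespace SpectralData

variable {E : Type*} [MeasurableSpace E] (D : SpectralData E)

/-- `Ei^*(λ_i)`. -/
def EiStar (i : Fin (D.r + 1)) : Set (BddFun E) := {f | ∃ j, D.PhiJ i j f ≠ 0}

/-- `Ei(λ_i) = Ei^*(λ_i) \ ⋃ Ei^*(λ_j)`, the union over `j` with `Re λ_j ≥ Re λ_i`, `λ_j ≠ λ_i`;
the union is empty for `λ_1`. -/
def Ei (i : Fin (D.r + 1)) : Set (BddFun E) :=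
  D.EiStar i \ ⋃ (j) (_ : (D.lam i).re ≤ (D.lam j).re ∧ D.lam j ≠ D.lam i), D.EiStar j

/-- `Ei_1(Λ_L)`: the functions bounded by one in the union of the `Ei(λ_i)` over the large
eigenvalues, `2 Re λ_i > λ_1`. -/
def EiLargeOne : Set (BddFun E) :=
  {f | (∃ i, (D.lam 0).re < 2 * (D.lam i).re ∧ f ∈ D.Ei i) ∧ ∀ y, ‖(f : E → ℂ) y‖ ≤ 1}

/-- `ν(f)`: the unique index with `f ∈ Ei(λ_{ν(f)})` (used only when it exists). -/
noncomputable def nu (f : BddFun E) : Fin (D.r + 1) := Classical.epsilon fun i => f ∈ D.Ei i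

/-- `p(f) = max {i : 𝒩^{i-1} f ≠ 0}`. -/
noncomputable def pIndex (f : BddFun E) : ℕ := sSup {i : ℕ | 1 ≤ i ∧ (D.N ^ (i - 1)) f ≠ 0}

/-- `f^* = (𝒩^{p(f_1)-1} f_1, …, 𝒩^{p(f_ℓ)-1} f_ℓ)`. -/
noncomputable def fStar {ℓ : ℕ} (f : Fin ℓ → BddFun E) : Fin ℓ → BddFun E :=
  fun i => (D.N ^ (D.pIndex (f i) - 1)) (f i)

end SpectralData

section Limit

variable {E Ω : Type*} [MeasurableSpace E] [MeasurableSpace Ω]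
  (Pr : Kernel E Ω) (X : ℝ≥0 → Ω → Config E) (γ : E → ℝ≥0) (offspring : Kernel E (Config E))
  (D : SpectralData E)

/-- The integrand in the recursive definition of `L_A[h](x)`, given a family `G s B` standing for
`L_B[e^{-𝒩 s} h]` on the subsets `B` of `A`:
`e^{-λ̃_A s} ψ_s[γ ζ_A[G s ·]](x)`, where `λ̃_A = ∑_{i ∈ A} λ_{ν i}`. -/
noncomputable def limitIntegrand {ℓ : ℕ} (ν : Fin ℓ → Fin (D.r + 1)) (A : Finset (Fin ℓ))
    (G : ℝ → Finset (Fin ℓ) → E → ℂ) (x : E) (s : ℝ) : ℂ :=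
  Complex.exp (-(∑ i ∈ A, D.lam (ν i)) * s) *
    psi Pr X s.toNNReal (fun y => (γ y : ℂ) * zeta offspring A (G s) y) x

/-- `L_A[h](x)`, defined by recursion on `A`, where `ν i` is the eigenvalue index attached to the
`i`-th coordinate: `L_{{i}}[h] = Φ_{ν i}[h_i]`, and for `|A| ≥ 2`
`L_A[h](x) = ∫_0^∞ e^{-λ̃_A s} ψ_s[γ ζ_A[B ↦ L_B[e^{-𝒩 s} h]]](x) ds`.
(The blocks of the partitions in `ζ_A` are proper subsets of `A`. The value `1` at
`A = ∅` is never used.) -/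
noncomputable def limitL {ℓ : ℕ} (ν : Fin ℓ → Fin (D.r + 1)) (A : Finset (Fin ℓ))
    (h : Fin ℓ → BddFun E) (x : E) : ℂ :=
  if A.card ≤ 1 then ∏ i ∈ A, (D.Phi (ν i) (h i) : E → ℂ) x
  else ∫ s in Set.Ioi (0 : ℝ),
    limitIntegrand Pr X γ offspring D ν A
      (fun s B y => if _ : B ⊂ A then limitL ν B (fun i => D.expN (-s) (h i)) y else 0) x s
termination_by A.card
decreasing_by exact Finset.card_lt_card (by assumption)

/-- `Δ_{ℓ,t}`, as an extended nonnegative number. -/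
noncomputable def Delta (ℓ : ℕ) (t : ℝ≥0) : ℝ≥0∞ :=
  ⨆ (x : E) (f : Fin ℓ → BddFun E) (_ : ∀ i, f i ∈ D.EiLargeOne),
    ‖Complex.exp (-(∑ i, D.lam (D.nu (f i))) * (t : ℝ)) *
        ((1 + (t : ℝ) : ℝ) : ℂ) ^ (-((∑ i, (D.pIndex (f i) : ℤ)) - (ℓ : ℤ))) *
        psiProd Pr X t (fun i => (f i : E → ℂ)) x -
      (∏ i, (((D.pIndex (f i) - 1).factorial : ℂ))⁻¹) *
        limitL Pr X γ offspring D (fun i => D.nu (f i)) Finset.univ (D.fStar f) x‖ₑ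

end Limit

end BMP

set_option linter.unusedSectionVars false

namespace BMP

/-! ### Measurability on the space of configurations -/

section ConfigMeasurability

variable {E α β : Type*} [MeasurableSpace E] [MeasurableSpace α] [MeasurableSpace β]

/-! The proof turns the branching property into an evolution equation for product moments and then
lets the spectral gap act on that equation.

Evolution equation. The process is described only through functionals `𝔼[∏ g(x_i)]` with `g ≤ 1`.
Taking `g = exp(-∑ θ_i f_i)` makes the first-branching equation an identity of Laplace transforms,
so by uniqueness the law of a vector of nonnegative linear statistics splits into a surviving, a
dead and a branched part, the last being a mixture of sums of independent vectors (`law_eq`). Any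
functional that vanishes at `0` can be integrated against this identity. Truncated powers of the
particle number and a Grönwall inequality give `𝔼[N_t^k] ≤ 2 exp(βt)`, uniformly in the starting
point (`lintegral_card_pow_le`). Products of complex statistics are functions of their nonnegative
parts; expanding a product of sums over offspring and grouping the factors by offspring produces set
partitions, the one-block partition giving the mean and the others giving `ζ_A`. This is a renewal
equation for the motion killed at rate `γ` (`MomentBounds.prodMoment_eq`). The candidate `ψ_t[∏ f_i]
+ ∫₀ᵗ ψ_s[γ ζ_A[ψ^{(·)}_{t-s}]] ds` solves the same equation by Fubini, and the difference of two
locally bounded solutions vanishes by Grönwall (`MomentBounds.prodMoment_evolution`).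

Decay. Choose `κ > 0` with `Re λ_i ≥ λ_1/2 + κ` for all large eigenvalues. If `|A| ≥ 2`, the weight
`e^{-λ̃_A s}` has modulus at most `e^{-(λ_1+2κ)s}`, whereas `ψ_s` grows at most like `e^{(λ_1+κ)s}`.
The integrands in `L_A` therefore decay like `e^{-κs}`, up to powers of `1+s` coming from the
nilpotent part. By induction on `|A|`, `L_A` is bounded and Lipschitz in its arguments
(`exists_limitBound`).

Convergence. For fixed `t`, the functional `L_A[e^{𝒩t} f]` is the natural comparison for `e^{-λ̃_A
t} ψ^{(A)}_t[f]`: since `e^{-𝒩s} e^{𝒩t} = e^{𝒩(t-s)}`, its integrand at `s` is that of the evolution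
equation with every smaller moment at time `t-s` replaced by its own comparison. Induction on `|A|`
shows that the difference, divided by `∏ (1+t)^{d_i}` with `d_i = p(f_i) - 1`, tends to zero
uniformly (`exists_momentRate`); singletons are the first-moment asymptotics (`exists_rate_psi`).
Finally `(1+t)^{-d} e^{𝒩t} f = 𝒩^d f / d! + O(1/(1+t))`, and homogeneity and the Lipschitz bound
carry this through `L_A` (`exists_norm_limitL_expN_sub_le`). Only finitely many vectors of
eigenvalue indices occur, so their rates can be summed (`exists_rate_Delta`). -/

lemma measurable_config_mk (n : ℕ) : Measurable (fun v : Fin n → E => (⟨n, v⟩ : Config E)) := by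
  intro s hs
  have h := MeasurableSpace.measurableSet_iInf.1 hs n
  exact h

lemma measurableEmbedding_config_mk (n : ℕ) :
    MeasurableEmbedding (fun v : Fin n → E => (⟨n, v⟩ : Config E)) where
  injective := fun _ _ h => sigma_mk_injective h
  measurable := measurable_config_mk n
  measurableSet_image' := by
    intro s hs
    refine MeasurableSpace.measurableSet_iInf.2 fun m => ?_
    change MeasurableSet ((fun v : Fin m → E => (⟨m, v⟩ : Config E)) ⁻¹'
      ((fun v : Fin n → E => (⟨n, v⟩ : Config E)) '' s))
    by_cases h : m = n
    · subst h
      have hinj : Function.Injective fun v : Fin m → E => (⟨m, v⟩ : Config E) :=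
        fun _ _ h => sigma_mk_injective h
      rwa [Set.preimage_image_eq _ hinj]
    · convert MeasurableSet.empty
      ext x
      simp only [Set.mem_preimage, Set.mem_image, Set.mem_empty_iff_false, iff_false]
      rintro ⟨y, -, hy⟩
      exact h (congrArg Sigma.fst hy).symm

/-- The preimage of a set is a countable union of images of measurable sets under measurable
embeddings, one for each particle number, so measurability can be checked with the number of
particles fixed. -/
lemma measurable_of_config {f : α × Config E → β}
    (h : ∀ n, Measurable fun p : α × (Fin n → E) => f (p.1, ⟨n, p.2⟩)) : Measurable f := by
  intro B hB
  have : f ⁻¹' B = ⋃ n, (Prod.map id (fun v : Fin n → E => (⟨n, v⟩ : Config E))) ''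
      ((fun p : α × (Fin n → E) => f (p.1, ⟨n, p.2⟩)) ⁻¹' B) := by
    ext ⟨a, n, v⟩
    simp only [Set.mem_preimage, Set.mem_iUnion, Set.mem_image, Prod.exists, Prod.map, id]
    constructor
    · intro hx
      exact ⟨n, a, v, hx, rfl⟩
    · rintro ⟨m, a', v', hx, he⟩
      rw [← he]
      exact hx
  rw [this]
  exact MeasurableSet.iUnion fun n =>
    (MeasurableEmbedding.id.prodMap (measurableEmbedding_config_mk n)).measurableSet_image.2
      (h n hB)

lemma measurable_of_config' {f : Config E → β}
    (h : ∀ n, Measurable fun p : Fin n → E => f ⟨n, p⟩) : Measurable f := by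
  have : Measurable fun p : Unit × Config E => f p.2 :=
    measurable_of_config fun n => (h n).comp measurable_snd
  exact this.comp (measurable_const.prodMk measurable_id : Measurable fun c : Config E => ((), c))

lemma measurable_config_card : Measurable fun c : Config E => c.1 :=
  measurable_of_config' fun _ => measurable_const

lemma measurable_pair {G : α → E → ℂ} (hG : Measurable fun p : α × E => G p.1 p.2) :
    Measurable fun p : α × Config E => pair p.2 (G p.1) := by
  refine measurable_of_config fun n => ?_
  change Measurable fun p : α × (Fin n → E) => ∑ j : Fin n, G p.1 (p.2 j)
  refine Finset.measurable_fun_sum _ fun j _ => ?_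
  exact hG.comp (measurable_fst.prodMk (by fun_prop : Measurable fun p : α × (Fin n → E) => p.2 j))

end ConfigMeasurability

/-! ### Uniqueness of Laplace transforms -/

section Laplace

variable {ι : Type*} [Fintype ι]

/-- The function `y ↦ exp (-⟨θ, y⟩)` on the orthant. -/
noncomputable def laplaceFun (θ : ι → ℝ≥0) :
    BoundedContinuousFunction (ι → ℝ≥0) ℝ :=
  BoundedContinuousFunction.ofNormedAddCommGroup
    (fun y => Real.exp (-∑ i, (θ i : ℝ) * y i)) (by fun_prop) 1 (fun y => by
      rw [Real.norm_eq_abs, Real.abs_exp, Real.exp_le_one_iff]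
      have : 0 ≤ ∑ i, (θ i : ℝ) * y i := Finset.sum_nonneg fun i _ => by positivity
      linarith)

lemma laplaceFun_apply (θ y : ι → ℝ≥0) :
    laplaceFun θ y = Real.exp (-∑ i, (θ i : ℝ) * y i) := rfl

lemma laplaceFun_nonneg (θ y : ι → ℝ≥0) : 0 ≤ laplaceFun θ y := (Real.exp_pos _).le

lemma laplaceFun_mul (θ θ' : ι → ℝ≥0) :
    laplaceFun θ * laplaceFun θ' = laplaceFun (θ + θ') := by
  ext y
  simp only [BoundedContinuousFunction.coe_mul, Pi.mul_apply, laplaceFun_apply, ← Real.exp_add]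
  congr 1
  simp [add_mul, Finset.sum_add_distrib]
  ring

/-- The exponentials `exp (-⟨θ, ·⟩)` as a submonoid. -/
noncomputable def laplaceSubmonoid (ι : Type*) [Fintype ι] :
    Submonoid (BoundedContinuousFunction (ι → ℝ≥0) ℝ) where
  carrier := Set.range laplaceFun
  mul_mem' := by
    rintro _ _ ⟨θ, rfl⟩ ⟨θ', rfl⟩
    exact ⟨θ + θ', (laplaceFun_mul θ θ').symm⟩
  one_mem' := ⟨0, by ext y; simp [laplaceFun_apply]⟩

/-- The exponentials are closed under multiplication, so the algebra they generate is just their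
linear span, on which the two integrals agree by linearity. The algebra separates points, and a
separating algebra of bounded continuous functions determines a finite measure on this Polish space.
-/
lemma ext_of_laplace {μ ν : Measure (ι → ℝ≥0)} [IsFiniteMeasure μ] [IsFiniteMeasure ν]
    (h : ∀ θ : ι → ℝ≥0, ∫⁻ y, ENNReal.ofReal (Real.exp (-∑ i, (θ i : ℝ) * y i)) ∂μ =
      ∫⁻ y, ENNReal.ofReal (Real.exp (-∑ i, (θ i : ℝ) * y i)) ∂ν) : μ = ν := by
  let A₀ : Subalgebra ℝ (BoundedContinuousFunction (ι → ℝ≥0) ℝ) :=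
    Algebra.adjoin ℝ (laplaceSubmonoid ι : Set (BoundedContinuousFunction (ι → ℝ≥0) ℝ))
  let A : StarSubalgebra ℝ (BoundedContinuousFunction (ι → ℝ≥0) ℝ) :=
    { A₀ with
      star_mem' := by
        intro a ha
        have : star a = a := by
          ext y
          simp
        rw [this]
        exact ha }
  have hint : ∀ (m : Measure (ι → ℝ≥0)) [IsFiniteMeasure m] θ,
      ∫ y, laplaceFun θ y ∂m =
        (∫⁻ y, ENNReal.ofReal (Real.exp (-∑ i, (θ i : ℝ) * y i)) ∂m).toReal := by
    intro m _ θ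
    rw [integral_eq_lintegral_of_nonneg_ae]
    · rfl
    · exact ae_of_all _ fun y => (Real.exp_pos _).le
    · exact (laplaceFun θ).continuous.aestronglyMeasurable
  refine ext_of_forall_mem_subalgebra_integral_eq_of_pseudoEMetric_complete_countable
    (𝕜 := ℝ) (A := A) ?_ ?_
  · intro y y' hy
    obtain ⟨i, hi⟩ := Function.ne_iff.1 hy
    classical
    refine ⟨_, ⟨laplaceFun (Pi.single i 1), ?_, rfl⟩, ?_⟩
    · simp only [A]
      exact ⟨laplaceFun (Pi.single i 1), Algebra.subset_adjoin ⟨_, rfl⟩, rfl⟩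
    · simp [laplaceFun_apply, Pi.single_apply, apply_ite, ite_mul, hi]
  · intro g hg
    have hg' : g ∈ Submodule.span ℝ
        (laplaceSubmonoid ι : Set (BoundedContinuousFunction (ι → ℝ≥0) ℝ)) := by
      have h1 : g ∈ Subalgebra.toSubmodule A₀ := hg
      rwa [Algebra.adjoin_eq_span, Submonoid.closure_eq] at h1
    induction hg' using Submodule.span_induction with
    | mem x hx =>
      obtain ⟨θ, rfl⟩ := hx
      rw [hint μ, hint ν, h]
    | zero => simp
    | add x y hx hy ihx ihy =>
      have hx' : x ∈ A := by
        change x ∈ A₀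
        rw [← Subalgebra.mem_toSubmodule, Algebra.adjoin_eq_span, Submonoid.closure_eq]; exact hx
      have hy' : y ∈ A := by
        change y ∈ A₀
        rw [← Subalgebra.mem_toSubmodule, Algebra.adjoin_eq_span, Submonoid.closure_eq]; exact hy
      have e : ∀ (m : Measure (ι → ℝ≥0)) [IsFiniteMeasure m],
          ∫ z, (x + y) z ∂m = ∫ z, x z ∂m + ∫ z, y z ∂m := fun m _ =>
        integral_add (x.integrable m) (y.integrable m)
      rw [e, e, ihx hx', ihy hy']
    | smul a x hx ihx =>
      have hx' : x ∈ A := by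
        change x ∈ A₀
        rw [← Subalgebra.mem_toSubmodule, Algebra.adjoin_eq_span, Submonoid.closure_eq]; exact hx
      have e : ∀ (m : Measure (ι → ℝ≥0)),
          ∫ z, (a • x) z ∂m = a * ∫ z, x z ∂m := fun m => integral_const_mul a _
      rw [e, e, ihx hx']

end Laplace


/-! ### The motion killed at the branching rate -/

lemma noBranchProb_le_one {E Ω₀ : Type*} (ξ : ℝ≥0 → Ω₀ → E ⊕ Unit) (γ : E → ℝ≥0) (t : ℝ≥0) (ω : Ω₀) :
    noBranchProb ξ γ t ω ≤ 1 := by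
  rw [noBranchProb, ENNReal.ofReal_le_one, Real.exp_le_one_iff, neg_nonpos]
  exact intervalIntegral.integral_nonneg t.2 fun s _ => NNReal.coe_nonneg _

section Motion

variable {E Ω₀ : Type*} [MeasurableSpace E] [MeasurableSpace Ω₀]

lemma measurable_rate {γ : E → ℝ≥0} (hγ : Measurable γ) : Measurable (rate γ) :=
  Measurable.sumElim hγ measurable_const

/-- The variable endpoint is moved into an indicator on the product space, after which measurability
of parameter integrals applies. -/
lemma measurable_noBranchProb {ξ : ℝ≥0 → Ω₀ → E ⊕ Unit} {γ : E → ℝ≥0}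
    (hξ : Measurable fun q : ℝ≥0 × Ω₀ => ξ q.1 q.2) (hγ : Measurable γ) :
    Measurable fun q : ℝ≥0 × Ω₀ => noBranchProb ξ γ q.1 q.2 := by
  unfold noBranchProb
  refine ENNReal.measurable_ofReal.comp (Real.measurable_exp.comp (Measurable.neg ?_))
  have h1 : Measurable fun p : (ℝ≥0 × Ω₀) × ℝ => (rate γ (ξ p.2.toNNReal p.1.2) : ℝ) := by
    refine measurable_coe_nnreal_real.comp ((measurable_rate hγ).comp ?_)
    exact hξ.comp (f := fun p : (ℝ≥0 × Ω₀) × ℝ => (p.2.toNNReal, p.1.2)) (by fun_prop)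
  have h2 : MeasurableSet {p : (ℝ≥0 × Ω₀) × ℝ | 0 < p.2 ∧ p.2 ≤ p.1.1} := by
    apply MeasurableSet.inter
    · exact measurableSet_lt measurable_const measurable_snd
    · exact measurableSet_le measurable_snd (by fun_prop)
  have h3 := (h1.indicator h2).stronglyMeasurable
  have h4 := (StronglyMeasurable.integral_prod_right (ν := (volume : Measure ℝ))
    (f := fun (q : ℝ≥0 × Ω₀) (s : ℝ) => Set.indicator
      {p : (ℝ≥0 × Ω₀) × ℝ | 0 < p.2 ∧ p.2 ≤ p.1.1}
      (fun p => (rate γ (ξ p.2.toNNReal p.1.2) : ℝ)) (q, s)) h3).measurable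
  convert h4 using 2 with q
  rw [intervalIntegral.integral_of_le q.1.coe_nonneg, ← integral_indicator measurableSet_Ioc]
  rfl

lemma measurable_noBranchProb_right {ξ : ℝ≥0 → Ω₀ → E ⊕ Unit} {γ : E → ℝ≥0}
    (hξ : Measurable fun q : ℝ≥0 × Ω₀ => ξ q.1 q.2) (hγ : Measurable γ) (t : ℝ≥0) :
    Measurable fun ω => noBranchProb ξ γ t ω := by
  have := measurable_noBranchProb hξ hγ
  exact this.comp (f := fun ω => (t, ω)) (by fun_prop)

/-- The kernel from `E ∪ {†}` to `E` that forgets the cemetery. -/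
noncomputable def aliveKernel (E : Type*) [MeasurableSpace E] : Kernel (E ⊕ Unit) E where
  toFun := Sum.elim Measure.dirac fun _ => 0
  measurable' := Measurable.sumElim Measure.measurable_dirac measurable_const

/-- `S_t(x, dy) = E_x [exp (-∫₀ᵗ γ(ξ_s) ds); ξ_t ∈ dy]`. -/
noncomputable def killedKernel (P : Kernel E Ω₀) [IsSFiniteKernel P] (ξ : ℝ≥0 → Ω₀ → E ⊕ Unit)
    (γ : E → ℝ≥0) : Kernel (ℝ≥0 × E) E :=
  aliveKernel E ∘ₖ
    (Kernel.withDensity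
      (Kernel.deterministic Prod.fst measurable_fst ×ₖ Kernel.prodMkLeft ℝ≥0 P)
      (fun _ q => noBranchProb ξ γ q.1 q.2)).map fun q => ξ q.1 q.2

variable {P : Kernel E Ω₀} [IsMarkovKernel P] {ξ : ℝ≥0 → Ω₀ → E ⊕ Unit} {γ : E → ℝ≥0}

lemma lintegral_killedKernel (hξ : Measurable fun q : ℝ≥0 × Ω₀ => ξ q.1 q.2) (hγ : Measurable γ)
    (t : ℝ≥0) (x : E) {g : E → ℝ≥0∞} (hg : Measurable g) :
    ∫⁻ y, g y ∂(killedKernel P ξ γ (t, x)) =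
      ∫⁻ ω, noBranchProb ξ γ t ω * Sum.elim g (fun _ => 0) (ξ t ω) ∂(P x) := by
  have hnb := measurable_noBranchProb hξ hγ
  have hal : ∀ z : E ⊕ Unit, ∫⁻ y, g y ∂(aliveKernel E z) = Sum.elim g (fun _ => 0) z := by
    rintro (y | y)
    · exact lintegral_dirac' y hg
    · exact lintegral_zero_measure g
  have hm : Measurable (Sum.elim g (fun _ : Unit => (0 : ℝ≥0∞))) :=
    Measurable.sumElim hg measurable_const
  have hm2 : Measurable fun q : ℝ≥0 × Ω₀ => Sum.elim g (fun _ : Unit => (0 : ℝ≥0∞)) (ξ q.1 q.2) :=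
    hm.comp hξ
  have hnb2 : Measurable (Function.uncurry fun (_ : ℝ≥0 × E) (q : ℝ≥0 × Ω₀) =>
      noBranchProb ξ γ q.1 q.2) := hnb.comp measurable_snd
  have hprod : Measurable fun q : ℝ≥0 × Ω₀ =>
      noBranchProb ξ γ q.1 q.2 * Sum.elim g (fun _ => 0) (ξ q.1 q.2) := hnb.mul hm2
  have h1 := Kernel.lintegral_deterministic_prod measurable_fst (Kernel.prodMkLeft ℝ≥0 P) (t, x)
    hprod
  have h2 := Kernel.lintegral_withDensity
    (Kernel.deterministic Prod.fst measurable_fst ×ₖ Kernel.prodMkLeft ℝ≥0 P) hnb2 (t, x) hm2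
  have h3 := Kernel.lintegral_map ((Kernel.withDensity
      (Kernel.deterministic Prod.fst measurable_fst ×ₖ Kernel.prodMkLeft ℝ≥0 P)
      (fun _ q => noBranchProb ξ γ q.1 q.2))) hξ (t, x) hm
  rw [killedKernel, Kernel.lintegral_comp _ _ _ hg, lintegral_congr hal, h3, h2, h1,
    Kernel.prodMkLeft_apply]

attribute [irreducible] killedKernel

lemma killedKernel_univ_le (hξ : Measurable fun q : ℝ≥0 × Ω₀ => ξ q.1 q.2) (hγ : Measurable γ)
    (p : ℝ≥0 × E) : killedKernel P ξ γ p Set.univ ≤ 1 := by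
  have h := lintegral_killedKernel (P := P) hξ hγ p.1 p.2 (g := fun _ => 1) measurable_const
  rw [lintegral_one] at h
  rw [show p = (p.1, p.2) from rfl, h]
  calc _ ≤ ∫⁻ _, 1 ∂(P p.2) := by
        refine lintegral_mono fun ω => ?_
        refine mul_le_one' (noBranchProb_le_one _ _ _ _) ?_
        cases ξ p.1 ω <;> simp
    _ = 1 := by simp

lemma isFiniteKernel_killedKernel (hξ : Measurable fun q : ℝ≥0 × Ω₀ => ξ q.1 q.2)
    (hγ : Measurable γ) : IsFiniteKernel (killedKernel P ξ γ) :=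
  ⟨⟨1, ENNReal.one_lt_top, killedKernel_univ_le hξ hγ⟩⟩

end Motion

/-! ### Laws of vectors of linear statistics -/

section Vec

variable {E Ω α ι : Type*} [MeasurableSpace E] [MeasurableSpace Ω] [MeasurableSpace α]

/-- The vector `(∑ⱼ fᵢ(xⱼ))ᵢ`. -/
noncomputable def vec (f : ι → E → ℝ≥0) (c : Config E) (i : ι) : ℝ≥0 := ∑ j, f i (c.2 j)

lemma measurable_vec {f : ι → E → ℝ≥0} (hf : ∀ i, Measurable (f i)) : Measurable (vec f) := by
  refine measurable_of_config' fun n => measurable_pi_lambda _ fun i => ?_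
  change Measurable fun p : Fin n → E => ∑ j : Fin n, f i (p j)
  refine Finset.measurable_fun_sum _ fun j _ => ?_
  exact (hf i).comp (measurable_pi_apply j)

/-- The law of `vec f (X_u)` under `Pr x`. -/
noncomputable def vecKernel (Pr : Kernel E Ω) [IsSFiniteKernel Pr] (X : ℝ≥0 → Ω → Config E)
    (f : ι → E → ℝ≥0) : Kernel (ℝ≥0 × E) (ι → ℝ≥0) :=
  (Kernel.deterministic Prod.fst measurable_fst ×ₖ Kernel.prodMkLeft ℝ≥0 Pr).map
    fun q => vec f (X q.1 q.2)

section

variable {Pr : Kernel E Ω} [IsMarkovKernel Pr] {X : ℝ≥0 → Ω → Config E} {f : ι → E → ℝ≥0}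

lemma vecKernel_apply (hX : Measurable fun q : ℝ≥0 × Ω => X q.1 q.2) (hf : ∀ i, Measurable (f i))
    (u : ℝ≥0) (x : E) : vecKernel Pr X f (u, x) = (Pr x).map fun ω => vec f (X u ω) := by
  have hm : Measurable fun q : ℝ≥0 × Ω => vec f (X q.1 q.2) := (measurable_vec hf).comp hX
  refine Measure.ext_of_lintegral _ fun g hg => ?_
  rw [vecKernel, Kernel.lintegral_map _ hm _ hg,
    Kernel.lintegral_deterministic_prod _ _ _ (g := fun q : ℝ≥0 × Ω => g (vec f (X q.1 q.2)))
      (hg.comp hm), Kernel.prodMkLeft_apply,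
    lintegral_map (f := g) (g := fun ω => vec f (X u ω)) hg (hm.comp measurable_prodMk_left)]

lemma measurable_vec_comp (hX : Measurable fun q : ℝ≥0 × Ω => X q.1 q.2)
    (hf : ∀ i, Measurable (f i)) (u : ℝ≥0) : Measurable fun ω => vec f (X u ω) :=
  (measurable_vec hf).comp (hX.comp (f := fun ω => (u, ω)) measurable_prodMk_left)

lemma isMarkovKernel_vecKernel (hX : Measurable fun q : ℝ≥0 × Ω => X q.1 q.2)
    (hf : ∀ i, Measurable (f i)) : IsMarkovKernel (vecKernel Pr X f) := by
  rw [vecKernel]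
  exact Kernel.IsMarkovKernel.map _ ((measurable_vec hf).comp hX)

end

/-- The law of the sum of independent vectors with laws `κ (a, x_j)`, one for each particle. -/
noncomputable def superpose (κ : Kernel (α × E) (ι → ℝ≥0)) [IsMarkovKernel κ] :
    Kernel (α × Config E) (ι → ℝ≥0) where
  toFun p := (Measure.pi fun j => κ (p.1, p.2.2 j)).map fun z => ∑ j, z j
  measurable' := by
    refine measurable_of_config fun n => ?_
    refine (Measure.measurable_map (fun z : Fin n → ι → ℝ≥0 => ∑ j, z j)
      (Finset.measurable_fun_sum _ fun j _ => measurable_pi_apply j)).comp ?_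
    -- Boxes form a generating π-system, and the mass of a box is a finite product of measurable
    -- functions of the parameters.
    refine Measurable.measure_of_isPiSystem_of_isProbabilityMeasure generateFrom_pi.symm
      isPiSystem_pi ?_
    rintro _ ⟨B, hB, rfl⟩
    simp only [Measure.pi_pi]
    change Measurable fun p : α × (Fin n → E) => ∏ j : Fin n, κ (p.1, p.2 j) (B j)
    refine Finset.measurable_fun_prod _ fun j _ => ?_
    exact (Kernel.measurable_coe κ (hB j (Set.mem_univ j))).comp (by fun_prop)

variable (κ : Kernel (α × E) (ι → ℝ≥0)) [IsMarkovKernel κ]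

lemma superpose_apply (a : α) (c : Config E) :
    superpose κ (a, c) = (Measure.pi fun j => κ (a, c.2 j)).map fun z => ∑ j, z j := rfl

instance : IsMarkovKernel (superpose κ) where
  isProbabilityMeasure p := by
    rw [show p = (p.1, p.2) from rfl, superpose_apply]
    exact Measure.isProbabilityMeasure_map
      (Finset.measurable_fun_sum _ fun j _ => measurable_pi_apply j).aemeasurable

lemma lintegral_superpose (a : α) (c : Config E) {H : (ι → ℝ≥0) → ℝ≥0∞} (hH : Measurable H) :
    ∫⁻ z, H z ∂(superpose κ (a, c)) =
      ∫⁻ z, H (∑ j, z j) ∂(Measure.pi fun j => κ (a, c.2 j)) := by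
  rw [superpose_apply, lintegral_map hH
    (Finset.measurable_fun_sum _ fun j _ => measurable_pi_apply j)]

/-- Laplace transforms turn sums of independent vectors into products. This is the form in which `∏
genFun` appears in the first-branching equation. -/
lemma lintegral_superpose_exp [Fintype ι] (a : α) (c : Config E) (θ : ι → ℝ≥0) :
    ∫⁻ z, ENNReal.ofReal (Real.exp (-∑ i, (θ i : ℝ) * z i)) ∂(superpose κ (a, c)) =
      ∏ j, ∫⁻ z, ENNReal.ofReal (Real.exp (-∑ i, (θ i : ℝ) * z i)) ∂(κ (a, c.2 j)) := by
  have hint : ∀ (m : Measure (ι → ℝ≥0)) [IsFiniteMeasure m],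
      ∫⁻ z, ENNReal.ofReal (Real.exp (-∑ i, (θ i : ℝ) * z i)) ∂m =
        ENNReal.ofReal (∫ z, laplaceFun θ z ∂m) := by
    intro m _
    rw [ofReal_integral_eq_lintegral_ofReal ((laplaceFun θ).integrable m)
      (ae_of_all _ fun y => (Real.exp_pos _).le)]
    rfl
  simp_rw [hint]
  rw [← ENNReal.ofReal_prod_of_nonneg fun j _ => integral_nonneg (laplaceFun_nonneg θ)]
  congr 1
  rw [← integral_fintype_prod_eq_prod, superpose_apply,
    integral_map (Finset.measurable_fun_sum _ fun j _ => measurable_pi_apply j).aemeasurable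
      (laplaceFun θ).continuous.aestronglyMeasurable]
  refine integral_congr_ae (ae_of_all _ fun z => ?_)
  simp only [laplaceFun_apply, ← Real.exp_sum]
  congr 1
  rw [Finset.sum_neg_distrib, Finset.sum_comm]
  simp [Finset.sum_apply, Finset.mul_sum]

end Vec


/-! ### The law of linear statistics, decomposed at the first branching time -/

section FirstBranch

variable {E Ω₀ Ω ι : Type*} [MeasurableSpace E] [MeasurableSpace Ω₀] [MeasurableSpace Ω]

/-- The law of the time (before `t`), position and offspring at the first branching. -/
noncomputable def branchMeasure (S : Kernel (ℝ≥0 × E) E) [IsFiniteKernel S] (γ : E → ℝ≥0)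
    (off : Kernel E (Config E)) (t : ℝ≥0) (x : E) : Measure ((ℝ × E) × Config E) :=
  ((volume.restrict (Set.Ioo (0 : ℝ) t)) ⊗ₘ
    Kernel.withDensity (S.comap (fun s : ℝ => (s.toNNReal, x)) (by fun_prop))
      fun _ y => (γ y : ℝ≥0∞)) ⊗ₘ off.comap Prod.snd measurable_snd

lemma lintegral_branchMeasure (S : Kernel (ℝ≥0 × E) E) [IsFiniteKernel S] {γ : E → ℝ≥0}
    (hγ : Measurable γ) (off : Kernel E (Config E)) [IsMarkovKernel off] (t : ℝ≥0) (x : E)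
    {H : (ℝ × E) × Config E → ℝ≥0∞} (hH : Measurable H) :
    ∫⁻ p, H p ∂(branchMeasure S γ off t x) =
      ∫⁻ s in Set.Ioo (0 : ℝ) t, ∫⁻ y, γ y * ∫⁻ c, H ((s, y), c) ∂(off y)
        ∂(S (s.toNNReal, x)) := by
  have h1 : Measurable fun p : ℝ × E => ∫⁻ c, H (p, c) ∂(off p.2) :=
    Measurable.lintegral_kernel_prod_right (κ := off.comap Prod.snd measurable_snd)
      (f := fun p c => H (p, c)) hH
  rw [branchMeasure, Measure.lintegral_compProd hH]
  simp only [Kernel.comap_apply]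
  rw [Measure.lintegral_compProd h1]
  refine lintegral_congr fun s => ?_
  have h2 : Measurable fun y => ∫⁻ c, H ((s, y), c) ∂(off y) := h1.comp measurable_prodMk_left
  rw [Kernel.lintegral_withDensity _ (f := fun (_ : ℝ) y => (γ y : ℝ≥0∞)) (by fun_prop) s h2,
    Kernel.comap_apply]

/-- The contribution of the paths that branch before time `t` to the law of a vector of linear
statistics. -/
noncomputable def branchedLaw (S : Kernel (ℝ≥0 × E) E) [IsFiniteKernel S] (γ : E → ℝ≥0)
    (off : Kernel E (Config E)) (κ : Kernel (ℝ≥0 × E) (ι → ℝ≥0)) [IsMarkovKernel κ]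
    (t : ℝ≥0) (x : E) : Measure (ι → ℝ≥0) :=
  ((superpose κ).comap (fun p : (ℝ × E) × Config E => (t - p.1.1.toNNReal, p.2))
    (by fun_prop)) ∘ₘ branchMeasure S γ off t x

lemma lintegral_branchedLaw (S : Kernel (ℝ≥0 × E) E) [IsFiniteKernel S] {γ : E → ℝ≥0}
    (hγ : Measurable γ) (off : Kernel E (Config E)) [IsMarkovKernel off]
    (κ : Kernel (ℝ≥0 × E) (ι → ℝ≥0)) [IsMarkovKernel κ] (t : ℝ≥0) (x : E)
    {H : (ι → ℝ≥0) → ℝ≥0∞} (hH : Measurable H) :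
    ∫⁻ z, H z ∂(branchedLaw S γ off κ t x) =
      ∫⁻ s in Set.Ioo (0 : ℝ) t, ∫⁻ y, γ y * ∫⁻ c, ∫⁻ z, H z ∂(superpose κ (t - s.toNNReal, c))
        ∂(off y) ∂(S (s.toNNReal, x)) := by
  rw [branchedLaw, Measure.lintegral_bind (Kernel.aemeasurable _) hH.aemeasurable]
  simp only [Kernel.comap_apply]
  rw [lintegral_branchMeasure S hγ off t x]
  exact hH.lintegral_kernel.comp (f := fun p : (ℝ × E) × Config E => (t - p.1.1.toNNReal, p.2))
    (by fun_prop)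

lemma measurable_sumElim_zero {α : Type*} [MeasurableSpace α] {h : α × E → ℝ≥0∞}
    (hh : Measurable h) :
    Measurable fun p : α × (E ⊕ Unit) => Sum.elim (fun y => h (p.1, y)) (fun _ => 0) p.2 := by
  have : (fun p : α × (E ⊕ Unit) => Sum.elim (fun y => h (p.1, y)) (fun _ => 0) p.2) =
      Sum.elim h (fun _ => 0) ∘ MeasurableEquiv.prodSumDistrib α E Unit := by
    ext ⟨a, (y | y)⟩ <;> rfl
  rw [this]
  exact (Measurable.sumElim hh measurable_const).comp (MeasurableEquiv.measurable _)

lemma prodOver_exp {E ι : Type*} [Fintype ι] (f : ι → E → ℝ≥0) (θ : ι → ℝ≥0) (c : Config E) :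
    prodOver c (fun y => ENNReal.ofReal (Real.exp (-∑ i, (θ i : ℝ) * f i y))) =
      ENNReal.ofReal (Real.exp (-∑ i, (θ i : ℝ) * vec f c i)) := by
  rw [prodOver, ← ENNReal.ofReal_prod_of_nonneg fun j _ => (Real.exp_pos _).le, ← Real.exp_sum,
    Finset.sum_neg_distrib, Finset.sum_comm]
  simp [vec, Finset.mul_sum]

variable {P : Kernel E Ω₀} [IsMarkovKernel P] {ξ : ℝ≥0 → Ω₀ → E ⊕ Unit} {γ : E → ℝ≥0}
  {offspring : Kernel E (Config E)} [IsMarkovKernel offspring] {Pr : Kernel E Ω}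
  [IsMarkovKernel Pr] {X : ℝ≥0 → Ω → Config E}

/-- The probability of dying before time `t` without having branched. -/
noncomputable def deathProb (P : Kernel E Ω₀) (ξ : ℝ≥0 → Ω₀ → E ⊕ Unit) (γ : E → ℝ≥0)
    (t : ℝ≥0) (x : E) : ℝ≥0∞ :=
  ∫⁻ ω, noBranchProb ξ γ t ω * Sum.elim (fun _ => 0) (fun _ => 1) (ξ t ω) ∂(P x)

/-- The first-branching equation in terms of the killed kernel. -/
lemma genFun_eq (hξ : Measurable fun q : ℝ≥0 × Ω₀ => ξ q.1 q.2) (hγ : Measurable γ)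
    (hX : IsBranchingMarkovProcess P ξ γ offspring Pr X) {g : E → ℝ≥0∞} (hg : Measurable g)
    (hg1 : ∀ y, g y ≤ 1) (t : ℝ≥0) (x : E)
    (hh : Measurable fun p : ℝ × E => (γ p.2 : ℝ≥0∞) *
      ∫⁻ c, prodOver c (genFun Pr X g (t - p.1.toNNReal)) ∂(offspring p.2)) :
    genFun Pr X g t x = ∫⁻ y, g y ∂(killedKernel P ξ γ (t, x)) + deathProb P ξ γ t x +
      ∫⁻ s in Set.Ioo (0 : ℝ) t, ∫⁻ y, (γ y : ℝ≥0∞) *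
        ∫⁻ c, prodOver c (genFun Pr X g (t - s.toNNReal)) ∂(offspring y)
          ∂(killedKernel P ξ γ (s.toNNReal, x)) := by
  have hnb := measurable_noBranchProb hξ hγ
  have hξt : Measurable fun ω => ξ t ω := hξ.comp (measurable_prodMk_left (x := t))
  have hnbt : Measurable fun ω => noBranchProb ξ γ t ω :=
    measurable_noBranchProb_right hξ hγ t
  have hjoint : Measurable fun p : Ω₀ × ℝ => noBranchProb ξ γ p.2.toNNReal p.1 *
      Sum.elim (fun y => (γ y : ℝ≥0∞) *
        ∫⁻ c, prodOver c (genFun Pr X g (t - p.2.toNNReal)) ∂(offspring y))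
        (fun _ => 0) (ξ p.2.toNNReal p.1) := by
    refine Measurable.mul ?_ ?_
    · exact hnb.comp (f := fun p : Ω₀ × ℝ => (p.2.toNNReal, p.1)) (by fun_prop)
    · exact (measurable_sumElim_zero hh).comp
        (f := fun p : Ω₀ × ℝ => (p.2, ξ p.2.toNNReal p.1))
        (measurable_snd.prodMk
          (hξ.comp (f := fun p : Ω₀ × ℝ => (p.2.toNNReal, p.1)) (by fun_prop)))
  have hm1 : Measurable fun ω => noBranchProb ξ γ t ω * Sum.elim g (fun _ => 1) (ξ t ω) :=
    hnbt.mul ((Measurable.sumElim hg measurable_const).comp hξt)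
  have hm2 : Measurable fun ω => noBranchProb ξ γ t ω * Sum.elim g (fun _ => 0) (ξ t ω) :=
    hnbt.mul ((Measurable.sumElim hg measurable_const).comp hξt)
  have h1 := hX.first_branch g hg hg1 t x
  rw [lintegral_add_left hm1] at h1
  have h2 := lintegral_killedKernel (P := P) hξ hγ t x hg
  rw [h1, h2, deathProb, ← lintegral_add_left hm2]
  congr 1
  · refine lintegral_congr fun ω => ?_
    rw [← mul_add]
    congr 1
    cases ξ t ω <;> simp
  -- Exchanging the expectation over the path with the time integral leaves, at each time `s`, an
  -- integral against the killed kernel.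
  · rw [lintegral_lintegral_swap hjoint.aemeasurable]
    refine lintegral_congr fun s => ?_
    have h3 : Measurable fun y => (γ y : ℝ≥0∞) *
        ∫⁻ c, prodOver c (genFun Pr X g (t - s.toNNReal)) ∂(offspring y) :=
      hh.comp measurable_prodMk_left
    exact (lintegral_killedKernel (P := P) hξ hγ s.toNNReal x h3).symm

/-- The law of a vector of nonnegative linear statistics, decomposed according to whether the
initial particle dies, survives without branching, or branches. -/
theorem law_eq [Fintype ι] (hξ : Measurable fun q : ℝ≥0 × Ω₀ => ξ q.1 q.2) (hγ : Measurable γ)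
    (hX : IsBranchingMarkovProcess P ξ γ offspring Pr X) {f : ι → E → ℝ≥0}
    (hf : ∀ i, Measurable (f i)) [IsMarkovKernel (vecKernel Pr X f)]
    [IsFiniteKernel (killedKernel P ξ γ)] (t : ℝ≥0) (x : E) :
    (Pr x).map (fun ω => vec f (X t ω)) =
      (killedKernel P ξ γ (t, x)).map (fun y i => f i y) +
        deathProb P ξ γ t x • Measure.dirac 0 +
        branchedLaw (killedKernel P ξ γ) γ offspring (vecKernel Pr X f) t x := by
  have hXm := hX.measurable
  have hfm : Measurable fun (y : E) (i : ι) => f i y := measurable_pi_lambda _ hf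
  have hvt : ∀ t, Measurable fun ω => vec f (X t ω) := fun t =>
    measurable_vec_comp hXm hf t
  have key : ∀ θ : ι → ℝ≥0,
      ∫⁻ y, ENNReal.ofReal (Real.exp (-∑ i, (θ i : ℝ) * y i))
        ∂((Pr x).map (fun ω => vec f (X t ω))) =
      ∫⁻ y, ENNReal.ofReal (Real.exp (-∑ i, (θ i : ℝ) * y i))
        ∂((killedKernel P ξ γ (t, x)).map (fun y i => f i y) +
        deathProb P ξ γ t x • Measure.dirac 0 +
          branchedLaw (killedKernel P ξ γ) γ offspring (vecKernel Pr X f) t x) := by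
    -- At `θ`, the transform of the left side is the generating functional of `g = exp(-∑ θ_i f_i)`.
    -- Since `g` at the cemetery is `1 = exp 0`, death contributes an atom at the zero vector.
    intro θ
    have hem : Measurable fun y : ι → ℝ≥0 =>
      ENNReal.ofReal (Real.exp (-∑ i, (θ i : ℝ) * y i)) := by fun_prop
    have hgm : Measurable fun y : E => ENNReal.ofReal (Real.exp (-∑ i, (θ i : ℝ) * f i y)) :=
      hem.comp hfm
    have hg1 : ∀ y, ENNReal.ofReal (Real.exp (-∑ i, (θ i : ℝ) * f i y)) ≤ 1 := by
      intro y
      rw [ENNReal.ofReal_le_one, Real.exp_le_one_iff, neg_nonpos]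
      exact Finset.sum_nonneg fun i _ => by positivity
    have hgen : ∀ u y,
        genFun Pr X (fun y => ENNReal.ofReal (Real.exp (-∑ i, (θ i : ℝ) * f i y))) u y =
          ∫⁻ z, ENNReal.ofReal (Real.exp (-∑ i, (θ i : ℝ) * z i)) ∂(vecKernel Pr X f (u, y)) := by
      intro u y
      rw [vecKernel_apply hXm hf, lintegral_map hem (hvt u)]
      exact lintegral_congr fun ω => prodOver_exp f θ _
    have hsup : ∀ u (c : Config E), prodOver c
        (genFun Pr X (fun y => ENNReal.ofReal (Real.exp (-∑ i, (θ i : ℝ) * f i y))) u) =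
        ∫⁻ z, ENNReal.ofReal (Real.exp (-∑ i, (θ i : ℝ) * z i))
          ∂(superpose (vecKernel Pr X f) (u, c)) := by
      intro u c
      rw [lintegral_superpose_exp]
      exact Finset.prod_congr rfl fun j _ => hgen u _
    have hgen' := genFun_eq (P := P) (ξ := ξ) hξ hγ hX hgm hg1 t x
    simp_rw [hsup] at hgen'
    rw [lintegral_map hem (hvt t), lintegral_add_measure, lintegral_add_measure,
      lintegral_map hem hfm, lintegral_smul_measure, lintegral_dirac' _ hem,
      lintegral_branchedLaw _ hγ _ _ _ _ hem]
    simp only [Pi.zero_apply, NNReal.coe_zero, mul_zero, Finset.sum_const_zero, neg_zero,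
        Real.exp_zero, ENNReal.ofReal_one, smul_eq_mul, mul_one]
    rw [← hgen' ?_]
    · exact lintegral_congr fun ω => (prodOver_exp f θ _).symm
    · refine Measurable.mul (measurable_coe_nnreal_ennreal.comp (hγ.comp measurable_snd)) ?_
      refine Measurable.lintegral_kernel_prod_right
        (κ := offspring.comap Prod.snd measurable_snd)
        (f := fun (p : ℝ × E) (c : Config E) =>
          ∫⁻ z, ENNReal.ofReal (Real.exp (-∑ i, (θ i : ℝ) * z i))
            ∂(superpose (vecKernel Pr X f) (t - p.1.toNNReal, c))) ?_
      exact hem.lintegral_kernel.comp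
        (f := fun p : (ℝ × E) × Config E => (t - p.1.1.toNNReal, p.2)) (by fun_prop)
  have : IsProbabilityMeasure ((Pr x).map (fun ω => vec f (X t ω))) :=
    Measure.isProbabilityMeasure_map (hvt t).aemeasurable
  have : IsFiniteMeasure ((killedKernel P ξ γ (t, x)).map (fun y i => f i y) +
        deathProb P ξ γ t x • Measure.dirac 0 +
          branchedLaw (killedKernel P ξ γ) γ offspring (vecKernel Pr X f) t x) := by
    refine ⟨?_⟩
    -- The case `θ = 0` compares total masses, so the right side is finite and uniqueness of Laplace
    -- transforms applies to it.
    have := key 0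
    simp only [Pi.zero_apply, NNReal.coe_zero, zero_mul, Finset.sum_const_zero, neg_zero,
      Real.exp_zero, ENNReal.ofReal_one, lintegral_one] at this
    rw [← this]
    exact measure_lt_top _ _
  exact ext_of_laplace key

end FirstBranch


/-! ### Moments of the number of particles -/

lemma lintegral_exp_neg_le {β : ℝ} (hβ : 0 < β) (t : ℝ) :
    ∫⁻ s in Set.Ioo (0 : ℝ) t, ENNReal.ofReal (Real.exp (-β * s)) ≤ ENNReal.ofReal (1 / β) := by
  calc ∫⁻ s in Set.Ioo (0 : ℝ) t, ENNReal.ofReal (Real.exp (-β * s))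
      ≤ ∫⁻ s in Set.Ioi (0 : ℝ), ENNReal.ofReal (Real.exp (-β * s)) :=
        lintegral_mono_set Set.Ioo_subset_Ioi_self
    _ = ENNReal.ofReal (∫ s in Set.Ioi (0 : ℝ), Real.exp (-β * s)) := by
        rw [ofReal_integral_eq_lintegral_ofReal (integrableOn_exp_mul_Ioi (by linarith) 0)
          (ae_of_all _ fun s => (Real.exp_pos _).le)]
    _ = ENNReal.ofReal (1 / β) := by
        rw [integral_exp_mul_Ioi (by linarith)]
        congr 1
        simp [neg_div_neg_eq]

/-- A Grönwall inequality for functions of time and space, uniform in space. -/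
lemma gronwall_iSup {E : Type*} (a : ℝ≥0 → E → ℝ≥0∞) (A L B : ℝ≥0)
    (hB : ∀ t x, a t x ≤ B)
    (h : ∀ t x, a t x ≤ A + L * ∫⁻ s in Set.Ioo (0 : ℝ) t, ⨆ y, a (t - s.toNNReal) y) (t : ℝ≥0)
    (x : E) : a t x ≤ 2 * A * ENNReal.ofReal (Real.exp ((2 * L + 1) * t)) := by
  -- With the weight `e^{-βt}` the integral term contributes at most `L/β ≤ 1/2` of the weighted
  -- supremum, and the extra `1` keeps `β` positive when `L = 0`.
  set β : ℝ := 2 * L + 1 with hβ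
  have hβ0 : 0 < β := by positivity
  set e : ℝ → ℝ≥0∞ := fun s => ENNReal.ofReal (Real.exp (-β * s)) with he
  have hee : ∀ s, e s * ENNReal.ofReal (Real.exp (β * s)) = 1 := by
    intro s
    rw [he, ← ENNReal.ofReal_mul (Real.exp_pos _).le, ← Real.exp_add]
    simp
  have he1 : ∀ t : ℝ≥0, e t ≤ 1 := by
    intro t
    rw [he, ENNReal.ofReal_le_one, Real.exp_le_one_iff]
    have : 0 ≤ β * t := by positivity
    linarith
  set b : ℝ≥0∞ := ⨆ (t : ℝ≥0) (x : E), e t * a t x with hb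
  -- The a priori bound `B` serves only here: finiteness of `b` permits subtracting `b / 2` from `b
  -- ≤ A + b / 2`.
  have hbtop : b ≠ ⊤ := by
    refine ne_top_of_le_ne_top (b := (B : ℝ≥0∞)) ENNReal.coe_ne_top ?_
    refine iSup₂_le fun t x => ?_
    calc e t * a t x ≤ 1 * B := mul_le_mul' (he1 t) (hB t x)
      _ = B := one_mul _
  have hab : ∀ t x, a t x ≤ ENNReal.ofReal (Real.exp (β * t)) * b := by
    intro t x
    calc a t x = ENNReal.ofReal (Real.exp (β * t)) * (e t * a t x) := by
          rw [← mul_assoc, mul_comm _ (e t), hee, one_mul]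
      _ ≤ _ := mul_le_mul' le_rfl (le_iSup₂_of_le t x le_rfl)
  have hbb : b ≤ A + b / 2 := by
    refine iSup₂_le fun t x => ?_
    have h1 : ∫⁻ s in Set.Ioo (0 : ℝ) t, ⨆ y, a (t - s.toNNReal) y ≤
        ∫⁻ s in Set.Ioo (0 : ℝ) t, ENNReal.ofReal (Real.exp (β * t)) * b * e s := by
      refine setLIntegral_mono (by fun_prop) fun s hs => iSup_le fun y => (hab _ y).trans ?_
      have hs' : ((t - s.toNNReal : ℝ≥0) : ℝ) = t - s := by
        rw [NNReal.coe_sub, Real.coe_toNNReal _ hs.1.le]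
        rw [← NNReal.coe_le_coe, Real.coe_toNNReal _ hs.1.le]
        exact hs.2.le
      rw [hs', mul_right_comm, he]
      simp only
      rw [← ENNReal.ofReal_mul (Real.exp_pos _).le, ← Real.exp_add]
      exact mul_le_mul' (ENNReal.ofReal_le_ofReal (Real.exp_le_exp.2 (by linarith))) le_rfl
    have h2 : (L : ℝ≥0∞) * ENNReal.ofReal (1 / β) ≤ 2⁻¹ := by
      rw [← ENNReal.ofReal_coe_nnreal, ← ENNReal.ofReal_mul L.coe_nonneg]
      have : (2 : ℝ≥0∞)⁻¹ = ENNReal.ofReal (1 / 2) := by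
        rw [one_div, ENNReal.ofReal_inv_of_pos two_pos, ENNReal.ofReal_ofNat]
      rw [this]
      refine ENNReal.ofReal_le_ofReal ?_
      rw [mul_one_div, div_le_iff₀ hβ0]
      linarith
    calc e t * a t x ≤ e t * (A + L * ∫⁻ s in Set.Ioo (0 : ℝ) t,
            ENNReal.ofReal (Real.exp (β * t)) * b * e s) := by
          exact mul_le_mul' le_rfl ((h t x).trans (by gcongr))
      _ = e t * A + L * (∫⁻ s in Set.Ioo (0 : ℝ) t, e s) * b := by
          rw [lintegral_const_mul _ (by fun_prop), mul_add]
          congr 1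
          calc _ = (e t * ENNReal.ofReal (Real.exp (β * t))) *
                (L * (∫⁻ s in Set.Ioo (0 : ℝ) t, e s) * b) := by ring
            _ = _ := by rw [hee, one_mul]
      _ ≤ 1 * A + 2⁻¹ * b := by
          gcongr
          · exact he1 t
          · exact (mul_le_mul' le_rfl (lintegral_exp_neg_le hβ0 _)).trans h2
      _ = A + b / 2 := by rw [one_mul, ENNReal.div_eq_inv_mul]
  have hb2 : b ≤ 2 * A := by
    have h3 : b / 2 ≤ A := by
      have h4 : b / 2 + b / 2 ≤ A + b / 2 := by rwa [ENNReal.add_halves]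
      exact (ENNReal.add_le_add_iff_right (ENNReal.div_ne_top hbtop two_ne_zero)).1 h4
    calc b = b / 2 + b / 2 := (ENNReal.add_halves b).symm
      _ ≤ A + A := add_le_add h3 h3
      _ = 2 * A := (two_mul _).symm
  calc a t x ≤ ENNReal.ofReal (Real.exp (β * t)) * b := hab t x
    _ ≤ ENNReal.ofReal (Real.exp (β * t)) * (2 * A) := mul_le_mul' le_rfl hb2
    _ = _ := mul_comm _ _

section Moments

variable {E Ω₀ Ω ι : Type*} [MeasurableSpace E] [MeasurableSpace Ω₀] [MeasurableSpace Ω]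
variable {P : Kernel E Ω₀} [IsMarkovKernel P] {ξ : ℝ≥0 → Ω₀ → E ⊕ Unit} {γ : E → ℝ≥0}
  {offspring : Kernel E (Config E)} [IsMarkovKernel offspring] {Pr : Kernel E Ω}
  [IsMarkovKernel Pr] {X : ℝ≥0 → Ω → Config E}

/-- The first-branching equation for nonnegative functionals of linear statistics. -/
lemma lintegral_law_eq [Fintype ι] (hξ : Measurable fun q : ℝ≥0 × Ω₀ => ξ q.1 q.2)
    (hγ : Measurable γ) (hX : IsBranchingMarkovProcess P ξ γ offspring Pr X) {f : ι → E → ℝ≥0}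
    (hf : ∀ i, Measurable (f i)) [IsMarkovKernel (vecKernel Pr X f)]
    [IsFiniteKernel (killedKernel P ξ γ)] (t : ℝ≥0) (x : E) {H : (ι → ℝ≥0) → ℝ≥0∞}
    (hH : Measurable H) (hH0 : H 0 = 0) :
    ∫⁻ ω, H (vec f (X t ω)) ∂(Pr x) =
      ∫⁻ y, H (fun i => f i y) ∂(killedKernel P ξ γ (t, x)) +
      ∫⁻ s in Set.Ioo (0 : ℝ) t, ∫⁻ y, γ y * ∫⁻ c, ∫⁻ z, H (∑ j, z j)
        ∂(Measure.pi fun j => vecKernel Pr X f (t - s.toNNReal, c.2 j))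
        ∂(offspring y) ∂(killedKernel P ξ γ (s.toNNReal, x)) := by
  have hvt : Measurable fun ω => vec f (X t ω) :=
    measurable_vec_comp hX.measurable hf t
  have hfm : Measurable fun (y : E) (i : ι) => f i y := measurable_pi_lambda _ hf
  rw [← lintegral_map hH hvt, law_eq hξ hγ hX hf, lintegral_add_measure, lintegral_add_measure,
    lintegral_map hH hfm, lintegral_smul_measure, lintegral_dirac' _ hH,
    lintegral_branchedLaw _ hγ _ _ _ _ hH, hH0, smul_zero, add_zero]
  simp_rw [lintegral_superpose _ _ _ hH]

lemma min_sum_le_sum_min {α : Type*} (s : Finset α) (z : α → ℝ≥0) (K : ℝ≥0) :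
    min (∑ j ∈ s, z j) K ≤ ∑ j ∈ s, min (z j) K := by
  classical
  induction s using Finset.induction_on with
  | empty => simp
  | insert a s ha ih =>
    rw [Finset.sum_insert ha, Finset.sum_insert ha]
    rcases le_total (z a) K with h | h
    · rw [min_eq_left h]
      rcases le_total (∑ j ∈ s, z j) K with h' | h'
      · rw [min_eq_left h'] at ih
        exact (min_le_left _ _).trans (by gcongr)
      · rw [min_eq_right h'] at ih
        exact (min_le_right _ _).trans (ih.trans (le_add_of_nonneg_left (zero_le)))
    · rw [min_eq_right h]
      exact (min_le_right _ _).trans (le_add_of_nonneg_right (zero_le))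

/-- Truncation is subadditive and the power-mean inequality costs `n ^ m`. Together with the `n`
summands this calls for exactly the offspring moment of order `m + 1`. -/
lemma min_sum_pow_le {n : ℕ} (z : Fin n → ℝ≥0) (K : ℝ≥0) (m : ℕ) :
    min (∑ j, z j) K ^ (m + 1) ≤ (n : ℝ≥0) ^ m * ∑ j, min (z j) K ^ (m + 1) := by
  have h1 : min (∑ j, z j) K ^ (m + 1) ≤ (∑ j, min (z j) K) ^ (m + 1) :=
    pow_le_pow_left₀ zero_le (min_sum_le_sum_min _ _ _) _
  refine h1.trans ?_
  rw [← NNReal.coe_le_coe]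
  push_cast
  have h2 := pow_sum_le_card_mul_sum_pow (s := Finset.univ)
    (f := fun j => ((min (z j) K : ℝ≥0) : ℝ)) (fun j _ => NNReal.coe_nonneg _) m
  simpa using h2

/-- The truncated moments `𝔼_{δ_x} [(N_t ∧ K)^k]`. -/
noncomputable def truncMoment (Pr : Kernel E Ω) (X : ℝ≥0 → Ω → Config E) (k : ℕ) (K t : ℝ≥0)
    (x : E) : ℝ≥0∞ :=
  ∫⁻ ω, ((min ((X t ω).1 : ℝ≥0) K ^ k : ℝ≥0) : ℝ≥0∞) ∂(Pr x)

lemma truncMoment_le [IsFiniteKernel (killedKernel P ξ γ)]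
    (hξ : Measurable fun q : ℝ≥0 × Ω₀ => ξ q.1 q.2)
    (hγ : Measurable γ) {C : ℝ≥0} (hγC : ∀ y, γ y ≤ C)
    (hX : IsBranchingMarkovProcess P ξ γ offspring Pr X) {m : ℕ} {M : ℝ≥0}
    (hM : ∀ y, ∫⁻ c, (c.1 : ℝ≥0∞) ^ (m + 1) ∂(offspring y) ≤ M) (K : ℝ≥0) (t : ℝ≥0) (x : E) :
    truncMoment Pr X (m + 1) K t x ≤
      1 + (C * M : ℝ≥0) * ∫⁻ s in Set.Ioo (0 : ℝ) t,
        ⨆ y, truncMoment Pr X (m + 1) K (t - s.toNNReal) y := by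
  have hXm := hX.measurable
  let f : Unit → E → ℝ≥0 := fun _ _ => 1
  have hf : ∀ i, Measurable (f i) := fun i => measurable_const
  have : IsMarkovKernel (vecKernel Pr X f) := isMarkovKernel_vecKernel hXm hf
  let H : (Unit → ℝ≥0) → ℝ≥0∞ := fun z => ((min (z ()) K ^ (m + 1) : ℝ≥0) : ℝ≥0∞)
  have hH : Measurable H := by fun_prop
  have hvec : ∀ c : Config E, vec f c () = c.1 := fun c => by simp [vec, f]
  have htr : ∀ u y, ∫⁻ z, H z ∂(vecKernel Pr X f (u, y)) = truncMoment Pr X (m + 1) K u y := by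
    intro u y
    rw [vecKernel_apply hXm hf, lintegral_map hH (measurable_vec_comp hXm hf u), truncMoment]
    exact lintegral_congr fun ω => by simp only [H, hvec]
  have hmain := lintegral_law_eq hξ hγ hX hf t x hH (by simp [H])
  have hlhs : ∫⁻ ω, H (vec f (X t ω)) ∂(Pr x) = truncMoment Pr X (m + 1) K t x :=
    lintegral_congr fun ω => by simp only [H, hvec]
  rw [← hlhs, hmain]
  have hS1 : ∀ u, killedKernel P ξ γ (u, x) Set.univ ≤ 1 := fun u => killedKernel_univ_le hξ hγ _
  refine add_le_add ?_ ?_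
  · calc _ ≤ ∫⁻ y, 1 ∂(killedKernel P ξ γ (t, x)) := by
          refine lintegral_mono fun y => ?_
          simp only [H, f]
          rw [← ENNReal.coe_one, ENNReal.coe_le_coe]
          exact pow_le_one₀ zero_le (min_le_left _ _)
      _ ≤ 1 := by rw [lintegral_one]; exact hS1 t
  · calc _ ≤ ∫⁻ s in Set.Ioo (0 : ℝ) t, (C * M : ℝ≥0) *
            ⨆ y, truncMoment Pr X (m + 1) K (t - s.toNNReal) y := by
          refine lintegral_mono fun s => ?_
          set a := ⨆ y, truncMoment Pr X (m + 1) K (t - s.toNNReal) y with ha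
          have hin : ∀ c : Config E, ∫⁻ z, H (∑ j, z j)
              ∂(Measure.pi fun j => vecKernel Pr X f (t - s.toNNReal, c.2 j)) ≤
              (c.1 : ℝ≥0∞) ^ (m + 1) * a := by
            intro c
            calc _ ≤ ∫⁻ z, (c.1 : ℝ≥0∞) ^ m * ∑ j, H (z j)
                  ∂(Measure.pi fun j => vecKernel Pr X f (t - s.toNNReal, c.2 j)) := by
                  refine lintegral_mono fun z => ?_
                  simp only [H, Finset.sum_apply]
                  exact_mod_cast min_sum_pow_le (fun j => z j ()) K m
              _ = (c.1 : ℝ≥0∞) ^ m * ∑ j, truncMoment Pr X (m + 1) K (t - s.toNNReal) (c.2 j) := by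
                  have hHj : ∀ j, Measurable fun z : Fin c.1 → Unit → ℝ≥0 => H (z j) :=
                    fun j => hH.comp (measurable_pi_apply j)
                  rw [lintegral_const_mul _ (Finset.measurable_fun_sum _ fun j _ => hHj j),
                    lintegral_finsetSum _ fun j _ => hHj j]
                  congr 1
                  refine Finset.sum_congr rfl fun j _ => ?_
                  rw [← htr, ← (measurePreserving_eval (fun j => vecKernel Pr X f
                    (t - s.toNNReal, c.2 j)) j).lintegral_comp hH]
              _ ≤ (c.1 : ℝ≥0∞) ^ m * ∑ j : Fin c.1, a := by
                  gcongr with j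
                  exact le_iSup (fun y => truncMoment Pr X (m + 1) K (t - s.toNNReal) y) _
              _ = _ := by
                  rw [Finset.sum_const, Finset.card_univ, Fintype.card_fin, nsmul_eq_mul, pow_succ,
                    mul_assoc]
          calc _ ≤ ∫⁻ y, C * (M * a) ∂(killedKernel P ξ γ (s.toNNReal, x)) := by
                refine lintegral_mono fun y => ?_
                refine mul_le_mul' (ENNReal.coe_le_coe.2 (hγC y)) ?_
                calc _ ≤ ∫⁻ c, (c.1 : ℝ≥0∞) ^ (m + 1) * a ∂(offspring y) := lintegral_mono hin
                  _ = (∫⁻ c, (c.1 : ℝ≥0∞) ^ (m + 1) ∂(offspring y)) * a := by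
                    rw [lintegral_mul_const]
                    exact ((measurable_of_countable (fun n : ℕ => (n : ℝ≥0∞))).comp
                      measurable_config_card).pow_const _
                  _ ≤ M * a := mul_le_mul' (hM y) le_rfl
            _ ≤ C * (M * a) * 1 := by
                rw [lintegral_const]
                exact mul_le_mul' le_rfl (hS1 _)
            _ = _ := by rw [mul_one, ENNReal.coe_mul, mul_assoc]
      _ ≤ _ := by rw [lintegral_const_mul' _ _ ENNReal.coe_ne_top]

/-- Exponential bound for the moments of the number of particles. -/
theorem lintegral_card_pow_le (hξ : Measurable fun q : ℝ≥0 × Ω₀ => ξ q.1 q.2)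
    (hγ : Measurable γ) {C : ℝ≥0} (hγC : ∀ y, γ y ≤ C)
    (hX : IsBranchingMarkovProcess P ξ γ offspring Pr X) {m : ℕ} {M : ℝ≥0}
    (hM : ∀ y, ∫⁻ c, (c.1 : ℝ≥0∞) ^ (m + 1) ∂(offspring y) ≤ M) (t : ℝ≥0) (x : E) :
    ∫⁻ ω, ((X t ω).1 : ℝ≥0∞) ^ (m + 1) ∂(Pr x) ≤
      2 * ENNReal.ofReal (Real.exp ((2 * (C * M) + 1) * t)) := by
  have := isFiniteKernel_killedKernel (P := P) hξ hγ
  have htr : ∀ K : ℝ≥0, truncMoment Pr X (m + 1) K t x ≤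
      2 * ENNReal.ofReal (Real.exp ((2 * (C * M) + 1) * t)) := by
    intro K
    -- Truncation at `K` supplies the a priori bound that Grönwall needs. The conclusion is
    -- independent of `K`, so monotone convergence removes the truncation.
    have h := gronwall_iSup (truncMoment Pr X (m + 1) K) 1 (C * M) (K ^ (m + 1)) ?_ ?_ t x
    · simpa using h
    · intro t x
      calc _ ≤ ∫⁻ ω, ((K ^ (m + 1) : ℝ≥0) : ℝ≥0∞) ∂(Pr x) := by
            refine lintegral_mono fun ω => ENNReal.coe_le_coe.2 ?_
            exact pow_le_pow_left₀ zero_le (min_le_right _ _) _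
        _ = _ := by simp
    · intro t x
      simpa using truncMoment_le hξ hγ hγC hX hM K t x
  have hN : Measurable fun ω => ((X t ω).1 : ℝ≥0) :=
    ((measurable_of_countable (fun n : ℕ => (n : ℝ≥0))).comp measurable_config_card).comp
      (hX.measurable.comp measurable_prodMk_left)
  have hsup : ∫⁻ ω, ((X t ω).1 : ℝ≥0∞) ^ (m + 1) ∂(Pr x) =
      ⨆ K : ℕ, truncMoment Pr X (m + 1) K t x := by
    unfold truncMoment
    rw [← lintegral_iSup]
    · refine lintegral_congr fun ω => le_antisymm ?_ ?_
      · refine le_iSup_of_le (X t ω).1 ?_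
        simp
      · refine iSup_le fun K => ?_
        have : min ((X t ω).1 : ℝ≥0) K ^ (m + 1) ≤ ((X t ω).1 : ℝ≥0) ^ (m + 1) :=
          pow_le_pow_left₀ zero_le (min_le_left _ _) _
        exact_mod_cast this
    · intro K
      fun_prop
    · intro K K' hK ω
      refine ENNReal.coe_le_coe.2 (pow_le_pow_left₀ zero_le (min_le_min le_rfl ?_) _)
      exact_mod_cast hK
  rw [hsup]
  exact iSup_le fun K => htr K

end Moments

/-! ### Maps as partitions with injectively labelled blocks -/

section Partitions

variable {ι : Type*} [DecidableEq ι] {A : Finset ι} {n : ℕ}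

/-- The fibre of `φ : A → Fin n` over `j`, as a finite set. -/
def fiber (φ : A → Fin n) (j : Fin n) : Finset ι :=
  (Finset.univ.filter fun i => φ i = j).map (Function.Embedding.subtype _)

lemma mem_fiber {φ : A → Fin n} {j : Fin n} {i : ι} :
    i ∈ fiber φ j ↔ ∃ h : i ∈ A, φ ⟨i, h⟩ = j := by
  simp [fiber]

lemma fiber_subset (φ : A → Fin n) (j : Fin n) : fiber φ j ⊆ A := fun _ h => (mem_fiber.1 h).1

/-- The map that sends each element to the label of its block. -/
def blockLabel (p : Σ σ : Finpartition A, {B // B ∈ σ.parts} ↪ Fin n) (i : A) : Fin n :=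
  p.2 ⟨p.1.part i.1, p.1.part_mem.2 i.2⟩

lemma fiber_blockLabel (p : Σ σ : Finpartition A, {B // B ∈ σ.parts} ↪ Fin n)
    (B : {B // B ∈ p.1.parts}) : fiber (blockLabel p) (p.2 B) = B.1 := by
  ext i
  rw [mem_fiber]
  constructor
  · rintro ⟨h, he⟩
    have := p.2.injective he
    rw [← this]
    exact p.1.mem_part h
  · intro hi
    have hA : i ∈ A := p.1.le B.2 hi
    refine ⟨hA, ?_⟩
    unfold blockLabel
    congr 1
    exact Subtype.ext (p.1.part_eq_of_mem B.2 hi)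

lemma fiber_blockLabel_of_notMem (p : Σ σ : Finpartition A, {B // B ∈ σ.parts} ↪ Fin n)
    {j : Fin n} (hj : j ∉ Set.range p.2) : fiber (blockLabel p) j = ∅ := by
  refine Finset.eq_empty_of_forall_notMem fun i hi => ?_
  obtain ⟨h, he⟩ := mem_fiber.1 hi
  exact hj ⟨_, he⟩

lemma blockLabel_of_mem (p : Σ σ : Finpartition A, {B // B ∈ σ.parts} ↪ Fin n)
    (B : {B // B ∈ p.1.parts}) {i : ι} (hi : i ∈ B.1) (hA : i ∈ A) :
    blockLabel p ⟨i, hA⟩ = p.2 B := by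
  rw [← fiber_blockLabel p B, mem_fiber] at hi
  exact hi.2

/-- Each block is the fibre over its own label, so the blocks are recovered from the map, and a
label is the value of the map at any point of the block. -/
lemma blockLabel_injective : Function.Injective
    (blockLabel : (Σ σ : Finpartition A, {B // B ∈ σ.parts} ↪ Fin n) → A → Fin n) := by
  have key : ∀ p q : (Σ σ : Finpartition A, {B // B ∈ σ.parts} ↪ Fin n),
      blockLabel p = blockLabel q → p.1.parts ⊆ q.1.parts := by
    intro p q h B hB
    obtain ⟨i, hi⟩ := p.1.nonempty_of_mem_parts hB
    have hA : i ∈ A := p.1.le hB hi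
    have h1 := fiber_blockLabel p ⟨B, hB⟩
    have h2 := fiber_blockLabel q ⟨q.1.part i, q.1.part_mem.2 hA⟩
    rw [← blockLabel_of_mem p ⟨B, hB⟩ hi hA] at h1
    have h3 : q.2 ⟨q.1.part i, q.1.part_mem.2 hA⟩ = blockLabel q ⟨i, hA⟩ := rfl
    rw [h3, ← h, h1] at h2
    simp only at h2
    rw [h2]
    exact q.1.part_mem.2 hA
  rintro ⟨σ, e⟩ ⟨τ, e'⟩ h
  have hσ : σ = τ := Finpartition.ext ((key _ _ h).antisymm (key _ _ h.symm))
  subst hσ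
  congr 1
  ext1 B
  obtain ⟨i, hi⟩ := σ.nonempty_of_mem_parts B.2
  have hA : i ∈ A := σ.le B.2 hi
  have h1 := blockLabel_of_mem ⟨σ, e⟩ B hi hA
  have h2 := blockLabel_of_mem ⟨σ, e'⟩ B hi hA
  rw [h] at h1
  exact h1.symm.trans h2

lemma blockLabel_surjective : Function.Surjective
    (blockLabel : (Σ σ : Finpartition A, {B // B ∈ σ.parts} ↪ Fin n) → A → Fin n) := by
  intro φ
  have huniq : ∀ {i : ι} {j j' : Fin n}, i ∈ fiber φ j → i ∈ fiber φ j' → j = j' := by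
    intro i j j' h h'
    obtain ⟨_, h1⟩ := mem_fiber.1 h
    obtain ⟨_, h2⟩ := mem_fiber.1 h'
    exact h1.symm.trans h2
  -- The blocks are the nonempty fibres. Labels that are not attained all give the empty fibre,
  -- which is no block and must be erased.
  let σ : Finpartition A := Finpartition.ofExistsUnique ((Finset.univ.image (fiber φ)).erase ∅)
    (by
      intro B hB
      obtain ⟨j, -, rfl⟩ := Finset.mem_image.1 (Finset.mem_of_mem_erase hB)
      exact fiber_subset φ j)
    (by
      intro i hi
      have hmem : i ∈ fiber φ (φ ⟨i, hi⟩) := mem_fiber.2 ⟨hi, rfl⟩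
      refine ⟨fiber φ (φ ⟨i, hi⟩), ⟨Finset.mem_erase.2 ⟨Finset.ne_empty_of_mem hmem,
        Finset.mem_image_of_mem _ (Finset.mem_univ _)⟩, hmem⟩, ?_⟩
      rintro B ⟨hB, hiB⟩
      obtain ⟨j, -, rfl⟩ := Finset.mem_image.1 (Finset.mem_of_mem_erase hB)
      exact congrArg _ (huniq hiB hmem))
    (by simp)
  have hσ : σ.parts = (Finset.univ.image (fiber φ)).erase ∅ := rfl
  have hlab : ∀ B : {B // B ∈ σ.parts}, ∃ j, fiber φ j = B.1 := by
    rintro ⟨B, hB⟩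
    rw [hσ] at hB
    obtain ⟨j, -, rfl⟩ := Finset.mem_image.1 (Finset.mem_of_mem_erase hB)
    exact ⟨j, rfl⟩
  choose lab hlab using hlab
  refine ⟨⟨σ, ⟨lab, fun B B' h => Subtype.ext ?_⟩⟩, ?_⟩
  · rw [← hlab B, ← hlab B', h]
  · ext1 i
    have h1 : i.1 ∈ fiber φ (lab ⟨σ.part i.1, σ.part_mem.2 i.2⟩) := by
      rw [hlab]
      exact σ.mem_part i.2
    exact (mem_fiber.1 h1).2.symm

/-- A sum over maps is a sum over partitions together with injective labellings of the blocks. -/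
theorem sum_prod_fiber {R : Type*} [CommSemiring R] (A : Finset ι) (n : ℕ)
    (g : Finset ι → Fin n → R) (hg : ∀ j, g ∅ j = 1) :
    ∑ φ : A → Fin n, ∏ j, g (fiber φ j) j =
      ∑ σ : Finpartition A, ∑ e : {B // B ∈ σ.parts} ↪ Fin n,
        ∏ B : {B // B ∈ σ.parts}, g B.1 (e B) := by
  rw [← Fintype.sum_sigma' (fun (σ : Finpartition A) (e : {B // B ∈ σ.parts} ↪ Fin n) =>
    ∏ B : {B // B ∈ σ.parts}, g B.1 (e B))]
  refine (Fintype.sum_bijective blockLabel ⟨blockLabel_injective, blockLabel_surjective⟩ _ _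
    fun p => ?_).symm
  calc ∏ B : {B // B ∈ p.1.parts}, g B.1 (p.2 B)
      = ∏ B : {B // B ∈ p.1.parts}, g (fiber (blockLabel p) (p.2 B)) (p.2 B) :=
        Finset.prod_congr rfl fun B _ => by rw [fiber_blockLabel p B]
    _ = ∏ j ∈ Finset.univ.map p.2, g (fiber (blockLabel p) j) j := by rw [Finset.prod_map]
    _ = ∏ j, g (fiber (blockLabel p) j) j := by
        refine Finset.prod_subset (Finset.subset_univ _) fun j _ hj => ?_
        rw [fiber_blockLabel_of_notMem p, hg]
        rintro ⟨B, rfl⟩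
        exact hj (Finset.mem_map_of_mem _ (Finset.mem_univ _))

/-- The product over `A` of sums, as a sum over maps, grouped by fibres. -/
theorem prod_sum_eq_sum_fiber {R : Type*} [CommSemiring R] (A : Finset ι) (n : ℕ)
    (z : Fin n → ι → R) :
    ∏ i ∈ A, ∑ j, z j i = ∑ φ : A → Fin n, ∏ j, ∏ i ∈ fiber φ j, z j i := by
  rw [← Finset.prod_coe_sort, Finset.prod_univ_sum, Fintype.piFinset_univ]
  refine Finset.sum_congr rfl fun φ _ => ?_
  rw [← Finset.prod_fiberwise (s := Finset.univ) (g := φ)]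
  refine Finset.prod_congr rfl fun j _ => ?_
  rw [fiber, Finset.prod_map]
  refine Finset.prod_congr rfl fun i hi => ?_
  rw [(Finset.mem_filter.1 hi).2]
  rfl

/-- The contribution of the one-block partition. -/
lemma sum_filter_parts_eq {R : Type*} [CommSemiring R] {A : Finset ι} (hA : A.Nonempty) (n : ℕ)
    (g : Finset ι → Fin n → R) :
    ∑ σ : Finpartition A with σ.parts = {A}, ∑ e : {B // B ∈ σ.parts} ↪ Fin n,
      ∏ B : {B // B ∈ σ.parts}, g B.1 (e B) = ∑ j, g A j := by
  have h1 : (Finset.univ.filter fun σ : Finpartition A => σ.parts = {A}) =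
      {Finpartition.indiscrete hA.ne_empty} := by
    ext σ
    simp only [Finset.mem_filter, Finset.mem_univ, true_and, Finset.mem_singleton]
    exact ⟨fun h => Finpartition.ext h, fun h => by rw [h]; rfl⟩
  rw [h1, Finset.sum_singleton]
  let u : Unique {B // B ∈ (Finpartition.indiscrete hA.ne_empty : Finpartition A).parts} :=
    { default := ⟨A, Finset.mem_singleton_self A⟩
      uniq := fun B => Subtype.ext (Finset.mem_singleton.1 B.2) }
  rw [← Equiv.sum_comp (Equiv.uniqueEmbeddingEquivResult).symm]
  refine Finset.sum_congr rfl fun j _ => ?_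
  rw [Fintype.prod_unique]
  rfl

/-- Sums over maps split into the one-block partition and the others. -/
theorem sum_prod_fiber_eq_add {R : Type*} [CommSemiring R] {A : Finset ι} (hA : A.Nonempty)
    (n : ℕ) (g : Finset ι → Fin n → R) (hg : ∀ j, g ∅ j = 1) :
    ∑ φ : A → Fin n, ∏ j, g (fiber φ j) j = ∑ j, g A j +
      ∑ σ : Finpartition A with σ.parts ≠ {A}, ∑ e : {B // B ∈ σ.parts} ↪ Fin n,
        ∏ B : {B // B ∈ σ.parts}, g B.1 (e B) := by
  rw [sum_prod_fiber A n g hg, ← sum_filter_parts_eq hA,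
    Finset.sum_filter_add_sum_filter_not]

/-- The number of labelled partitions other than the one-block one. -/
lemma sum_card_embedding_le (A : Finset ι) (n : ℕ) :
    ∑ σ : Finpartition A with σ.parts ≠ {A}, Fintype.card ({B // B ∈ σ.parts} ↪ Fin n) ≤
      n ^ A.card := by
  have h := sum_prod_fiber A n (fun _ _ => (1 : ℕ)) fun _ => rfl
  simp only [Finset.prod_const_one, Finset.sum_const, smul_eq_mul, mul_one, Finset.card_univ,
    Fintype.card_fun, Fintype.card_fin, Fintype.card_coe] at h
  rw [h]
  exact Finset.sum_le_sum_of_subset (Finset.filter_subset _ _)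

end Partitions


/-! ### The branching operator -/

/-- Telescoping over the factors. Errors are measured relative to the bounds `a b`, so that the
estimate for a product has again the same relative form and can be used recursively. -/
lemma norm_prod_sub_prod_le {α : Type*} (s : Finset α) (x y : α → ℂ) (a : α → ℝ) {ε : ℝ}
    (hε : 0 ≤ ε) (hx : ∀ b ∈ s, ‖x b‖ ≤ a b) (hy : ∀ b ∈ s, ‖y b‖ ≤ a b)
    (hxy : ∀ b ∈ s, ‖x b - y b‖ ≤ ε * a b) :
    ‖∏ b ∈ s, x b - ∏ b ∈ s, y b‖ ≤ s.card * ε * ∏ b ∈ s, a b := by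
  classical
  induction s using Finset.induction_on with
  | empty => simp
  | insert b s hb ih =>
    have ih' := ih (fun b' h => hx b' (Finset.mem_insert_of_mem h))
      (fun b' h => hy b' (Finset.mem_insert_of_mem h))
      (fun b' h => hxy b' (Finset.mem_insert_of_mem h))
    have ha : ∀ b' ∈ s, 0 ≤ a b' := fun b' h =>
      (norm_nonneg _).trans (hx b' (Finset.mem_insert_of_mem h))
    have hb1 := hx b (Finset.mem_insert_self b s)
    have hb2 := hxy b (Finset.mem_insert_self b s)
    have hys : ‖∏ b ∈ s, y b‖ ≤ ∏ b ∈ s, a b := by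
      rw [norm_prod]
      exact Finset.prod_le_prod (fun _ _ => norm_nonneg _)
        fun b' h => hy b' (Finset.mem_insert_of_mem h)
    rw [Finset.prod_insert hb, Finset.prod_insert hb, Finset.prod_insert hb,
      Finset.card_insert_of_notMem hb]
    have : x b * ∏ b ∈ s, x b - y b * ∏ b ∈ s, y b =
        x b * (∏ b ∈ s, x b - ∏ b ∈ s, y b) + (x b - y b) * ∏ b ∈ s, y b := by ring
    rw [this]
    have hp : 0 ≤ ∏ b ∈ s, a b := Finset.prod_nonneg ha
    have ha0 : 0 ≤ a b := (norm_nonneg _).trans hb1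
    calc _ ≤ ‖x b‖ * ‖∏ b ∈ s, x b - ∏ b ∈ s, y b‖ + ‖x b - y b‖ * ‖∏ b ∈ s, y b‖ := by
          refine (norm_add_le _ _).trans ?_
          rw [norm_mul, norm_mul]
      _ ≤ a b * (s.card * ε * ∏ b ∈ s, a b) + (ε * a b) * ∏ b ∈ s, a b := by
          gcongr
      _ = _ := by
          push_cast
          ring

section Zeta

variable {E α ι : Type*} [MeasurableSpace E] [MeasurableSpace α] [DecidableEq ι] {A : Finset ι}

/-- The sum inside the expectation that defines `ζ_A[g]`. -/
noncomputable def zetaSum (A : Finset ι) (g : Finset ι → E → ℂ) (c : Config E) : ℂ :=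
  ∑ σ : Finpartition A with σ.parts ≠ {A},
    ∑ e : {B // B ∈ σ.parts} ↪ Fin c.1, ∏ B : {B // B ∈ σ.parts}, g B.1 (c.2 (e B))

lemma zeta_eq (off : Kernel E (Config E)) (A : Finset ι) (g : Finset ι → E → ℂ) (x : E) :
    zeta off A g x = ∫ c, zetaSum A g c ∂(off x) := rfl

lemma ssubset_of_mem_parts {σ : Finpartition A} (hσ : σ.parts ≠ {A}) {B : Finset ι}
    (hB : B ∈ σ.parts) : B ⊂ A := by
  refine (σ.le hB).ssubset_of_ne ?_
  rintro rfl
  refine hσ (Finset.eq_singleton_iff_unique_mem.2 ⟨hB, fun B' hB' => ?_⟩)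
  obtain ⟨i, hi⟩ := σ.nonempty_of_mem_parts hB'
  exact σ.eq_of_mem_parts hB' hB hi (σ.le hB' hi)

lemma prod_parts {R : Type*} [CommMonoid R] (σ : Finpartition A) (w : ι → R) :
    ∏ B ∈ σ.parts, ∏ i ∈ B, w i = ∏ i ∈ A, w i := by
  conv_rhs => rw [← σ.biUnion_parts]
  rw [Finset.prod_biUnion σ.disjoint]
  rfl

lemma measurable_zetaSum {G : α → Finset ι → E → ℂ}
    (hG : ∀ B, B ⊂ A → Measurable fun p : α × E => G p.1 B p.2) :
    Measurable fun p : α × Config E => zetaSum A (G p.1) p.2 := by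
  refine measurable_of_config fun n => ?_
  change Measurable fun p : α × (Fin n → E) => ∑ σ : Finpartition A with σ.parts ≠ {A},
    ∑ e : {B // B ∈ σ.parts} ↪ Fin n, ∏ B : {B // B ∈ σ.parts}, G p.1 B.1 (p.2 (e B))
  refine Finset.measurable_fun_sum _ fun σ hσ => Finset.measurable_fun_sum _ fun e _ =>
    Finset.measurable_fun_prod _ fun B _ => ?_
  exact (hG B.1 (ssubset_of_mem_parts (Finset.mem_filter.1 hσ).2 B.2)).comp
    (f := fun p : α × (Fin n → E) => (p.1, p.2 (e B))) (by fun_prop)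

lemma measurable_zeta (off : Kernel E (Config E)) [IsMarkovKernel off]
    {G : α → Finset ι → E → ℂ} (hG : ∀ B, B ⊂ A → Measurable fun p : α × E => G p.1 B p.2) :
    Measurable fun p : α × E => zeta off A (G p.1) p.2 := by
  have h := measurable_zetaSum hG
  have h2 := StronglyMeasurable.integral_kernel_prod_right
    (κ := off.comap (Prod.snd : α × E → E) measurable_snd)
    (f := fun (p : α × E) (c : Config E) => zetaSum A (G p.1) c)
    (h.comp (f := fun q : (α × E) × Config E => (q.1.1, q.2)) (by fun_prop)).stronglyMeasurable
  exact h2.measurable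

lemma zetaSum_congr {g g' : Finset ι → E → ℂ} (h : ∀ B, B ⊂ A → g B = g' B) (c : Config E) :
    zetaSum A g c = zetaSum A g' c := by
  refine Finset.sum_congr rfl fun σ hσ => Finset.sum_congr rfl fun e _ =>
    Finset.prod_congr rfl fun B _ => ?_
  rw [h B.1 (ssubset_of_mem_parts (Finset.mem_filter.1 hσ).2 B.2)]

lemma zeta_congr (off : Kernel E (Config E)) {g g' : Finset ι → E → ℂ}
    (h : ∀ B, B ⊂ A → g B = g' B) (x : E) : zeta off A g x = zeta off A g' x := by
  rw [zeta_eq, zeta_eq]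
  simp_rw [zetaSum_congr h]

/-- The blocks of a partition cover `A` exactly once, so multiplicative weights on the blocks
combine into the weight of `A`, whatever the partition. -/
lemma zetaSum_mul (w : ι → ℂ) (g : Finset ι → E → ℂ) (c : Config E) :
    zetaSum A (fun B y => (∏ i ∈ B, w i) * g B y) c = (∏ i ∈ A, w i) * zetaSum A g c := by
  unfold zetaSum
  rw [Finset.mul_sum]
  refine Finset.sum_congr rfl fun σ _ => ?_
  rw [Finset.mul_sum]
  refine Finset.sum_congr rfl fun e _ => ?_
  rw [Finset.prod_mul_distrib, ← prod_parts σ w, ← Finset.prod_coe_sort σ.parts]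

lemma zeta_mul (off : Kernel E (Config E)) (w : ι → ℂ) (g : Finset ι → E → ℂ) (x : E) :
    zeta off A (fun B y => (∏ i ∈ B, w i) * g B y) x = (∏ i ∈ A, w i) * zeta off A g x := by
  simp_rw [zeta_eq, zetaSum_mul]
  exact integral_const_mul _ _

/-- Each labelled partition contributes a difference of products with at most `|A|` factors. There
are at most `N ^ |A|` labelled partitions, so offspring moments of order `|A|` suffice. -/
lemma norm_zetaSum_sub_le {g g' : Finset ι → E → ℂ} {a : Finset ι → ℝ} {ε W : ℝ} (hε : 0 ≤ ε)
    (hW : 0 ≤ W)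
    (hg : ∀ B, B ⊂ A → B.Nonempty → ∀ y, ‖g B y‖ ≤ a B)
    (hg' : ∀ B, B ⊂ A → B.Nonempty → ∀ y, ‖g' B y‖ ≤ a B)
    (hgg : ∀ B, B ⊂ A → B.Nonempty → ∀ y, ‖g B y - g' B y‖ ≤ ε * a B)
    (ha : ∀ σ : Finpartition A, σ.parts ≠ {A} → ∏ B ∈ σ.parts, a B ≤ W) (c : Config E) :
    ‖zetaSum A g c - zetaSum A g' c‖ ≤ (A.card * ε * W) * (c.1 : ℝ) ^ A.card := by
  unfold zetaSum
  rw [← Finset.sum_sub_distrib]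
  calc _ ≤ ∑ σ : Finpartition A with σ.parts ≠ {A},
        ∑ e : {B // B ∈ σ.parts} ↪ Fin c.1, A.card * ε * W := by
        refine norm_sum_le_of_le _ fun σ hσ => ?_
        rw [← Finset.sum_sub_distrib]
        refine norm_sum_le_of_le _ fun e _ => ?_
        have hσ' := (Finset.mem_filter.1 hσ).2
        have hsub := fun B : {B // B ∈ σ.parts} => ssubset_of_mem_parts hσ' B.2
        have hne := fun B : {B // B ∈ σ.parts} => σ.nonempty_of_mem_parts B.2
        refine (norm_prod_sub_prod_le Finset.univ _ _ (fun B => a B.1) hε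
          (fun B _ => hg B.1 (hsub B) (hne B) _) (fun B _ => hg' B.1 (hsub B) (hne B) _)
          (fun B _ => hgg B.1 (hsub B) (hne B) _)).trans ?_
        rw [Finset.prod_coe_sort σ.parts a]
        have h1 : ((Finset.univ : Finset {B // B ∈ σ.parts}).card : ℝ) ≤ A.card := by
          rw [Finset.card_univ, Fintype.card_coe]
          exact_mod_cast σ.card_parts_le_card
        have h2 := ha σ hσ'
        have h3 : (0 : ℝ) ≤ A.card * ε := by positivity
        calc _ ≤ ((Finset.univ : Finset {B // B ∈ σ.parts}).card : ℝ) * ε * W := by gcongr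
          _ ≤ _ := by gcongr
    _ = (A.card * ε * W) * ((∑ σ : Finpartition A with σ.parts ≠ {A},
        Fintype.card ({B // B ∈ σ.parts} ↪ Fin c.1) : ℕ) : ℝ) := by
        push_cast
        rw [Finset.mul_sum]
        refine Finset.sum_congr rfl fun σ _ => ?_
        rw [Finset.sum_const, Finset.card_univ, nsmul_eq_mul, mul_comm]
    _ ≤ _ := by
        refine mul_le_mul_of_nonneg_left ?_ (by positivity)
        exact_mod_cast sum_card_embedding_le A c.1

lemma norm_zetaSum_le (hA : A.Nonempty) {g : Finset ι → E → ℂ} {a : Finset ι → ℝ} {W : ℝ}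
    (hW : 0 ≤ W) (hg : ∀ B, B ⊂ A → B.Nonempty → ∀ y, ‖g B y‖ ≤ a B)
    (ha : ∀ σ : Finpartition A, σ.parts ≠ {A} → ∏ B ∈ σ.parts, a B ≤ W) (c : Config E) :
    ‖zetaSum A g c‖ ≤ (A.card * W) * (c.1 : ℝ) ^ A.card := by
  -- Nonemptiness of `A` matters: every partition then has a block, so no empty product equal to `1`
  -- survives. The bound is the difference estimate against zero with `ε = 1`.
  have h0 : zetaSum A (fun _ _ => 0) c = 0 := by
    refine Finset.sum_eq_zero fun σ _ => Finset.sum_eq_zero fun e _ => ?_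
    obtain ⟨B, hB⟩ := σ.parts_nonempty hA.ne_empty
    exact Finset.prod_eq_zero (Finset.mem_univ (⟨B, hB⟩ : {B // B ∈ σ.parts})) rfl
  have h := norm_zetaSum_sub_le (g := g) (g' := fun _ _ => 0) zero_le_one hW hg
    (fun B h h' y => by rw [norm_zero]; exact (norm_nonneg _).trans (hg B h h' y))
    (fun B h h' y => by rw [sub_zero, one_mul]; exact hg B h h' y) ha c
  rwa [h0, sub_zero, mul_one] at h

section Moments

variable {off : Kernel E (Config E)} {k : ℕ} {M : ℝ}

/-- `∫ N^k` is finite and at most `M` under every offspring law. -/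
def OffspringMoment (off : Kernel E (Config E)) (k : ℕ) (M : ℝ) : Prop :=
  ∀ y, Integrable (fun c : Config E => (c.1 : ℝ) ^ k) (off y) ∧ ∫ c, (c.1 : ℝ) ^ k ∂(off y) ≤ M

/-- The exponent `j = 0` has to be excluded because of `0 ^ 0 = 1`. -/
lemma natCast_pow_le_pow (n : ℕ) {j k : ℕ} (hj : 1 ≤ j) (hk : j ≤ k) :
    (n : ℝ) ^ j ≤ (n : ℝ) ^ k := by
  rcases Nat.eq_zero_or_pos n with rfl | hn
  · simp [zero_pow (by omega : j ≠ 0), zero_pow (by omega : k ≠ 0)]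
  · exact pow_le_pow_right₀ (by exact_mod_cast hn) hk

lemma OffspringMoment.integrable_of_le (hM : OffspringMoment off k M) {F : Config E → ℂ}
    (hF : Measurable F) {j : ℕ} (hj : 1 ≤ j) (hk : j ≤ k) {D : ℝ} (hD : 0 ≤ D)
    (hFD : ∀ c, ‖F c‖ ≤ D * (c.1 : ℝ) ^ j) (y : E) : Integrable F (off y) := by
  refine ((hM y).1.const_mul D).mono' hF.aestronglyMeasurable (ae_of_all _ fun c => ?_)
  exact (hFD c).trans (mul_le_mul_of_nonneg_left (natCast_pow_le_pow _ hj hk) hD)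

lemma OffspringMoment.norm_integral_le (hM : OffspringMoment off k M) {F : Config E → ℂ}
    {j : ℕ} (hj : 1 ≤ j) (hk : j ≤ k) {D : ℝ} (hD : 0 ≤ D)
    (hFD : ∀ c, ‖F c‖ ≤ D * (c.1 : ℝ) ^ j) (y : E) : ‖∫ c, F c ∂(off y)‖ ≤ D * M := by
  calc _ ≤ ∫ c, D * (c.1 : ℝ) ^ k ∂(off y) := by
        refine norm_integral_le_of_norm_le ((hM y).1.const_mul D) (ae_of_all _ fun c => ?_)
        exact (hFD c).trans (mul_le_mul_of_nonneg_left (natCast_pow_le_pow _ hj hk) hD)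
    _ ≤ D * M := by
        rw [integral_const_mul]
        exact mul_le_mul_of_nonneg_left (hM y).2 hD

lemma OffspringMoment.nonneg (hM : OffspringMoment off k M) (y : E) : 0 ≤ M :=
  (integral_nonneg fun _ => by positivity).trans (hM y).2

lemma measurable_zetaSum_right {g : Finset ι → E → ℂ} (hg : ∀ B, B ⊂ A → Measurable (g B)) :
    Measurable (zetaSum A g) :=
  (measurable_zetaSum (α := Unit) (G := fun _ => g) fun B hB => (hg B hB).comp measurable_snd).comp
    (f := fun c : Config E => ((), c)) (by fun_prop)

lemma norm_zeta_sub_le (hM : OffspringMoment off k M) (hA : A.Nonempty) (hAk : A.card ≤ k)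
    {g g' : Finset ι → E → ℂ} {a : Finset ι → ℝ}
    {ε W : ℝ} (hε : 0 ≤ ε) (hW : 0 ≤ W)
    (hgm : ∀ B, B ⊂ A → Measurable (g B)) (hgm' : ∀ B, B ⊂ A → Measurable (g' B))
    (hg : ∀ B, B ⊂ A → B.Nonempty → ∀ y, ‖g B y‖ ≤ a B)
    (hg' : ∀ B, B ⊂ A → B.Nonempty → ∀ y, ‖g' B y‖ ≤ a B)
    (hgg : ∀ B, B ⊂ A → B.Nonempty → ∀ y, ‖g B y - g' B y‖ ≤ ε * a B)
    (ha : ∀ σ : Finpartition A, σ.parts ≠ {A} → ∏ B ∈ σ.parts, a B ≤ W) (x : E) :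
    ‖zeta off A g x - zeta off A g' x‖ ≤ (A.card * ε * W) * M := by
  have hA1 : 1 ≤ A.card := hA.card_pos
  have hint : Integrable (zetaSum A g) (off x) :=
    hM.integrable_of_le (measurable_zetaSum_right hgm) hA1 hAk (by positivity)
      (norm_zetaSum_le hA hW hg ha) x
  have hint' : Integrable (zetaSum A g') (off x) :=
    hM.integrable_of_le (measurable_zetaSum_right hgm') hA1 hAk (by positivity)
      (norm_zetaSum_le hA hW hg' ha) x
  rw [zeta_eq, zeta_eq, ← integral_sub hint hint']
  exact hM.norm_integral_le hA1 hAk (by positivity) (norm_zetaSum_sub_le hε hW hg hg' hgg ha) x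

lemma norm_zeta_le (hM : OffspringMoment off k M) (hA : A.Nonempty) (hAk : A.card ≤ k)
    {g : Finset ι → E → ℂ} {a : Finset ι → ℝ} {W : ℝ} (hW : 0 ≤ W)
    (hg : ∀ B, B ⊂ A → B.Nonempty → ∀ y, ‖g B y‖ ≤ a B)
    (ha : ∀ σ : Finpartition A, σ.parts ≠ {A} → ∏ B ∈ σ.parts, a B ≤ W) (x : E) :
    ‖zeta off A g x‖ ≤ (A.card * W) * M :=
  hM.norm_integral_le hA.card_pos hAk (by positivity) (norm_zetaSum_le hA hW hg ha) x

end Moments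

end Zeta


/-! ### The first-branching equation for complex functionals -/

lemma integrable_integral_compProd {α β : Type*} [MeasurableSpace α] [MeasurableSpace β]
    {μ : Measure α} [SFinite μ] {κ : Kernel α β} [IsSFiniteKernel κ] {f : α × β → ℂ}
    (hf : Integrable f (μ ⊗ₘ κ)) : Integrable (fun a => ∫ b, f (a, b) ∂(κ a)) μ := by
  have h := Integrable.integral_compProd (a := ()) (κ := Kernel.const Unit μ)
    (η := Kernel.prodMkLeft Unit κ) hf
  simpa using h

section

variable {E Ω₀ Ω ι : Type*} [MeasurableSpace E] [MeasurableSpace Ω₀] [MeasurableSpace Ω]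

lemma integral_branchedLaw (S : Kernel (ℝ≥0 × E) E) [IsFiniteKernel S] {γ : E → ℝ≥0}
    (hγ : Measurable γ) (off : Kernel E (Config E)) [IsMarkovKernel off]
    (κ : Kernel (ℝ≥0 × E) (ι → ℝ≥0)) [IsMarkovKernel κ] (t : ℝ≥0) (x : E)
    {H : (ι → ℝ≥0) → ℂ} (hH : Integrable H (branchedLaw S γ off κ t x)) :
    ∫ z, H z ∂(branchedLaw S γ off κ t x) =
      ∫ s in Set.Ioo (0 : ℝ) t, ∫ y, (γ y : ℂ) * ∫ c, ∫ z, H z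
        ∂(superpose κ (t - s.toNNReal, c)) ∂(off y) ∂(S (s.toNNReal, x)) := by
  rw [branchedLaw, Measure.comp_eq_comp_const_apply] at hH ⊢
  have h1 := hH.integral_comp
  rw [Kernel.integral_comp hH]
  simp only [Kernel.const_apply, Kernel.comap_apply] at h1 ⊢
  rw [branchMeasure] at h1 ⊢
  rw [Measure.integral_compProd h1]
  have h2 := integrable_integral_compProd h1
  rw [Measure.integral_compProd h2]
  simp only [Kernel.comap_apply]
  refine integral_congr_ae (ae_of_all _ fun s => ?_)
  simp only
  rw [Kernel.withDensity_apply _ (by fun_prop), Kernel.comap_apply,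
    integral_withDensity_eq_integral_smul hγ]
  refine integral_congr_ae (ae_of_all _ fun y => ?_)
  simp only [NNReal.smul_def, Complex.real_smul]

variable {P : Kernel E Ω₀} [IsMarkovKernel P] {ξ : ℝ≥0 → Ω₀ → E ⊕ Unit} {γ : E → ℝ≥0}
  {offspring : Kernel E (Config E)} [IsMarkovKernel offspring] {Pr : Kernel E Ω}
  [IsMarkovKernel Pr] {X : ℝ≥0 → Ω → Config E}

/-- The first-branching equation for complex functionals of linear statistics. -/
lemma integral_law_eq [Fintype ι] (hξ : Measurable fun q : ℝ≥0 × Ω₀ => ξ q.1 q.2)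
    (hγ : Measurable γ) (hX : IsBranchingMarkovProcess P ξ γ offspring Pr X) {f : ι → E → ℝ≥0}
    (hf : ∀ i, Measurable (f i)) [IsMarkovKernel (vecKernel Pr X f)]
    [IsFiniteKernel (killedKernel P ξ γ)] (t : ℝ≥0) (x : E) {H : (ι → ℝ≥0) → ℂ}
    (hH : Measurable H) (hH0 : H 0 = 0)
    (hint : Integrable (fun ω => H (vec f (X t ω))) (Pr x)) :
    ∫ ω, H (vec f (X t ω)) ∂(Pr x) =
      ∫ y, H (fun i => f i y) ∂(killedKernel P ξ γ (t, x)) +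
      ∫ s in Set.Ioo (0 : ℝ) t, ∫ y, (γ y : ℂ) * ∫ c, ∫ z, H (∑ j, z j)
        ∂(Measure.pi fun j => vecKernel Pr X f (t - s.toNNReal, c.2 j))
        ∂(offspring y) ∂(killedKernel P ξ γ (s.toNNReal, x)) := by
  have hvt := measurable_vec_comp hX.measurable hf t
  have hfm : Measurable fun (y : E) (i : ι) => f i y := measurable_pi_lambda _ hf
  have hmap : Integrable H ((Pr x).map fun ω => vec f (X t ω)) :=
    (integrable_map_measure hH.aestronglyMeasurable hvt.aemeasurable).2 hint
  rw [← integral_map hvt.aemeasurable hH.aestronglyMeasurable]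
  rw [law_eq hξ hγ hX hf] at hmap ⊢
  obtain ⟨h12, h3⟩ := integrable_add_measure.1 hmap
  obtain ⟨h1, h2⟩ := integrable_add_measure.1 h12
  rw [integral_add_measure h12 h3, integral_add_measure h1 h2,
    integral_map hfm.aemeasurable hH.aestronglyMeasurable, integral_smul_measure,
    integral_dirac' _ _ hH.stronglyMeasurable, hH0, smul_zero, add_zero,
    integral_branchedLaw _ hγ _ _ _ _ h3]
  congr 1
  have : ∀ u (c : Config E), ∫ z, H z ∂(superpose (vecKernel Pr X f) (u, c)) =
      ∫ z, H (∑ j, z j) ∂(Measure.pi fun j => vecKernel Pr X f (u, c.2 j)) := by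
    intro u c
    rw [superpose_apply, integral_map
      (Finset.measurable_fun_sum _ fun j _ => measurable_pi_apply j).aemeasurable
      hH.aestronglyMeasurable]
  simp_rw [this]

end


/-! ### Complex functions as combinations of nonnegative functions -/

/-- The positive and negative parts of the real and imaginary parts, in the order of the powers
of `I`. -/
noncomputable def cpart (z : ℂ) : Fin 4 → ℝ≥0 :=
  ![z.re.toNNReal, z.im.toNNReal, (-z.re).toNNReal, (-z.im).toNNReal]

lemma sum_cpart (z : ℂ) : ∑ q : Fin 4, Complex.I ^ (q : ℕ) * (cpart z q : ℂ) = z := by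
  have h : ∀ r : ℝ, ((r.toNNReal : ℝ) : ℂ) - ((-r).toNNReal : ℝ) = r := by
    intro r
    rw [← Complex.ofReal_sub]
    congr 1
    simp [Real.coe_toNNReal']
  simp only [Fin.sum_univ_four, cpart]
  simp only [Fin.isValue, Fin.val_zero, pow_zero, Matrix.cons_val_zero, one_mul, Fin.val_one,
    pow_one, Matrix.cons_val_one, Fin.val_two, Complex.I_sq, Matrix.cons_val, neg_mul,
    Complex.I_pow_three, show ((3 : Fin 4) : ℕ) = 3 from rfl]
  conv_rhs => rw [← Complex.re_add_im z, ← h z.re, ← h z.im]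
  ring

lemma measurable_cpart (q : Fin 4) : Measurable fun z => cpart z q := by
  fin_cases q
  · exact Complex.measurable_re.real_toNNReal
  · exact Complex.measurable_im.real_toNNReal
  · exact Complex.measurable_re.neg.real_toNNReal
  · exact Complex.measurable_im.neg.real_toNNReal

section Parts

variable {E ι : Type*}

/-- The four nonnegative parts of each function of a family. -/
noncomputable def partsFun (f : ι → E → ℂ) (q : ι × Fin 4) (y : E) : ℝ≥0 := cpart (f q.1 y) q.2

/-- Reassembly of a complex number from its four parts. -/
noncomputable def assemble (i : ι) (v : ι × Fin 4 → ℝ≥0) : ℂ :=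
  ∑ q : Fin 4, Complex.I ^ (q : ℕ) * (v (i, q) : ℂ)

lemma assemble_sum {α : Type*} (s : Finset α) (i : ι) (v : α → ι × Fin 4 → ℝ≥0) :
    assemble i (∑ j ∈ s, v j) = ∑ j ∈ s, assemble i (v j) := by
  unfold assemble
  rw [Finset.sum_comm]
  refine Finset.sum_congr rfl fun q _ => ?_
  rw [← Finset.mul_sum, Finset.sum_apply]
  push_cast
  rfl

lemma assemble_zero (i : ι) : assemble i (0 : ι × Fin 4 → ℝ≥0) = 0 := by
  simp [assemble]

lemma measurable_assemble (i : ι) : Measurable (assemble i) := by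
  unfold assemble
  fun_prop

lemma assemble_partsFun (f : ι → E → ℂ) (i : ι) (y : E) :
    assemble i (fun q => partsFun f q y) = f i y := sum_cpart _

/-- Reassembly is additive, so it commutes with summation over particles. Complex statistics thus
become functions of a vector of nonnegative ones, to which the identity of laws applies. -/
lemma assemble_vec (f : ι → E → ℂ) (i : ι) (c : Config E) :
    assemble i (vec (partsFun f) c) = pair c (f i) := by
  have : vec (partsFun f) c = ∑ j, fun q => partsFun f q (c.2 j) := by
    ext q
    simp [vec]
  rw [this, assemble_sum]
  exact Finset.sum_congr rfl fun j _ => assemble_partsFun f i _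

lemma measurable_partsFun [MeasurableSpace E] {f : ι → E → ℂ} (hf : ∀ i, Measurable (f i))
    (q : ι × Fin 4) : Measurable (partsFun f q) :=
  (measurable_cpart q.2).comp (hf q.1)

end Parts

/-! ### Product moments -/

section

variable {E Ω ι : Type*} [MeasurableSpace E] [MeasurableSpace Ω]

/-- Uniform bounds on the branching rate, on the offspring moments and on the moments of the
number of particles. -/
structure MomentBounds (γ : E → ℝ≥0) (off : Kernel E (Config E)) (Pr : Kernel E Ω)
    (X : ℝ≥0 → Ω → Config E) (k : ℕ) (C : ℝ≥0) (M β : ℝ) : Prop where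
  measurable_X : Measurable fun q : ℝ≥0 × Ω => X q.1 q.2
  measurable_rate : Measurable γ
  rate_le : ∀ y, γ y ≤ C
  one_le : 1 ≤ k
  beta_nonneg : 0 ≤ β
  offspring : OffspringMoment off k M
  integrable_card : ∀ t x, Integrable (fun ω => ((X t ω).1 : ℝ) ^ k) (Pr x)
  integral_card_le : ∀ t x, ∫ ω, ((X t ω).1 : ℝ) ^ k ∂(Pr x) ≤ 2 * Real.exp (β * t)

/-- `𝔼_{δ_x} [∏_{i ∈ A} X_t[f_i]]`. -/
noncomputable def prodMoment (Pr : Kernel E Ω) (X : ℝ≥0 → Ω → Config E) (f : ι → E → ℂ)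
    (A : Finset ι) (t : ℝ≥0) (x : E) : ℂ :=
  ∫ ω, ∏ i ∈ A, pair (X t ω) (f i) ∂(Pr x)

lemma norm_pair_le {E : Type*} {f : E → ℂ} {D : ℝ} (hf : ∀ y, ‖f y‖ ≤ D) (c : Config E) :
    ‖pair c f‖ ≤ D * c.1 := by
  calc _ ≤ ∑ j : Fin c.1, D := norm_sum_le_of_le _ fun j _ => hf _
    _ = _ := by simp [mul_comm]

lemma norm_prod_pair_le {E : Type*} {f : ι → E → ℂ} {D : ℝ} (hf : ∀ i y, ‖f i y‖ ≤ D)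
    (A : Finset ι) (c : Config E) :
    ‖∏ i ∈ A, pair c (f i)‖ ≤ D ^ A.card * (c.1 : ℝ) ^ A.card := by
  rw [norm_prod, ← mul_pow, ← Finset.prod_const]
  exact Finset.prod_le_prod (fun _ _ => norm_nonneg _) fun i _ => norm_pair_le (hf i) c

lemma natCast_pow_le (n : ℕ) {j k : ℕ} (hk : j ≤ k) : (n : ℝ) ^ j ≤ 1 + (n : ℝ) ^ k := by
  rcases Nat.eq_zero_or_pos j with rfl | hj
  · simp
  · have := natCast_pow_le_pow n hj hk
    linarith

lemma norm_prod_pair_le' {E : Type*} {f : ι → E → ℂ} {D : ℝ} (hD : 1 ≤ D)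
    (hf : ∀ i y, ‖f i y‖ ≤ D) {k : ℕ} {A : Finset ι} (hA : A.card ≤ k) (c : Config E) :
    ‖∏ i ∈ A, pair c (f i)‖ ≤ D ^ k * (1 + (c.1 : ℝ) ^ k) := by
  refine (norm_prod_pair_le hf A c).trans ?_
  have := natCast_pow_le c.1 hA
  have := pow_le_pow_right₀ hD hA
  gcongr

variable {γ : E → ℝ≥0} {off : Kernel E (Config E)} {Pr : Kernel E Ω} [IsMarkovKernel Pr]
  {X : ℝ≥0 → Ω → Config E} {k : ℕ} {C : ℝ≥0} {M β : ℝ}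

lemma MomentBounds.measurable_prod_pair (h : MomentBounds γ off Pr X k C M β) {f : ι → E → ℂ}
    (hf : ∀ i, Measurable (f i)) (A : Finset ι) :
    Measurable fun q : ℝ≥0 × Ω => ∏ i ∈ A, pair (X q.1 q.2) (f i) := by
  refine Finset.measurable_fun_prod _ fun i _ => ?_
  exact (measurable_pair (α := Unit) (G := fun _ => f i) ((hf i).comp measurable_snd)).comp
    (f := fun q : ℝ≥0 × Ω => ((), X q.1 q.2)) (measurable_const.prodMk h.measurable_X)

lemma MomentBounds.integrable_prod_pair (h : MomentBounds γ off Pr X k C M β) {f : ι → E → ℂ}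
    (hf : ∀ i, Measurable (f i)) {D : ℝ} (hD : 1 ≤ D) (hfD : ∀ i y, ‖f i y‖ ≤ D) {A : Finset ι}
    (hA : A.card ≤ k) (t : ℝ≥0) (x : E) :
    Integrable (fun ω => ∏ i ∈ A, pair (X t ω) (f i)) (Pr x) := by
  refine (((integrable_const 1).add (h.integrable_card t x)).const_mul (D ^ k)).mono' ?_
    (ae_of_all _ fun ω => norm_prod_pair_le' hD hfD hA _)
  exact ((h.measurable_prod_pair hf A).comp (f := fun ω => (t, ω))
    (by fun_prop)).aestronglyMeasurable

lemma MomentBounds.norm_prodMoment_le (h : MomentBounds γ off Pr X k C M β) {f : ι → E → ℂ}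
    {D : ℝ} (hD : 1 ≤ D) (hfD : ∀ i y, ‖f i y‖ ≤ D) {A : Finset ι}
    (hA : A.card ≤ k) (t : ℝ≥0) (x : E) :
    ‖prodMoment Pr X f A t x‖ ≤ D ^ k * (1 + 2 * Real.exp (β * t)) := by
  calc _ ≤ ∫ ω, D ^ k * (1 + ((X t ω).1 : ℝ) ^ k) ∂(Pr x) := by
        exact norm_integral_le_of_norm_le
          (((integrable_const 1).add (h.integrable_card t x)).const_mul (D ^ k))
          (ae_of_all _ fun ω => norm_prod_pair_le' hD hfD hA _)
    _ = D ^ k * (1 + ∫ ω, ((X t ω).1 : ℝ) ^ k ∂(Pr x)) := by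
        rw [integral_const_mul, integral_add (integrable_const 1) (h.integrable_card t x)]
        simp
    _ ≤ _ := by
        have := h.integral_card_le t x
        gcongr

lemma MomentBounds.measurable_prodMoment (h : MomentBounds γ off Pr X k C M β) {f : ι → E → ℂ}
    (hf : ∀ i, Measurable (f i)) (A : Finset ι) :
    Measurable fun p : ℝ≥0 × E => prodMoment Pr X f A p.1 p.2 := by
  have h2 := StronglyMeasurable.integral_kernel_prod_right
    (κ := Pr.comap (Prod.snd : ℝ≥0 × E → E) measurable_snd)
    (f := fun (p : ℝ≥0 × E) (ω : Ω) => ∏ i ∈ A, pair (X p.1 ω) (f i))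
    ((h.measurable_prod_pair hf A).comp (f := fun q : (ℝ≥0 × E) × Ω => (q.1.1, q.2))
      (by fun_prop)).stronglyMeasurable
  exact h2.measurable

lemma MomentBounds.integrable_pair (h : MomentBounds γ off Pr X k C M β) {f : E → ℂ}
    (hf : Measurable f) {D : ℝ} (hD : 0 ≤ D) (hfD : ∀ y, ‖f y‖ ≤ D) (y : E) :
    Integrable (fun c => pair c f) (off y) := by
  refine h.offspring.integrable_of_le ?_ le_rfl h.one_le hD
    (fun c => by rw [pow_one]; exact norm_pair_le hfD c) y
  exact (measurable_pair (α := Unit) (G := fun _ => f) (hf.comp measurable_snd)).comp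
    (f := fun c => ((), c)) (by fun_prop)

lemma prodMoment_empty (f : ι → E → ℂ) (t : ℝ≥0) (x : E) : prodMoment Pr X f ∅ t x = 1 := by
  simp [prodMoment]

variable [Fintype ι] [DecidableEq ι]

/-- Product moments of a superposition of independent copies of the process. -/
lemma MomentBounds.integral_superposition (h : MomentBounds γ off Pr X k C M β)
    {f : ι → E → ℂ} (hf : ∀ i, Measurable (f i)) {D : ℝ} (hD : 1 ≤ D)
    (hfD : ∀ i y, ‖f i y‖ ≤ D) {A : Finset ι} (hA : A.Nonempty) (hAk : A.card ≤ k)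
    [IsMarkovKernel (vecKernel Pr X (partsFun f))] (u : ℝ≥0) (c : Config E) :
    ∫ z, ∏ i ∈ A, assemble i (∑ j, z j)
        ∂(Measure.pi fun j => vecKernel Pr X (partsFun f) (u, c.2 j)) =
      pair c (prodMoment Pr X f A u) + zetaSum A (fun B => prodMoment Pr X f B u) c := by
  have hpm := measurable_partsFun hf
  have hB : ∀ (B : Finset ι), B ⊆ A → ∀ y,
      Integrable (fun v => ∏ i ∈ B, assemble i v) (vecKernel Pr X (partsFun f) (u, y)) ∧
      ∫ v, ∏ i ∈ B, assemble i v ∂(vecKernel Pr X (partsFun f) (u, y)) =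
        prodMoment Pr X f B u y := by
    intro B hBA y
    have hm : Measurable fun v : ι × Fin 4 → ℝ≥0 => ∏ i ∈ B, assemble i v :=
      Finset.measurable_fun_prod _ fun i _ => measurable_assemble i
    have hv := measurable_vec_comp h.measurable_X hpm u
    rw [vecKernel_apply h.measurable_X hpm, integral_map hv.aemeasurable hm.aestronglyMeasurable,
      integrable_map_measure hm.aestronglyMeasurable hv.aemeasurable]
    simp only [Function.comp_def, assemble_vec]
    exact ⟨h.integrable_prod_pair hf hD hfD ((Finset.card_le_card hBA).trans hAk) u y, rfl⟩
  -- Choosing a particle for each factor gives a map from `A` to the particles. Independence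
  -- factorises the expectation over particles, and particle `j` contributes the product moment over
  -- the fibre above `j`.
  simp_rw [assemble_sum, prod_sum_eq_sum_fiber A c.1 (fun j i => assemble i _)]
  rw [integral_finsetSum]
  · have h1 : ∀ φ : A → Fin c.1, ∫ z, ∏ j, ∏ i ∈ fiber φ j, assemble i (z j)
        ∂(Measure.pi fun j => vecKernel Pr X (partsFun f) (u, c.2 j)) =
        ∏ j, prodMoment Pr X f (fiber φ j) u (c.2 j) := by
      intro φ
      rw [integral_fintype_prod_eq_prod (fun j v => ∏ i ∈ fiber φ j, assemble i v)]
      exact Finset.prod_congr rfl fun j _ => (hB _ (fiber_subset φ j) _).2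
    simp_rw [h1]
    rw [sum_prod_fiber_eq_add hA c.1 (fun B j => prodMoment Pr X f B u (c.2 j))
      fun j => prodMoment_empty f u _]
    rfl
  · intro φ _
    exact Integrable.fintype_prod_dep (f := fun j v => ∏ i ∈ fiber φ j, assemble i v) fun j =>
      (hB _ (fiber_subset φ j) _).1

lemma MomentBounds.norm_prodMoment_prod_le (h : MomentBounds γ off Pr X k C M β) {f : ι → E → ℂ}
    {D : ℝ} (hD : 1 ≤ D) (hfD : ∀ i y, ‖f i y‖ ≤ D) {A : Finset ι} (hAk : A.card ≤ k) (u : ℝ≥0) :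
    (∀ B, B ⊂ A → B.Nonempty → ∀ y, ‖prodMoment Pr X f B u y‖ ≤
      D ^ k * (1 + 2 * Real.exp (β * u))) ∧
    ∀ σ : Finpartition A, σ.parts ≠ {A} →
      ∏ _B ∈ σ.parts, D ^ k * (1 + 2 * Real.exp (β * u)) ≤
        (D ^ k * (1 + 2 * Real.exp (β * u))) ^ k := by
  refine ⟨fun B hB _ y => h.norm_prodMoment_le hD hfD
    ((Finset.card_le_card hB.subset).trans hAk) u y, fun σ _ => ?_⟩
  rw [Finset.prod_const]
  refine pow_le_pow_right₀ ?_ (σ.card_parts_le_card.trans hAk)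
  refine one_le_mul_of_one_le_of_one_le (one_le_pow₀ hD) ?_
  have := Real.exp_pos (β * u)
  linarith

end

/-! ### The renewal equation for product moments -/

section Mild

variable {E Ω₀ Ω ι : Type*} [MeasurableSpace E] [MeasurableSpace Ω₀] [MeasurableSpace Ω]
  {P : Kernel E Ω₀} [IsMarkovKernel P] {ξ : ℝ≥0 → Ω₀ → E ⊕ Unit} {γ : E → ℝ≥0}
  {off : Kernel E (Config E)} [IsMarkovKernel off] {Pr : Kernel E Ω}
  [IsMarkovKernel Pr] {X : ℝ≥0 → Ω → Config E} {k : ℕ} {C : ℝ≥0} {M β : ℝ}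
  [Fintype ι] [DecidableEq ι]

/-- The first-branching equation for product moments. -/
theorem MomentBounds.prodMoment_eq (h : MomentBounds γ off Pr X k C M β)
    (hξ : Measurable fun q : ℝ≥0 × Ω₀ => ξ q.1 q.2)
    (hX : IsBranchingMarkovProcess P ξ γ off Pr X) [IsFiniteKernel (killedKernel P ξ γ)]
    {f : ι → E → ℂ} (hf : ∀ i, Measurable (f i)) {D : ℝ} (hD : 1 ≤ D)
    (hfD : ∀ i y, ‖f i y‖ ≤ D) {A : Finset ι} (hA : A.Nonempty) (hAk : A.card ≤ k)
    (t : ℝ≥0) (x : E) :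
    prodMoment Pr X f A t x = ∫ y, ∏ i ∈ A, f i y ∂(killedKernel P ξ γ (t, x)) +
      ∫ s in Set.Ioo (0 : ℝ) t, ∫ y, (γ y : ℂ) *
        (∫ c, pair c (prodMoment Pr X f A (t - s.toNNReal)) ∂(off y) +
          zeta off A (fun B => prodMoment Pr X f B (t - s.toNNReal)) y)
        ∂(killedKernel P ξ γ (s.toNNReal, x)) := by
  have hpm := measurable_partsFun hf
  have : IsMarkovKernel (vecKernel Pr X (partsFun f)) :=
    isMarkovKernel_vecKernel h.measurable_X hpm
  have hm : Measurable fun v : ι × Fin 4 → ℝ≥0 => ∏ i ∈ A, assemble i v :=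
    Finset.measurable_fun_prod _ fun i _ => measurable_assemble i
  -- As `A` is nonempty, the functional vanishes at the zero vector and the atom created by death
  -- drops out.
  have h0 : ∏ i ∈ A, assemble i (0 : ι × Fin 4 → ℝ≥0) = 0 := by
    obtain ⟨i, hi⟩ := hA
    exact Finset.prod_eq_zero hi (assemble_zero i)
  have hmain := integral_law_eq hξ h.measurable_rate hX hpm t x hm h0 (by
    simp only [assemble_vec]
    exact h.integrable_prod_pair hf hD hfD hAk t x)
  simp only [assemble_vec, assemble_partsFun] at hmain
  rw [prodMoment, hmain]
  simp_rw [h.integral_superposition hf hD hfD hA hAk]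
  have hmB : ∀ (B : Finset ι) (u : ℝ≥0), Measurable (prodMoment Pr X f B u) := fun B u =>
    (h.measurable_prodMoment hf B).comp (f := fun y => (u, y)) (by fun_prop)
  have hint : ∀ u y, ∫ c, (pair c (prodMoment Pr X f A u) +
      zetaSum A (fun B => prodMoment Pr X f B u) c) ∂(off y) =
      ∫ c, pair c (prodMoment Pr X f A u) ∂(off y) +
        zeta off A (fun B => prodMoment Pr X f B u) y := by
    intro u y
    have hexp := Real.exp_pos (β * u)
    obtain ⟨hb, hW⟩ := h.norm_prodMoment_prod_le hD hfD hAk u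
    rw [integral_add, zeta_eq]
    · exact h.integrable_pair (hmB A u) (by positivity)
        (fun y => h.norm_prodMoment_le hD hfD hAk u y) y
    · exact h.offspring.integrable_of_le (measurable_zetaSum_right fun B _ => hmB B u)
        hA.card_pos hAk (by positivity) (norm_zetaSum_le hA (by positivity) hb hW) y
  simp_rw [hint]

end Mild


/-! ### From the first-branching equation to the expectation semigroup -/

section Fubini

variable {E : Type*} [MeasurableSpace E]

lemma setIntegral_shift (f : ℝ → ℂ) {r t : ℝ} (hrt : r ≤ t) :
    ∫ s in Set.Ioo r t, f (s - r) = ∫ s in Set.Ioo 0 (t - r), f s := by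
  rw [← integral_Ioc_eq_integral_Ioo, ← integral_Ioc_eq_integral_Ioo,
    ← intervalIntegral.integral_of_le hrt, ← intervalIntegral.integral_of_le (by linarith),
    intervalIntegral.integral_comp_sub_right, sub_self]

/-- Interchange of the order of integration in iterated Duhamel integrals. -/
lemma duhamel_fubini (K : Kernel (ℝ≥0 × E) E) [IsFiniteKernel K] (x : E) (t : ℝ≥0)
    {φ : ℝ → ℝ → E → ℂ} (hφ : Measurable fun p : ℝ × ℝ × E => φ p.1 p.2.1 p.2.2) {B : ℝ}
    (hB0 : 0 ≤ B)
    (hB : ∀ (s u : ℝ) (y : E), 0 < s → 0 < u → s + u ≤ t → ‖φ s u y‖ ≤ B) :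
    ∫ s in Set.Ioo (0 : ℝ) t, ∫ r in Set.Ioo 0 s, ∫ y, φ (s - r) (t - s) y ∂(K (r.toNNReal, x)) =
      ∫ r in Set.Ioo (0 : ℝ) t, ∫ y, (∫ s in Set.Ioo 0 (t - r), φ s (t - r - s) y)
        ∂(K (r.toNNReal, x)) := by
  -- Extending the integrand by zero off the simplex `0 < r < s < t` gives a bounded measurable
  -- function, so both exchanges of integrals take place on finite product measures.
  set U : Set (ℝ × ℝ × E) := {p | 0 < p.1 ∧ p.1 < p.2.1 ∧ p.2.1 < t} with hU
  have hUm : MeasurableSet U := by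
    have h1 : MeasurableSet {p : ℝ × ℝ × E | 0 < p.1} :=
      measurableSet_lt measurable_const measurable_fst
    have h2 : MeasurableSet {p : ℝ × ℝ × E | p.1 < p.2.1} :=
      measurableSet_lt measurable_fst (by fun_prop)
    have h3 : MeasurableSet {p : ℝ × ℝ × E | p.2.1 < t} :=
      measurableSet_lt (by fun_prop) measurable_const
    exact h1.inter (h2.inter h3)
  set Φ : ℝ × ℝ × E → ℂ := U.indicator fun p => φ (p.2.1 - p.1) (t - p.2.1) p.2.2 with hΦ
  have hΦm : Measurable Φ := by
    refine Measurable.indicator ?_ hUm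
    exact hφ.comp (f := fun p : ℝ × ℝ × E => (p.2.1 - p.1, (t : ℝ) - p.2.1, p.2.2)) (by fun_prop)
  have hΦB : ∀ p, ‖Φ p‖ ≤ B := by
    intro p
    by_cases hp : p ∈ U
    · rw [hΦ, Set.indicator_of_mem hp]
      obtain ⟨h1, h2, h3⟩ := hp
      exact hB _ _ _ (by linarith) (by linarith) (by linarith)
    · rw [hΦ, Set.indicator_of_notMem hp, norm_zero]
      exact hB0
  set J : ℝ → ℝ → ℂ := fun r s => ∫ y, Φ (r, s, y) ∂(K (r.toNNReal, x)) with hJ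
  have hJm : Measurable fun p : ℝ × ℝ => J p.1 p.2 := by
    have := StronglyMeasurable.integral_kernel_prod_right
      (κ := K.comap (fun p : ℝ × ℝ => (p.1.toNNReal, x)) (by fun_prop))
      (f := fun (p : ℝ × ℝ) y => Φ (p.1, p.2, y))
      (hΦm.comp (f := fun q : (ℝ × ℝ) × E => (q.1.1, q.1.2, q.2)) (by fun_prop)).stronglyMeasurable
    exact this.measurable
  have hJB : ∀ r s, ‖J r s‖ ≤ B * (Kernel.bound K).toReal := by
    intro r s
    refine (norm_integral_le_of_norm_le_const (ae_of_all _ fun y => hΦB _)).trans ?_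
    refine mul_le_mul_of_nonneg_left ?_ hB0
    exact ENNReal.toReal_mono (Kernel.bound_ne_top K) (Kernel.measure_le_bound K _ _)
  have hJr : ∀ s ∈ Set.Ioo (0 : ℝ) t,
      ∫ r in Set.Ioo 0 s, ∫ y, φ (s - r) (t - s) y ∂(K (r.toNNReal, x)) =
        ∫ r in Set.Ioo (0 : ℝ) t, J r s := by
    intro s hs
    have h1 : ∀ r, J r s = (Set.Ioo 0 s).indicator
        (fun r => ∫ y, φ (s - r) (t - s) y ∂(K (r.toNNReal, x))) r := by
      intro r
      by_cases hr : r ∈ Set.Ioo 0 s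
      · rw [Set.indicator_of_mem hr, hJ]
        refine integral_congr_ae (ae_of_all _ fun y => ?_)
        exact Set.indicator_of_mem (s := U) ⟨hr.1, hr.2, hs.2⟩ _
      · rw [Set.indicator_of_notMem hr, hJ]
        refine (integral_congr_ae (ae_of_all _ fun y => ?_)).trans (integral_zero E ℂ)
        exact Set.indicator_of_notMem (s := U) (fun h => hr ⟨h.1, h.2.1⟩) _
    simp_rw [h1]
    rw [setIntegral_indicator measurableSet_Ioo, Set.Ioo_inter_Ioo, max_self,
      min_eq_right hs.2.le]
  have hint : Integrable (Function.uncurry fun s r => J r s)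
      ((volume.restrict (Set.Ioo (0 : ℝ) t)).prod (volume.restrict (Set.Ioo (0 : ℝ) t))) := by
    refine Integrable.of_bound
      (hJm.comp (f := fun p : ℝ × ℝ => (p.2, p.1)) (by fun_prop)).aestronglyMeasurable _
      (ae_of_all _ fun p => hJB _ _)
  rw [setIntegral_congr_fun measurableSet_Ioo hJr, integral_integral_swap hint]
  refine setIntegral_congr_fun measurableSet_Ioo fun r hr => ?_
  have hswap : ∫ s in Set.Ioo (0 : ℝ) t, J r s =
      ∫ y, (∫ s in Set.Ioo (0 : ℝ) t, Φ (r, s, y)) ∂(K (r.toNNReal, x)) := by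
    refine integral_integral_swap (f := fun s y => Φ (r, s, y)) ?_
    exact Integrable.of_bound
      (hΦm.comp (f := fun p : ℝ × E => (r, p.1, p.2)) (by fun_prop)).aestronglyMeasurable _
      (ae_of_all _ fun p => hΦB _)
  rw [hswap]
  refine integral_congr_ae (ae_of_all _ fun y => ?_)
  simp only
  have h2 : ∀ s, s ∈ Set.Ioo (0 : ℝ) t → Φ (r, s, y) = (Set.Ioo r (t : ℝ)).indicator
      (fun s => φ (s - r) (t - r - (s - r)) y) s := by
    intro s hs
    by_cases hrs : r < s
    · have hm1 : s ∈ Set.Ioo r (t : ℝ) := ⟨hrs, hs.2⟩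
      have hm2 : (r, s, y) ∈ U := ⟨hr.1, hrs, hs.2⟩
      rw [Set.indicator_of_mem hm1, hΦ, Set.indicator_of_mem hm2]
      congr 1
      ring
    · rw [Set.indicator_of_notMem fun h => hrs h.1]
      exact Set.indicator_of_notMem (s := U) (fun h => hrs h.2.1) _
  rw [setIntegral_congr_fun measurableSet_Ioo h2, setIntegral_indicator measurableSet_Ioo,
    Set.Ioo_inter_Ioo, max_eq_right hr.1.le, min_self]
  exact setIntegral_shift (fun s => φ s (t - r - s) y) hr.2.le

end Fubini

/-! ### The mean offspring kernel -/

section MeanKernel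

variable {E Ω : Type*} [MeasurableSpace E] [MeasurableSpace Ω]

/-- The point measure of a configuration, as a kernel. -/
noncomputable def pointKernel (E : Type*) [MeasurableSpace E] : Kernel (Config E) E where
  toFun := toMeasure
  measurable' := by
    refine measurable_of_config' fun n => ?_
    change Measurable fun p : Fin n → E => ∑ j : Fin n, Measure.dirac (p j)
    refine Measure.measurable_of_measurable_coe _ fun s hs => ?_
    simp only [Measure.coe_finsetSum, Finset.sum_apply]
    refine Finset.measurable_fun_sum _ fun j _ => ?_
    exact (Measure.measurable_coe hs).comp (Measure.measurable_dirac.comp (measurable_pi_apply j))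

lemma integral_pointKernel {f : E → ℂ} (hf : Measurable f) (c : Config E) :
    ∫ y, f y ∂(pointKernel E c) = pair c f := by
  change ∫ y, f y ∂(∑ j, Measure.dirac (c.2 j)) = _
  rw [integral_finsetSum_measure]
  · exact Finset.sum_congr rfl fun j _ => integral_dirac' _ _ hf.stronglyMeasurable
  · intro j _
    exact integrable_dirac' hf.stronglyMeasurable (by simp)

lemma pointKernel_univ (c : Config E) : pointKernel E c Set.univ = c.1 := by
  change (∑ j, Measure.dirac (c.2 j)) Set.univ = _
  simp

/-- `K_s(x, ·)`: the mean number of offspring produced at a first branching at time `s`. -/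
noncomputable def meanKernel (S : Kernel (ℝ≥0 × E) E) [IsFiniteKernel S] (γ : E → ℝ≥0)
    (off : Kernel E (Config E)) : Kernel (ℝ≥0 × E) E :=
  pointKernel E ∘ₖ (off ∘ₖ Kernel.withDensity S fun _ y => (γ y : ℝ≥0∞))

variable {γ : E → ℝ≥0} {off : Kernel E (Config E)} {Pr : Kernel E Ω}
  {X : ℝ≥0 → Ω → Config E} {k : ℕ} {C : ℝ≥0} {M β : ℝ} {S : Kernel (ℝ≥0 × E) E}
  [IsFiniteKernel S]

lemma MomentBounds.lintegral_card_le (h : MomentBounds γ off Pr X k C M β) (y : E) :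
    ∫⁻ c, (c.1 : ℝ≥0∞) ∂(off y) ≤ ENNReal.ofReal M := by
  have h1 := h.offspring y
  calc ∫⁻ c, (c.1 : ℝ≥0∞) ∂(off y) ≤ ∫⁻ c, ENNReal.ofReal ((c.1 : ℝ) ^ k) ∂(off y) := by
        refine lintegral_mono fun c => ?_
        have := natCast_pow_le_pow c.1 le_rfl h.one_le
        rw [pow_one] at this
        simp only
        rw [← ENNReal.ofReal_natCast]
        exact ENNReal.ofReal_le_ofReal this
    _ = ENNReal.ofReal (∫ c, (c.1 : ℝ) ^ k ∂(off y)) := by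
        rw [ofReal_integral_eq_lintegral_ofReal h1.1 (ae_of_all _ fun _ => by positivity)]
    _ ≤ _ := ENNReal.ofReal_le_ofReal h1.2

lemma MomentBounds.meanKernel_univ_le (h : MomentBounds γ off Pr X k C M β)
    (hS : ∀ p, S p Set.univ ≤ 1) (p : ℝ≥0 × E) :
    meanKernel S γ off p Set.univ ≤ C * ENNReal.ofReal M := by
  have hN : Measurable fun c : Config E => (c.1 : ℝ≥0∞) :=
    (measurable_of_countable (fun n : ℕ => (n : ℝ≥0∞))).comp measurable_config_card
  have hγ := h.measurable_rate
  rw [← lintegral_one, meanKernel, Kernel.lintegral_comp _ _ _ measurable_const]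
  simp only [lintegral_one, pointKernel_univ]
  rw [Kernel.lintegral_comp _ _ _ hN, Kernel.lintegral_withDensity _ (by fun_prop) _
    hN.lintegral_kernel]
  calc _ ≤ ∫⁻ y, C * ENNReal.ofReal M ∂(S p) := by
        refine lintegral_mono fun y => mul_le_mul' ?_ (h.lintegral_card_le y)
        exact ENNReal.coe_le_coe.2 (h.rate_le y)
    _ ≤ _ := by
        rw [lintegral_const]
        exact mul_le_of_le_one_right' (hS p)

lemma MomentBounds.isFiniteKernel_meanKernel (h : MomentBounds γ off Pr X k C M β)
    (hS : ∀ p, S p Set.univ ≤ 1) : IsFiniteKernel (meanKernel S γ off) :=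
  ⟨⟨C * ENNReal.ofReal M, ENNReal.mul_lt_top ENNReal.coe_lt_top ENNReal.ofReal_lt_top,
    h.meanKernel_univ_le hS⟩⟩

lemma MomentBounds.integral_meanKernel (h : MomentBounds γ off Pr X k C M β)
    (hS : ∀ p, S p Set.univ ≤ 1) {f : E → ℂ} (hf : Measurable f) {D : ℝ}
    (hD : ∀ y, ‖f y‖ ≤ D) (p : ℝ≥0 × E) :
    ∫ y, f y ∂(meanKernel S γ off p) =
      ∫ y, (γ y : ℂ) * ∫ c, pair c f ∂(off y) ∂(S p) := by
  have := h.isFiniteKernel_meanKernel hS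
  have hγ := h.measurable_rate
  have hint : Integrable f (meanKernel S γ off p) :=
    Integrable.of_bound hf.aestronglyMeasurable D (ae_of_all _ hD)
  rw [meanKernel] at hint ⊢
  rw [Kernel.integral_comp hint]
  have h2 := hint.integral_comp
  simp only [integral_pointKernel hf] at h2 ⊢
  rw [Kernel.integral_comp h2, Kernel.withDensity_apply _ (by fun_prop),
    integral_withDensity_eq_integral_smul hγ]
  simp only [NNReal.smul_def, Complex.real_smul]

end MeanKernel


/-! ### The evolution equation for product moments -/

section Semigroup

variable {E Ω α ι : Type*} [MeasurableSpace E] [MeasurableSpace Ω] [MeasurableSpace α]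
  {γ : E → ℝ≥0} {off : Kernel E (Config E)} {Pr : Kernel E Ω} [IsMarkovKernel Pr]
  {X : ℝ≥0 → Ω → Config E} {k : ℕ} {C : ℝ≥0} {M β : ℝ}

lemma MomentBounds.measurable_psi (h : MomentBounds γ off Pr X k C M β) {G : α → E → ℂ}
    (hG : Measurable fun p : α × E => G p.1 p.2) :
    Measurable fun p : α × ℝ≥0 × E => psi Pr X p.2.1 (G p.1) p.2.2 := by
  have h1 : Measurable fun q : (α × ℝ≥0 × E) × Ω => pair (X q.1.2.1 q.2) (G q.1.1) :=
    (measurable_pair hG).comp (f := fun q : (α × ℝ≥0 × E) × Ω => (q.1.1, X q.1.2.1 q.2))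
      ((by fun_prop : Measurable fun q : (α × ℝ≥0 × E) × Ω => q.1.1).prodMk
        (h.measurable_X.comp (f := fun q : (α × ℝ≥0 × E) × Ω => (q.1.2.1, q.2)) (by fun_prop)))
  exact (StronglyMeasurable.integral_kernel_prod_right
    (κ := Pr.comap (fun p : α × ℝ≥0 × E => p.2.2) (by fun_prop))
    (f := fun (p : α × ℝ≥0 × E) (ω : Ω) => pair (X p.2.1 ω) (G p.1)) h1.stronglyMeasurable).measurable

lemma MomentBounds.integrable_pair_X (h : MomentBounds γ off Pr X k C M β) {f : E → ℂ}
    (hf : Measurable f) {D : ℝ} (hD : ∀ y, ‖f y‖ ≤ D) (t : ℝ≥0) (x : E) :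
    Integrable (fun ω => pair (X t ω) f) (Pr x) := by
  have hD0 : 0 ≤ D := (norm_nonneg _).trans (hD x)
  refine ((h.integrable_card t x).const_mul D).mono' ?_ (ae_of_all _ fun ω => ?_)
  · exact ((measurable_pair (α := Unit) (G := fun _ => f) (hf.comp measurable_snd)).comp
      (f := fun ω => ((), X t ω)) (measurable_const.prodMk
        (h.measurable_X.comp (f := fun ω => (t, ω)) (by fun_prop)))).aestronglyMeasurable
  · refine (norm_pair_le hD _).trans (mul_le_mul_of_nonneg_left ?_ hD0)
    simpa using natCast_pow_le_pow (X t ω).1 le_rfl h.one_le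

lemma MomentBounds.norm_psi_le (h : MomentBounds γ off Pr X k C M β) {f : E → ℂ}
    {D : ℝ} (hD : ∀ y, ‖f y‖ ≤ D) (t : ℝ≥0) (x : E) :
    ‖psi Pr X t f x‖ ≤ D * (2 * Real.exp (β * t)) := by
  have hD0 : 0 ≤ D := (norm_nonneg _).trans (hD x)
  calc _ ≤ ∫ ω, D * ((X t ω).1 : ℝ) ^ k ∂(Pr x) := by
        refine norm_integral_le_of_norm_le ((h.integrable_card t x).const_mul D)
          (ae_of_all _ fun ω => ?_)
        refine (norm_pair_le hD _).trans (mul_le_mul_of_nonneg_left ?_ hD0)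
        simpa using natCast_pow_le_pow (X t ω).1 le_rfl h.one_le
    _ ≤ _ := by
        rw [integral_const_mul]
        exact mul_le_mul_of_nonneg_left (h.integral_card_le t x) hD0

lemma prodMoment_unit (f : E → ℂ) (t : ℝ≥0) (x : E) :
    prodMoment Pr X (fun _ : Unit => f) Finset.univ t x = psi Pr X t f x := by
  simp [prodMoment, psi]

lemma zeta_singleton [DecidableEq ι] (i : ι) (g : Finset ι → E → ℂ) (y : E) :
    zeta off {i} g y = 0 := by
  have h : ∀ c, zetaSum {i} g c = 0 := by
    intro c
    unfold zetaSum
    rw [Finset.filter_false_of_mem, Finset.sum_empty]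
    intro σ _ hσ
    obtain ⟨B, hB⟩ := σ.parts_nonempty (Finset.singleton_ne_empty i)
    have h1 := ssubset_of_mem_parts hσ hB
    exact σ.ne_empty hB (Finset.ssubset_singleton_iff.1 h1)
  simp [zeta_eq, h]

lemma integrableOn_integral_kernel {κ : Kernel (ℝ≥0 × E) E} [IsFiniteKernel κ]
    {G : ℝ≥0 → E → ℂ} (hG : Measurable fun p : ℝ≥0 × E => G p.1 p.2) (t : ℝ≥0) {B : ℝ}
    (hB : ∀ u ≤ t, ∀ y, ‖G u y‖ ≤ B) (x : E) :
    IntegrableOn (fun s : ℝ => ∫ y, G (t - s.toNNReal) y ∂(κ (s.toNNReal, x)))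
      (Set.Ioo 0 (t : ℝ)) := by
  have hB0 : 0 ≤ B := (norm_nonneg _).trans (hB t le_rfl x)
  have hm : Measurable fun s : ℝ => ∫ y, G (t - s.toNNReal) y ∂(κ (s.toNNReal, x)) :=
    (StronglyMeasurable.integral_kernel_prod_right
      (κ := κ.comap (fun s : ℝ => (s.toNNReal, x)) (by fun_prop))
      (f := fun (s : ℝ) y => G (t - s.toNNReal) y)
      (hG.comp (f := fun p : ℝ × E => (t - p.1.toNNReal, p.2))
        (by fun_prop)).stronglyMeasurable).measurable
  refine Integrable.of_bound hm.aestronglyMeasurable (B * (Kernel.bound κ).toReal)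
    (ae_of_all _ fun s => ?_)
  refine (norm_integral_le_of_norm_le_const (ae_of_all _ fun y => hB _ tsub_le_self y)).trans ?_
  refine mul_le_mul_of_nonneg_left ?_ hB0
  exact ENNReal.toReal_mono (Kernel.bound_ne_top κ) (Kernel.measure_le_bound κ _ _)

/-- The Duhamel integral `∫₀ᵗ ψ_s[F_{t-s}](x) ds`. -/
noncomputable def duhamel (Pr : Kernel E Ω) (X : ℝ≥0 → Ω → Config E) (F : ℝ≥0 → E → ℂ) (t : ℝ≥0)
    (x : E) : ℂ :=
  ∫ s in Set.Ioo (0 : ℝ) t, psi Pr X s.toNNReal (F (t - s.toNNReal)) x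

lemma MomentBounds.measurable_duhamel (h : MomentBounds γ off Pr X k C M β) {F : ℝ≥0 → E → ℂ}
    (hF : Measurable fun p : ℝ≥0 × E => F p.1 p.2) :
    Measurable fun p : ℝ≥0 × E => duhamel Pr X F p.1 p.2 := by
  have h1 : Measurable fun q : (ℝ≥0 × E) × ℝ =>
      psi Pr X q.2.toNNReal (F (q.1.1 - q.2.toNNReal)) q.1.2 :=
    (h.measurable_psi hF).comp
      (f := fun q : (ℝ≥0 × E) × ℝ => (q.1.1 - q.2.toNNReal, q.2.toNNReal, q.1.2)) (by fun_prop)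
  have h2 : MeasurableSet {q : (ℝ≥0 × E) × ℝ | 0 < q.2} :=
    measurableSet_lt measurable_const (by fun_prop)
  have h3 : MeasurableSet {q : (ℝ≥0 × E) × ℝ | q.2 < q.1.1} :=
    measurableSet_lt (by fun_prop) (by fun_prop)
  have h4 := (h1.indicator (h2.inter h3)).stronglyMeasurable
  have h5 := (StronglyMeasurable.integral_prod_right (ν := (volume : Measure ℝ))
    (f := fun (p : ℝ≥0 × E) (s : ℝ) => ({q : (ℝ≥0 × E) × ℝ | 0 < q.2} ∩
      {q : (ℝ≥0 × E) × ℝ | q.2 < q.1.1}).indicator (fun q : (ℝ≥0 × E) × ℝ =>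
      psi Pr X q.2.toNNReal (F (q.1.1 - q.2.toNNReal)) q.1.2) (p, s)) h4).measurable
  convert h5 using 2 with p
  rw [duhamel, ← integral_indicator measurableSet_Ioo]
  rfl

lemma MomentBounds.norm_duhamel_le (h : MomentBounds γ off Pr X k C M β) {F : ℝ≥0 → E → ℂ}
    {t : ℝ≥0} {B : ℝ} (hB : ∀ u ≤ t, ∀ y, ‖F u y‖ ≤ B) (x : E) :
    ‖duhamel Pr X F t x‖ ≤ B * (2 * Real.exp (β * t)) * t := by
  have hB0 : 0 ≤ B := (norm_nonneg _).trans (hB t le_rfl x)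
  have h1 : ∀ s ∈ Set.Ioo (0 : ℝ) t, ‖psi Pr X s.toNNReal (F (t - s.toNNReal)) x‖ ≤
      B * (2 * Real.exp (β * t)) := by
    intro s hs
    refine (h.norm_psi_le (fun y => hB _ tsub_le_self y) _ x).trans ?_
    rw [Real.coe_toNNReal _ hs.1.le]
    have := mul_le_mul_of_nonneg_left hs.2.le h.beta_nonneg
    gcongr
  refine (norm_setIntegral_le_of_norm_le_const (by simp) h1).trans ?_
  simp

end Semigroup

/-! ### From the killed motion to the expectation semigroup -/

section Evolution

variable {E Ω₀ Ω ι : Type*} [MeasurableSpace E] [MeasurableSpace Ω₀] [MeasurableSpace Ω]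
  {P : Kernel E Ω₀} [IsMarkovKernel P] {ξ : ℝ≥0 → Ω₀ → E ⊕ Unit} {γ : E → ℝ≥0}
  {off : Kernel E (Config E)} [IsMarkovKernel off] {Pr : Kernel E Ω}
  [IsMarkovKernel Pr] {X : ℝ≥0 → Ω → Config E} {k : ℕ} {C : ℝ≥0} {M β : ℝ}
  [IsFiniteKernel (killedKernel P ξ γ)]

/-- The first-branching equation for the expectation semigroup. -/
lemma MomentBounds.psi_eq (h : MomentBounds γ off Pr X k C M β)
    (hξ : Measurable fun q : ℝ≥0 × Ω₀ => ξ q.1 q.2)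
    (hX : IsBranchingMarkovProcess P ξ γ off Pr X)
    {f : E → ℂ} (hf : Measurable f) {D : ℝ} (hD : ∀ y, ‖f y‖ ≤ D) (t : ℝ≥0) (x : E) :
    psi Pr X t f x = ∫ y, f y ∂(killedKernel P ξ γ (t, x)) +
      ∫ s in Set.Ioo (0 : ℝ) t, ∫ y, psi Pr X (t - s.toNNReal) f y
        ∂(meanKernel (killedKernel P ξ γ) γ off (s.toNNReal, x)) := by
  have hD1 : ∀ (_ : Unit) y, ‖f y‖ ≤ max 1 D := fun _ y => (hD y).trans (le_max_right _ _)
  -- For a one-point index set the one-block partition is the only one, so `ζ` vanishes and only the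
  -- mean offspring term remains.
  have h1 := h.prodMoment_eq (ι := Unit) hξ hX (f := fun _ => f) (fun _ => hf) (le_max_left 1 D)
    hD1 (A := Finset.univ) ⟨(), Finset.mem_univ _⟩ (by simpa using h.one_le) t x
  have hu : (Finset.univ : Finset Unit) = {()} := rfl
  have hpsi : ∀ u, prodMoment Pr X (fun _ : Unit => f) Finset.univ u = psi Pr X u f := fun u =>
    funext fun y => prodMoment_unit f u y
  simp only [hpsi] at h1
  rw [h1]
  congr 1
  · simp
  · refine integral_congr_ae (ae_of_all _ fun s => ?_)
    have hm : Measurable fun y => psi Pr X (t - s.toNNReal) f y :=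
      (h.measurable_psi (α := Unit) (G := fun _ => f) (hf.comp measurable_snd)).comp
        (f := fun y => ((), t - s.toNNReal, y)) (by fun_prop)
    simp only
    rw [h.integral_meanKernel (S := killedKernel P ξ γ)
      (fun p => killedKernel_univ_le hξ h.measurable_rate p) hm (h.norm_psi_le hD _)]
    simp_rw [hu, zeta_singleton, add_zero]

lemma coe_sub_toNNReal {t : ℝ≥0} {s : ℝ} (hs : s ∈ Set.Ioo (0 : ℝ) t) :
    ((t - s.toNNReal : ℝ≥0) : ℝ) = t - s := by
  rw [NNReal.coe_sub, Real.coe_toNNReal _ hs.1.le]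
  rw [← NNReal.coe_le_coe, Real.coe_toNNReal _ hs.1.le]
  exact hs.2.le

/-- Duhamel integrals solve the first-branching equation with a source. -/
lemma MomentBounds.duhamel_eq (h : MomentBounds γ off Pr X k C M β)
    (hξ : Measurable fun q : ℝ≥0 × Ω₀ => ξ q.1 q.2)
    (hX : IsBranchingMarkovProcess P ξ γ off Pr X) {F : ℝ≥0 → E → ℂ}
    (hF : Measurable fun p : ℝ≥0 × E => F p.1 p.2) {t : ℝ≥0} {B : ℝ}
    (hB : ∀ u ≤ t, ∀ y, ‖F u y‖ ≤ B) (x : E) :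
    duhamel Pr X F t x =
      (∫ s in Set.Ioo (0 : ℝ) t,
        ∫ y, F (t - s.toNNReal) y ∂(killedKernel P ξ γ (s.toNNReal, x))) +
      ∫ s in Set.Ioo (0 : ℝ) t, ∫ y, duhamel Pr X F (t - s.toNNReal) y
        ∂(meanKernel (killedKernel P ξ γ) γ off (s.toNNReal, x)) := by
  have hS : ∀ p, killedKernel P ξ γ p Set.univ ≤ 1 := fun p =>
    killedKernel_univ_le hξ h.measurable_rate p
  have := h.isFiniteKernel_meanKernel hS
  have hB0 : 0 ≤ B := (norm_nonneg _).trans (hB t le_rfl x)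
  have hFm : ∀ u, Measurable (F u) := fun u => hF.comp (f := fun y => (u, y)) (by fun_prop)
  have hint1 : IntegrableOn (fun s : ℝ => psi Pr X s.toNNReal (F (t - s.toNNReal)) x)
      (Set.Ioo 0 (t : ℝ)) := by
    refine Measure.integrableOn_of_bounded (M := B * (2 * Real.exp (β * t))) (by simp) ?_ ?_
    · exact ((h.measurable_psi hF).comp (f := fun s : ℝ => (t - s.toNNReal, s.toNNReal, x))
        (by fun_prop)).aestronglyMeasurable
    · refine (ae_restrict_iff' measurableSet_Ioo).2 (ae_of_all _ fun s hs => ?_)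
      refine (h.norm_psi_le (fun y => hB _ tsub_le_self y) _ x).trans ?_
      rw [Real.coe_toNNReal _ hs.1.le]
      have := mul_le_mul_of_nonneg_left hs.2.le h.beta_nonneg
      gcongr
  have hint2 := integrableOn_integral_kernel (κ := killedKernel P ξ γ) hF t hB x
  have hφ : Measurable fun p : ℝ × ℝ × E =>
      psi Pr X p.1.toNNReal (F p.2.1.toNNReal) p.2.2 :=
    (h.measurable_psi hF).comp
      (f := fun p : ℝ × ℝ × E => (p.2.1.toNNReal, p.1.toNNReal, p.2.2)) (by fun_prop)
  have hfub := duhamel_fubini (meanKernel (killedKernel P ξ γ) γ off) x t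
    (φ := fun s u y => psi Pr X s.toNNReal (F u.toNNReal) y) hφ
    (B := B * (2 * Real.exp (β * t))) (by positivity) (by
      intro s u y hs hu hsu
      have hut : u.toNNReal ≤ t := by
        rw [← NNReal.coe_le_coe, Real.coe_toNNReal _ hu.le]
        linarith
      refine (h.norm_psi_le (fun y => hB _ hut y) _ y).trans ?_
      rw [Real.coe_toNNReal _ hs.le]
      have := mul_le_mul_of_nonneg_left (by linarith : s ≤ t) h.beta_nonneg
      gcongr)
  have hr : ∫ r in Set.Ioo (0 : ℝ) t, ∫ y, (∫ s in Set.Ioo 0 ((t : ℝ) - r),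
        psi Pr X s.toNNReal (F ((t : ℝ) - r - s).toNNReal) y)
        ∂(meanKernel (killedKernel P ξ γ) γ off (r.toNNReal, x)) =
      ∫ s in Set.Ioo (0 : ℝ) t, ∫ y, duhamel Pr X F (t - s.toNNReal) y
        ∂(meanKernel (killedKernel P ξ γ) γ off (s.toNNReal, x)) := by
    refine setIntegral_congr_fun measurableSet_Ioo fun r hr => ?_
    refine integral_congr_ae (ae_of_all _ fun y => ?_)
    simp only [duhamel, coe_sub_toNNReal hr]
    refine setIntegral_congr_fun measurableSet_Ioo fun s hs => ?_
    congr 2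
    rw [← NNReal.coe_inj, Real.coe_toNNReal _ (by linarith [hs.2]),
      coe_sub_toNNReal (by rw [coe_sub_toNNReal hr]; exact hs), coe_sub_toNNReal hr]
  -- The inner integral over `r` is what the renewal equation for `ψ_s[F_{t-s}]` leaves after its
  -- unbranched term. After Fubini the same double integral is the Duhamel integral propagated by
  -- the mean kernel.
  have hl : ∫ s in Set.Ioo (0 : ℝ) t, ∫ r in Set.Ioo 0 s, ∫ y,
        psi Pr X (s - r).toNNReal (F ((t : ℝ) - s).toNNReal) y
        ∂(meanKernel (killedKernel P ξ γ) γ off (r.toNNReal, x)) =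
      ∫ s in Set.Ioo (0 : ℝ) t, (psi Pr X s.toNNReal (F (t - s.toNNReal)) x -
        ∫ y, F (t - s.toNNReal) y ∂(killedKernel P ξ γ (s.toNNReal, x))) := by
    refine setIntegral_congr_fun measurableSet_Ioo fun s hs => ?_
    rw [h.psi_eq hξ hX (hFm _) (fun y => hB _ tsub_le_self y) s.toNNReal x, add_sub_cancel_left,
      Real.coe_toNNReal _ hs.1.le]
    refine setIntegral_congr_fun measurableSet_Ioo fun r hr => ?_
    refine integral_congr_ae (ae_of_all _ fun y => ?_)
    have e1 : (s - r).toNNReal = s.toNNReal - r.toNNReal := by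
      rw [← NNReal.coe_inj, Real.coe_toNNReal _ (by linarith [hr.2]), coe_sub_toNNReal,
        Real.coe_toNNReal _ hs.1.le]
      rw [Real.coe_toNNReal _ hs.1.le]
      exact hr
    have e2 : ((t : ℝ) - s).toNNReal = t - s.toNNReal := by
      rw [← NNReal.coe_inj, Real.coe_toNNReal _ (by linarith [hs.2]), coe_sub_toNNReal hs]
    rw [e1, e2]
  rw [hl, hr, integral_sub hint1 hint2] at hfub
  rw [← hfub, duhamel]
  ring

variable [Fintype ι] [DecidableEq ι]

/-- The evolution equation for product moments. -/
theorem MomentBounds.prodMoment_evolution (h : MomentBounds γ off Pr X k C M β)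
    (hξ : Measurable fun q : ℝ≥0 × Ω₀ => ξ q.1 q.2)
    (hX : IsBranchingMarkovProcess P ξ γ off Pr X)
    {f : ι → E → ℂ} (hf : ∀ i, Measurable (f i)) {D : ℝ} (hD : 1 ≤ D)
    (hfD : ∀ i y, ‖f i y‖ ≤ D) {A : Finset ι} (hA : A.Nonempty) (hAk : A.card ≤ k)
    (t : ℝ≥0) (x : E) :
    prodMoment Pr X f A t x = psi Pr X t (fun y => ∏ i ∈ A, f i y) x +
      ∫ s in Set.Ioo (0 : ℝ) t, psi Pr X s.toNNReal (fun y => (γ y : ℂ) *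
        zeta off A (fun B => prodMoment Pr X f B (t - s.toNNReal)) y) x := by
  have hS : ∀ p, killedKernel P ξ γ p Set.univ ≤ 1 := fun p =>
    killedKernel_univ_le hξ h.measurable_rate p
  have hKfin := h.isFiniteKernel_meanKernel hS
  have hγ := h.measurable_rate
  have hM0 : 0 ≤ M := h.offspring.nonneg x
  set K := meanKernel (killedKernel P ξ γ) γ off with hK
  set F : ℝ≥0 → E → ℂ := fun u y => (γ y : ℂ) * zeta off A (fun B => prodMoment Pr X f B u) y
    with hFdef
  have hmom := h.measurable_prodMoment hf
  have hFm : Measurable fun p : ℝ≥0 × E => F p.1 p.2 := by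
    refine Measurable.mul ?_ ?_
    · exact Complex.measurable_ofReal.comp
        (measurable_coe_nnreal_real.comp (hγ.comp measurable_snd))
    · exact measurable_zeta off (G := fun u B => prodMoment Pr X f B u) fun B _ => hmom B
  set g : E → ℂ := fun y => ∏ i ∈ A, f i y with hg
  have hgm : Measurable g := Finset.measurable_fun_prod _ fun i _ => hf i
  have hgD : ∀ y, ‖g y‖ ≤ D ^ A.card := fun y => by
    rw [hg, norm_prod, ← Finset.prod_const]
    exact Finset.prod_le_prod (fun _ _ => norm_nonneg _) fun i _ => hfD i y
  have hexp : ∀ {u T : ℝ≥0}, u ≤ T → Real.exp (β * u) ≤ Real.exp (β * T) := fun {u T} hu =>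
    Real.exp_le_exp.2 (mul_le_mul_of_nonneg_left (NNReal.coe_le_coe.2 hu) h.beta_nonneg)
  set BF : ℝ≥0 → ℝ := fun T => C * ((A.card * (D ^ k * (1 + 2 * Real.exp (β * T))) ^ k) * M)
    with hBF
  have hFB : ∀ T : ℝ≥0, ∀ u ≤ T, ∀ y, ‖F u y‖ ≤ BF T := by
    intro T u hu y
    have hpos := Real.exp_pos (β * u)
    obtain ⟨hb, hW⟩ := h.norm_prodMoment_prod_le hD hfD hAk u
    have h1 := norm_zeta_le h.offspring hA hAk (by positivity) hb hW y
    have h2 : ‖((γ y : ℝ) : ℂ)‖ ≤ C := by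
      rw [Complex.norm_real, Real.norm_of_nonneg (γ y).coe_nonneg]
      exact_mod_cast h.rate_le y
    rw [hFdef, norm_mul]
    refine mul_le_mul h2 (h1.trans ?_) (norm_nonneg _) C.coe_nonneg
    have := hexp hu
    gcongr
  have hw := h.measurable_duhamel hFm
  -- `R` is the defect in the evolution equation. All inhomogeneous terms cancel between the three
  -- renewal equations, so `R` solves the homogeneous one, `heq`, and Grönwall with constant `0`
  -- forces it to vanish.
  set R : ℝ≥0 → E → ℂ := fun u y =>
    prodMoment Pr X f A u y - psi Pr X u g y - duhamel Pr X F u y with hR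
  have hpsim : Measurable fun p : ℝ≥0 × E => psi Pr X p.1 g p.2 :=
    (h.measurable_psi (α := Unit) (G := fun _ => g) (hgm.comp measurable_snd)).comp
      (f := fun p : ℝ≥0 × E => ((), p.1, p.2)) (by fun_prop)
  have b1 : ∀ T : ℝ≥0, ∀ u ≤ T, ∀ y, ‖prodMoment Pr X f A u y‖ ≤
      D ^ k * (1 + 2 * Real.exp (β * T)) := fun T u hu y => by
    have := hexp hu
    exact (h.norm_prodMoment_le hD hfD hAk u y).trans (by gcongr)
  have b2 : ∀ T : ℝ≥0, ∀ u ≤ T, ∀ y, ‖psi Pr X u g y‖ ≤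
      D ^ A.card * (2 * Real.exp (β * T)) := fun T u hu y => by
    have := hexp hu
    exact (h.norm_psi_le hgD u y).trans (by gcongr)
  have b3 : ∀ T : ℝ≥0, ∀ u ≤ T, ∀ y, ‖duhamel Pr X F u y‖ ≤
      BF T * (2 * Real.exp (β * T)) * T := fun T u hu y => by
    have := hexp hu
    have h0 : 0 ≤ BF T := (norm_nonneg _).trans (hFB T u hu y)
    have hu' : (u : ℝ) ≤ T := hu
    exact (h.norm_duhamel_le (fun v hv y => hFB T v (hv.trans hu) y) y).trans (by gcongr)
  have heq : ∀ T y, R T y = ∫ s in Set.Ioo (0 : ℝ) T, ∫ z, R (T - s.toNNReal) z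
      ∂(K (s.toNNReal, y)) := by
    intro T y
    have i1 := integrableOn_integral_kernel (κ := K) (hmom A) T (b1 T) y
    have i2 := integrableOn_integral_kernel (κ := K) hpsim T (b2 T) y
    have i3 := integrableOn_integral_kernel (κ := K) hw T (b3 T) y
    have i4 := integrableOn_integral_kernel (κ := killedKernel P ξ γ) hFm T (hFB T) y
    have hsplit : ∀ s : ℝ, ∫ z, R (T - s.toNNReal) z ∂(K (s.toNNReal, y)) =
        ∫ z, prodMoment Pr X f A (T - s.toNNReal) z ∂(K (s.toNNReal, y)) -
        ∫ z, psi Pr X (T - s.toNNReal) g z ∂(K (s.toNNReal, y)) -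
        ∫ z, duhamel Pr X F (T - s.toNNReal) z ∂(K (s.toNNReal, y)) := by
      intro s
      have hle : T - s.toNNReal ≤ T := tsub_le_self
      have j1 : Integrable (fun z => prodMoment Pr X f A (T - s.toNNReal) z) (K (s.toNNReal, y)) :=
        Integrable.of_bound ((hmom A).comp (f := fun z => (T - s.toNNReal, z))
          (by fun_prop)).aestronglyMeasurable _ (ae_of_all _ (b1 T _ hle))
      have j2 : Integrable (fun z => psi Pr X (T - s.toNNReal) g z) (K (s.toNNReal, y)) :=
        Integrable.of_bound (hpsim.comp (f := fun z => (T - s.toNNReal, z))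
          (by fun_prop)).aestronglyMeasurable _ (ae_of_all _ (b2 T _ hle))
      have j3 : Integrable (fun z => duhamel Pr X F (T - s.toNNReal) z) (K (s.toNNReal, y)) :=
        Integrable.of_bound (hw.comp (f := fun z => (T - s.toNNReal, z))
          (by fun_prop)).aestronglyMeasurable _ (ae_of_all _ (b3 T _ hle))
      have e1 := integral_sub (j1.sub j2) j3
      have e2 := integral_sub j1 j2
      simp only [Pi.sub_apply] at e1
      rw [← e2, ← e1]
    have e1 := h.prodMoment_eq hξ hX hf hD hfD hA hAk T y
    have e2 := h.psi_eq hξ hX hgm hgD T y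
    have e3 := h.duhamel_eq hξ hX hFm (hFB T) y
    have e4 : ∫ s in Set.Ioo (0 : ℝ) T, ∫ z, (γ z : ℂ) *
        (∫ c, pair c (prodMoment Pr X f A (T - s.toNNReal)) ∂(off z) +
          zeta off A (fun B => prodMoment Pr X f B (T - s.toNNReal)) z)
        ∂(killedKernel P ξ γ (s.toNNReal, y)) =
        (∫ s in Set.Ioo (0 : ℝ) T, ∫ z, prodMoment Pr X f A (T - s.toNNReal) z
          ∂(K (s.toNNReal, y))) +
        ∫ s in Set.Ioo (0 : ℝ) T, ∫ z, F (T - s.toNNReal) z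
          ∂(killedKernel P ξ γ (s.toNNReal, y)) := by
      rw [← integral_add i1 i4]
      refine integral_congr_ae (ae_of_all _ fun s => ?_)
      beta_reduce
      have hle : T - s.toNNReal ≤ T := tsub_le_self
      have hm1 : Measurable (prodMoment Pr X f A (T - s.toNNReal)) :=
        (hmom A).comp (f := fun z => (T - s.toNNReal, z)) (by fun_prop)
      rw [h.integral_meanKernel hS hm1 (b1 T _ hle), ← integral_add]
      · simp only [mul_add, hFdef]
      · have hmpair : Measurable fun z => (γ z : ℂ) *
            ∫ c, pair c (prodMoment Pr X f A (T - s.toNNReal)) ∂(off z) := by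
          refine Measurable.mul (Complex.measurable_ofReal.comp
            (measurable_coe_nnreal_real.comp hγ)) ?_
          exact (StronglyMeasurable.integral_kernel (κ := off) ((measurable_pair (α := Unit)
            (G := fun _ => prodMoment Pr X f A (T - s.toNNReal)) (hm1.comp measurable_snd)).comp
            (f := fun c => ((), c)) (by fun_prop)).stronglyMeasurable).measurable
        refine Integrable.of_bound hmpair.aestronglyMeasurable
          (C * ((D ^ k * (1 + 2 * Real.exp (β * T))) * M)) (ae_of_all _ fun z => ?_)
        have h2 : ‖((γ z : ℝ) : ℂ)‖ ≤ C := by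
          rw [Complex.norm_real, Real.norm_of_nonneg (γ z).coe_nonneg]
          exact_mod_cast h.rate_le z
        rw [norm_mul]
        refine mul_le_mul h2 ?_ (norm_nonneg _) C.coe_nonneg
        exact h.offspring.norm_integral_le le_rfl h.one_le (by positivity)
          (fun c => by rw [pow_one]; exact norm_pair_le (b1 T _ hle) c) z
      · exact Integrable.of_bound (hFm.comp (f := fun z => (T - s.toNNReal, z))
          (by fun_prop)).aestronglyMeasurable _ (ae_of_all _ (hFB T _ hle))
    rw [e4] at e1
    simp_rw [hsplit]
    have e5 := integral_sub (i1.sub i2) i3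
    have e6 := integral_sub i1 i2
    simp only [Pi.sub_apply] at e5
    rw [e5, e6]
    simp only [hR]
    rw [e1, e2, e3]
    ring
  have hzero : R t x = 0 := by
    set BR : ℝ := D ^ k * (1 + 2 * Real.exp (β * t)) + D ^ A.card * (2 * Real.exp (β * t)) +
      BF t * (2 * Real.exp (β * t)) * t with hBR
    have hRB : ∀ u ≤ t, ∀ y, ‖R u y‖ ≤ BR := by
      intro u hu y
      refine (norm_sub_le _ _).trans (add_le_add ((norm_sub_le _ _).trans ?_) (b3 t u hu y))
      exact add_le_add (b1 t u hu y) (b2 t u hu y)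
    -- The bounds on `R` are only local in time, so it is cut off after time `t` to obtain a
    -- globally bounded function.
    have hgr := gronwall_iSup (fun u y => if u ≤ t then ‖R u y‖ₑ else 0) 0 (C * M.toNNReal)
      BR.toNNReal ?_ ?_ t x
    · simpa using hgr
    · intro u y
      split_ifs with hu
      · rw [← ofReal_norm]
        exact ENNReal.ofReal_le_ofReal (hRB u hu y)
      · exact zero_le
    · intro u y
      split_ifs with hu
      · rw [ENNReal.coe_zero, zero_add, heq u y]
        calc _ ≤ ∫⁻ s in Set.Ioo (0 : ℝ) u, ‖∫ z, R (u - s.toNNReal) z ∂(K (s.toNNReal, y))‖ₑ :=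
              enorm_integral_le_lintegral_enorm _
          _ ≤ ∫⁻ s in Set.Ioo (0 : ℝ) u, (C * M.toNNReal : ℝ≥0) *
              ⨆ z, if u - s.toNNReal ≤ t then ‖R (u - s.toNNReal) z‖ₑ else 0 := by
              refine lintegral_mono fun s => ?_
              have hut : u - s.toNNReal ≤ t := tsub_le_self.trans hu
              simp only [hut, if_true]
              calc _ ≤ ∫⁻ z, ‖R (u - s.toNNReal) z‖ₑ ∂(K (s.toNNReal, y)) :=
                    enorm_integral_le_lintegral_enorm _
                _ ≤ ∫⁻ z, (⨆ z, ‖R (u - s.toNNReal) z‖ₑ) ∂(K (s.toNNReal, y)) :=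
                    lintegral_mono fun z => le_iSup (fun z => ‖R (u - s.toNNReal) z‖ₑ) z
                _ ≤ _ := by
                    rw [lintegral_const, mul_comm]
                    refine mul_le_mul' ?_ le_rfl
                    rw [ENNReal.coe_mul]
                    exact h.meanKernel_univ_le hS _
          _ = _ := lintegral_const_mul' _ _ ENNReal.coe_ne_top
      · exact zero_le
  have := sub_eq_zero.1 hzero
  rw [sub_eq_iff_eq_add] at this
  rw [this, add_comm]
  rfl

end Evolution


/-! ### Spectral algebra -/

section Spectral

variable {E : Type*} [MeasurableSpace E]

/-- `T` maps functions bounded by `M` to functions bounded by `C * M`. -/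
def OpBound (T : BddFun E → BddFun E) (C : ℝ) : Prop :=
  ∀ (f : BddFun E) (M : ℝ), (∀ x, ‖(f : E → ℂ) x‖ ≤ M) → ∀ x, ‖(T f : E → ℂ) x‖ ≤ C * M

lemma BddFun.measurable (f : BddFun E) : Measurable (f : E → ℂ) := f.2.1

lemma BddFun.exists_bound (f : BddFun E) : ∃ C : ℝ, 0 ≤ C ∧ ∀ x, ‖(f : E → ℂ) x‖ ≤ C := by
  obtain ⟨C, hC⟩ := f.2.2
  exact ⟨max C 0, le_max_right _ _, fun x => (hC x).trans (le_max_left _ _)⟩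

lemma BddFun.coe_sum {β : Type*} (s : Finset β) (f : β → BddFun E) (x : E) :
    ((∑ b ∈ s, f b : BddFun E) : E → ℂ) x = ∑ b ∈ s, (f b : E → ℂ) x := by
  rw [Submodule.coe_sum, Finset.sum_apply]

lemma BddFun.coe_smul (c : ℂ) (f : BddFun E) (x : E) :
    ((c • f : BddFun E) : E → ℂ) x = c * (f : E → ℂ) x := rfl

namespace SpectralData

variable (D : SpectralData E)

/-- The index set of the family `φ`. -/
abbrev Idx : Type := Σ i : Fin (D.r + 1), Σ j : Fin (D.p i), Fin (D.k i j)

/-- The eigenfunctions, as a family over `Idx`. -/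
def eigenvec (a : D.Idx) : BddFun E := D.phi a.1 a.2.1 a.2.2

/-- The dual functionals, as a family over `Idx`. -/
def dual (a : D.Idx) : BddFun E →ₗ[ℂ] ℂ := D.phiDual a.1 a.2.1 a.2.2

lemma Phi_eq (i : Fin (D.r + 1)) (f : BddFun E) :
    D.Phi i f = ∑ a : D.Idx, D.dual a f • (if a.1 = i then D.eigenvec a else 0) := by
  rw [Fintype.sum_sigma, Finset.sum_eq_single i]
  · rw [Fintype.sum_sigma, Phi]
    refine Finset.sum_congr rfl fun j _ => ?_
    simp [PhiJ, dual, eigenvec]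
  · intro b _ hb
    simp [hb]
  · simp

lemma Phi_add (i : Fin (D.r + 1)) (f g : BddFun E) : D.Phi i (f + g) = D.Phi i f + D.Phi i g := by
  simp_rw [Phi_eq, map_add, add_smul, Finset.sum_add_distrib]

lemma Phi_smul (i : Fin (D.r + 1)) (c : ℂ) (f : BddFun E) : D.Phi i (c • f) = c • D.Phi i f := by
  simp_rw [Phi_eq, map_smul, smul_eq_mul, mul_smul, Finset.smul_sum]

lemma expN_add (t : ℝ) (f g : BddFun E) : D.expN t (f + g) = D.expN t f + D.expN t g := by
  simp_rw [expN, map_add, smul_add, Finset.sum_add_distrib]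

lemma expN_smul (t : ℝ) (c : ℂ) (f : BddFun E) : D.expN t (c • f) = c • D.expN t f := by
  simp_rw [expN, map_smul, Finset.smul_sum, smul_comm c]

lemma Phi_sub (i : Fin (D.r + 1)) (f g : BddFun E) : D.Phi i (f - g) = D.Phi i f - D.Phi i g := by
  have h := D.Phi_add i (f - g) g
  rw [sub_add_cancel] at h
  rw [h, add_sub_cancel_right]

lemma expN_sub (t : ℝ) (f g : BddFun E) : D.expN t (f - g) = D.expN t f - D.expN t g := by
  have h := D.expN_add t (f - g) g
  rw [sub_add_cancel] at h
  rw [h, add_sub_cancel_right]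

lemma N_pow_apply_eq_zero {d n : ℕ} {f : BddFun E} (hd : (D.N ^ (d + 1)) f = 0) (hn : d < n) :
    (D.N ^ n) f = 0 := by
  rw [← Nat.sub_add_cancel (Nat.succ_le_of_lt hn), pow_add, Module.End.mul_apply,
    Nat.succ_eq_add_one, hd, map_zero]

lemma measurable_expN {h : BddFun E} : Measurable fun p : ℝ × E => (D.expN p.1 h : E → ℂ) p.2 := by
  simp_rw [expN, BddFun.coe_sum, BddFun.coe_smul]
  refine Finset.measurable_fun_sum _ fun n _ => Measurable.mul ?_ ?_
  · fun_prop
  · exact (BddFun.measurable ((D.N ^ n) h)).comp measurable_snd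

end SpectralData

namespace AssumptionH1

open SpectralData

variable {ψ : ℝ≥0 → (E → ℂ) → E → ℂ} (H : AssumptionH1 ψ)

lemma dual_eigenvec (a b : H.Idx) :
    H.dual a (H.eigenvec b) = if a = b then 1 else 0 := by
  split_ifs with h
  · subst h
    exact H.phiDual_self _ _ _
  · exact H.phiDual_other a b h

lemma Phi_eigenvec (i : Fin (H.r + 1)) (a : H.Idx) :
    H.Phi i (H.eigenvec a) = if a.1 = i then H.eigenvec a else 0 := by
  simp_rw [Phi_eq, dual_eigenvec]
  rw [Finset.sum_eq_single a]
  · simp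
  · intro b _ hb
    simp [hb]
  · simp

/-- By biorthogonality, subtracting the spectral projection of `f` leaves an element of the common
kernel of the functionals, where `𝒩` vanishes. Hence `𝒩` has finite rank and is determined by its
action on the Jordan chains. -/
lemma N_eq (f : BddFun E) : H.N f = ∑ a : H.Idx, H.dual a f • H.N (H.eigenvec a) := by
  have h : H.N (f - ∑ a : H.Idx, H.dual a f • H.eigenvec a) = 0 := by
    refine H.N_ker _ fun i j q => ?_
    change H.dual ⟨i, j, q⟩ _ = 0
    rw [map_sub, map_sum, Finset.sum_eq_single ⟨i, j, q⟩]
    · rw [map_smul, dual_eigenvec]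
      simp
    · intro b _ hb
      rw [map_smul, dual_eigenvec, if_neg hb.symm, smul_zero]
    · simp
  rw [map_sub, sub_eq_zero, map_sum] at h
  simpa using h

lemma N_eigenvec (a : H.Idx) :
    H.N (H.eigenvec a) = 0 ∨ ∃ b : H.Idx, b.1 = a.1 ∧ H.N (H.eigenvec a) = H.eigenvec b := by
  obtain ⟨i, ⟨j, hj⟩, q⟩ := a
  rcases j with _ | j
  · exact Or.inl (H.N_bottom i hj q)
  · obtain ⟨kstar, -, hk⟩ := H.N_shift i j hj
    exact Or.inr ⟨⟨i, ⟨j, Nat.lt_of_succ_lt hj⟩, kstar q⟩, rfl, hk q⟩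

lemma Phi_zero (i : Fin (H.r + 1)) : H.Phi i 0 = 0 := by
  have := H.Phi_smul i 0 0
  simpa using this

lemma Phi_sum (i : Fin (H.r + 1)) {β : Type*} (s : Finset β) (f : β → BddFun E) :
    H.Phi i (∑ b ∈ s, f b) = ∑ b ∈ s, H.Phi i (f b) := by
  classical
  induction s using Finset.induction_on with
  | empty => simpa using H.Phi_zero i
  | insert b s hb ih => rw [Finset.sum_insert hb, Finset.sum_insert hb, Phi_add, ih]

lemma Phi_N_eigenvec (i : Fin (H.r + 1)) (a : H.Idx) :
    H.Phi i (H.N (H.eigenvec a)) = if a.1 = i then H.N (H.eigenvec a) else 0 := by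
  rcases H.N_eigenvec a with h | ⟨b, hb, h⟩
  · rw [h, Phi_zero]
    simp
  · rw [h, Phi_eigenvec, hb]

/-- `𝒩` sends a generalised eigenfunction to zero or to another one with the same eigenvalue, so it
respects the decomposition into eigenvalue blocks. -/
lemma Phi_N (i : Fin (H.r + 1)) (f : BddFun E) : H.Phi i (H.N f) = H.N (H.Phi i f) := by
  rw [H.N_eq f, Phi_sum, Phi_eq H.toSpectralData i f, map_sum]
  refine Finset.sum_congr rfl fun a _ => ?_
  rw [Phi_smul, Phi_N_eigenvec, map_smul]
  split_ifs <;> simp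

lemma Phi_N_pow (i : Fin (H.r + 1)) (n : ℕ) (f : BddFun E) :
    H.Phi i ((H.N ^ n) f) = (H.N ^ n) (H.Phi i f) := by
  induction n generalizing f with
  | zero => simp
  | succ n ih => rw [pow_succ, Module.End.mul_apply, Module.End.mul_apply, ih, Phi_N]

lemma Phi_expN (i : Fin (H.r + 1)) (t : ℝ) (f : BddFun E) :
    H.Phi i (H.expN t f) = H.expN t (H.Phi i f) := by
  rw [expN, Phi_sum, expN]
  exact Finset.sum_congr rfl fun n _ => by rw [Phi_smul, Phi_N_pow]

lemma N_pow_phi (i : Fin (H.r + 1)) (j : ℕ) (h : j < H.p i) (q : Fin (H.k i ⟨j, h⟩)) :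
    (H.N ^ (j + 1)) (H.phi i ⟨j, h⟩ q) = 0 := by
  induction j with
  | zero => simpa using H.N_bottom i h q
  | succ j ih =>
    obtain ⟨kstar, -, hk⟩ := H.N_shift i j h
    rw [pow_succ, Module.End.mul_apply, hk, ih]

/-- Each application of `𝒩` lowers the position in a chain. The exponent one above the sum of all `p
i` exceeds every chain length and leaves one factor to be expanded by `N_eq`. -/
lemma isNilpotent_N : IsNilpotent H.N := by
  refine ⟨∑ i, H.p i + 1, LinearMap.ext fun f => ?_⟩
  rw [pow_succ, Module.End.mul_apply, H.N_eq, map_sum, LinearMap.zero_apply]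
  refine Finset.sum_eq_zero fun a _ => ?_
  rw [map_smul, ← Module.End.mul_apply, ← pow_succ]
  have h1 : a.2.1.1 + 1 ≤ ∑ i, H.p i + 1 := by
    have := Finset.single_le_sum (f := H.p) (fun _ _ => Nat.zero_le _) (Finset.mem_univ a.1)
    have := a.2.1.2
    omega
  rw [← Nat.sub_add_cancel h1, pow_add, Module.End.mul_apply]
  have h2 : (H.N ^ (a.2.1.1 + 1)) (H.eigenvec a) = 0 := H.N_pow_phi a.1 a.2.1.1 a.2.1.2 a.2.2
  rw [h2, map_zero, smul_zero]

lemma N_pow_eq_zero {n : ℕ} (hn : nilpotencyClass H.N ≤ n) : H.N ^ n = 0 :=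
  pow_eq_zero_of_le hn (pow_nilpotencyClass H.isNilpotent_N)

/-- Identification with the exponential of a nilpotent element, whose addition formula yields the
group law `expN_expN`. -/
lemma expN_eq_exp (t : ℝ) (f : BddFun E) :
    letI : Module ℚ (Module.End ℂ (BddFun E)) := Module.compHom _ (algebraMap ℚ ℂ)
    H.expN t f = IsNilpotent.exp ((t : ℂ) • H.N) f := by
  rw [IsNilpotent.exp_eq_sum (k := nilpotencyClass H.N)
    (by rw [smul_pow, H.N_pow_eq_zero le_rfl, smul_zero]), LinearMap.sum_apply]
  refine Finset.sum_congr rfl fun n _ => ?_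
  change _ = (((((n.factorial : ℚ)⁻¹ : ℚ) : ℂ)) • ((t : ℂ) • H.N) ^ n) f
  rw [smul_pow, smul_smul, LinearMap.smul_apply]
  congr 1
  push_cast
  ring

lemma expN_expN (s t : ℝ) (f : BddFun E) : H.expN s (H.expN t f) = H.expN (s + t) f := by
  let _ : Module ℚ (Module.End ℂ (BddFun E)) := Module.compHom _ (algebraMap ℚ ℂ)
  have hn : ∀ u : ℝ, IsNilpotent ((u : ℂ) • H.N) := fun u =>
    ⟨nilpotencyClass H.N, by rw [smul_pow, H.N_pow_eq_zero le_rfl, smul_zero]⟩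
  rw [expN_eq_exp, expN_eq_exp, expN_eq_exp, ← Module.End.mul_apply,
    ← IsNilpotent.exp_add_of_commute _ (hn s) (hn t), ← add_smul]
  · push_cast
    rfl
  · exact ((Commute.refl H.N).smul_left _).smul_right _

lemma opBound_of_eq_sum {T : BddFun E → BddFun E} (u : H.Idx → BddFun E)
    (hT : ∀ f, T f = ∑ a, H.dual a f • u a) : ∃ C : ℝ, 0 ≤ C ∧ OpBound T C := by
  choose B hB using fun a : H.Idx => BddFun.exists_bound (u a)
  choose c hc using fun a : H.Idx => H.phiDual_bounded a.1 a.2.1 a.2.2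
  refine ⟨∑ a, |c a| * B a, Finset.sum_nonneg fun a _ => mul_nonneg (abs_nonneg _) (hB a).1,
    fun f M hf x => ?_⟩
  have hM : 0 ≤ M := (norm_nonneg _).trans (hf x)
  rw [hT, BddFun.coe_sum, Finset.sum_mul]
  refine norm_sum_le_of_le _ fun a _ => ?_
  rw [BddFun.coe_smul, norm_mul, mul_right_comm]
  refine mul_le_mul ((hc a f M hf).trans ?_) ((hB a).2 x) (norm_nonneg _) (by positivity)
  exact mul_le_mul_of_nonneg_right (le_abs_self _) hM

lemma exists_opBound_Phi : ∃ C : ℝ, 0 ≤ C ∧ ∀ i, OpBound (H.Phi i) C := by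
  choose C hC using fun i => H.opBound_of_eq_sum _ (H.Phi_eq i)
  refine ⟨∑ i, C i, Finset.sum_nonneg fun i _ => (hC i).1, fun i f M hf x => ?_⟩
  have hM : 0 ≤ M := (norm_nonneg _).trans (hf x)
  refine ((hC i).2 f M hf x).trans (mul_le_mul_of_nonneg_right ?_ hM)
  exact Finset.single_le_sum (fun i _ => (hC i).1) (Finset.mem_univ i)

lemma exists_opBound_N_pow : ∃ C : ℝ, 1 ≤ C ∧ ∀ n, OpBound (fun f => (H.N ^ n) f) C := by
  obtain ⟨C, -, hC⟩ := H.opBound_of_eq_sum _ H.N_eq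
  have h1 : ∀ n, OpBound (fun f => (H.N ^ n) f) ((max 1 C) ^ n) := by
    intro n
    induction n with
    | zero =>
      intro f M hf x
      simpa using hf x
    | succ n ih =>
      intro f M hf x
      have hM : 0 ≤ M := (norm_nonneg _).trans (hf x)
      simp only
      rw [pow_succ, Module.End.mul_apply, pow_succ, mul_assoc]
      exact ih _ _ (fun y => (hC f M hf y).trans
        (mul_le_mul_of_nonneg_right (le_max_right _ _) hM)) x
  refine ⟨max 1 C ^ nilpotencyClass H.N, one_le_pow₀ (le_max_left _ _), fun n f M hf x => ?_⟩
  have hM : 0 ≤ M := (norm_nonneg _).trans (hf x)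
  rcases le_total (nilpotencyClass H.N) n with hn | hn
  · rw [H.N_pow_eq_zero hn]
    simp only [LinearMap.zero_apply, ZeroMemClass.coe_zero, Pi.zero_apply, norm_zero]
    positivity
  · exact (h1 n f M hf x).trans (mul_le_mul_of_nonneg_right
      (pow_le_pow_right₀ (le_max_left _ _) hn) hM)

/-- The terms of order above `d` vanish on `f`, so `e^{𝒩u} f` is a polynomial in `u` of degree at
most `d`. The exact degree is kept because it fixes the normalisation in the limit. -/
lemma exists_norm_expN_le : ∃ C : ℝ, 1 ≤ C ∧ ∀ (u : ℝ) (d : ℕ) (f : BddFun E) (M : ℝ),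
    (H.N ^ (d + 1)) f = 0 → (∀ x, ‖(f : E → ℂ) x‖ ≤ M) →
    ∀ x, ‖(H.expN u f : E → ℂ) x‖ ≤ C * (1 + |u|) ^ d * M := by
  obtain ⟨C, hC1, hC⟩ := H.exists_opBound_N_pow
  refine ⟨(nilpotencyClass H.N + 1) * C, ?_, fun u d f M hd hf x => ?_⟩
  · exact one_le_mul_of_one_le_of_one_le (by simp) hC1
  have hM : 0 ≤ M := (norm_nonneg _).trans (hf x)
  rw [expN, BddFun.coe_sum]
  calc _ ≤ ∑ n ∈ Finset.range (nilpotencyClass H.N), C * (1 + |u|) ^ d * M := by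
        refine norm_sum_le_of_le _ fun n _ => ?_
        rcases le_or_gt n d with hn | hn
        · rw [BddFun.coe_smul, norm_mul, norm_div, norm_pow, Complex.norm_real, Complex.norm_natCast]
          have h1 : ‖u‖ ^ n / n.factorial ≤ (1 + |u|) ^ d := by
            calc ‖u‖ ^ n / n.factorial ≤ ‖u‖ ^ n :=
                  div_le_self (by positivity) (by exact_mod_cast n.factorial_pos)
              _ ≤ (1 + |u|) ^ n := by
                  gcongr
                  rw [Real.norm_eq_abs]
                  linarith
              _ ≤ _ := pow_le_pow_right₀ (by linarith [abs_nonneg u]) hn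
          calc _ ≤ (1 + |u|) ^ d * (C * M) :=
                mul_le_mul h1 (hC n f M hf x) (norm_nonneg _) (by positivity)
            _ = _ := by ring
        · rw [N_pow_apply_eq_zero _ hd hn]
          simp only [smul_zero, ZeroMemClass.coe_zero, Pi.zero_apply, norm_zero]
          positivity
    _ = nilpotencyClass H.N * (C * (1 + |u|) ^ d * M) := by simp
    _ ≤ (nilpotencyClass H.N + 1) * (C * (1 + |u|) ^ d * M) := by gcongr; simp
    _ = _ := by ring

/-- The leading order of `e^{𝒩 t} f` for large `t`. -/
lemma exists_norm_expN_sub_le : ∃ C : ℝ, 0 ≤ C ∧ ∀ (t : ℝ) (d : ℕ) (f : BddFun E) (M : ℝ),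
    0 ≤ t → d < nilpotencyClass H.N → (H.N ^ (d + 1)) f = 0 → (∀ x, ‖(f : E → ℂ) x‖ ≤ M) →
    ∀ x, ‖((((1 + t) ^ d)⁻¹ : ℝ) : ℂ) * (H.expN t f : E → ℂ) x -
      (d.factorial : ℂ)⁻¹ * ((H.N ^ d) f : E → ℂ) x‖ ≤ C * M / (1 + t) := by
  obtain ⟨C, hC1, hC⟩ := H.exists_opBound_N_pow
  have hC0 : 0 ≤ C := by linarith
  set K := nilpotencyClass H.N with hK
  refine ⟨K * (K * C), by positivity, fun t d f M ht hdK hd hf x => ?_⟩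
  have hM : 0 ≤ M := (norm_nonneg _).trans (hf x)
  have h1t : 0 < 1 + t := by linarith
  have hcoef : ∀ n < K, ‖((((1 + t) ^ d)⁻¹ : ℝ) : ℂ) * (((t : ℂ) ^ n / (n.factorial : ℂ)) *
      ((H.N ^ n) f : E → ℂ) x) - (if n = d then (d.factorial : ℂ)⁻¹ * ((H.N ^ d) f : E → ℂ) x
        else 0)‖ ≤ K * C * M / (1 + t) := by
    intro n hn
    have hK1 : (1 : ℝ) ≤ K := by exact_mod_cast (Nat.zero_le _).trans_lt hn
    have hfac : (1 : ℝ) ≤ n.factorial := by exact_mod_cast n.factorial_pos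
    have hb := hC n f M hf x
    rcases lt_trichotomy n d with h | h | h
    · rw [if_neg h.ne, sub_zero, ← mul_assoc, norm_mul]
      -- A term of order `n < d` loses at least one full power of `1 + t` against the normalisation.
      have h2 : ‖((((1 + t) ^ d)⁻¹ : ℝ) : ℂ) * ((t : ℂ) ^ n / (n.factorial : ℂ))‖ ≤ K / (1 + t) := by
        rw [norm_mul, norm_div, norm_pow, Complex.norm_real, Complex.norm_real,
          Complex.norm_natCast, Real.norm_of_nonneg ht, Real.norm_of_nonneg (by positivity)]
        obtain ⟨e, rfl⟩ := Nat.exists_eq_add_of_lt h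
        calc ((1 + t) ^ (n + e + 1))⁻¹ * (t ^ n / n.factorial)
            ≤ ((1 + t) ^ (n + e + 1))⁻¹ * (1 + t) ^ (n + e) := by
              refine mul_le_mul_of_nonneg_left ?_ (by positivity)
              calc t ^ n / n.factorial ≤ t ^ n := div_le_self (by positivity) hfac
                _ ≤ (1 + t) ^ n := by gcongr; linarith
                _ ≤ _ := pow_le_pow_right₀ (by linarith) (by omega)
          _ = 1 / (1 + t) := by
              rw [pow_succ (1 + t) (n + e)]
              field_simp
          _ ≤ _ := by gcongr
      calc _ ≤ K / (1 + t) * (C * M) := mul_le_mul h2 hb (norm_nonneg _) (by positivity)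
        _ = _ := by ring
    · subst h
      rw [if_pos rfl]
      have h3 : ((((1 + t) ^ n)⁻¹ : ℝ) : ℂ) * (((t : ℂ) ^ n / (n.factorial : ℂ)) *
          ((H.N ^ n) f : E → ℂ) x) - (n.factorial : ℂ)⁻¹ * ((H.N ^ n) f : E → ℂ) x =
          ((((t / (1 + t)) ^ n - 1) / n.factorial : ℝ) : ℂ) * ((H.N ^ n) f : E → ℂ) x := by
        push_cast
        rw [div_pow]
        ring
      rw [h3, norm_mul, Complex.norm_real, Real.norm_eq_abs]
      have h4 : |((t / (1 + t)) ^ n - 1) / n.factorial| ≤ K / (1 + t) := by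
        have h5 : t / (1 + t) = 1 + -(1 / (1 + t)) := by field_simp; ring
        have h6 : 1 / (1 + t) ≤ 1 := by rw [div_le_one h1t]; linarith
        have hle1 : (t / (1 + t)) ^ n ≤ 1 :=
          pow_le_one₀ (by positivity) (by rw [div_le_one h1t]; linarith)
        -- Bernoulli's inequality: the leading coefficient `(t/(1+t))^n` is within `n/(1+t)` of `1`.
        have h7 := one_add_mul_le_pow (a := -(1 / (1 + t))) (by linarith) n
        rw [← h5] at h7
        rw [abs_div, Nat.abs_cast, abs_of_nonpos (by linarith)]
        calc _ ≤ -((t / (1 + t)) ^ n - 1) := div_le_self (by linarith) hfac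
          _ ≤ n * (1 / (1 + t)) := by linarith
          _ ≤ K * (1 / (1 + t)) := by gcongr
          _ = _ := by ring
      calc _ ≤ K / (1 + t) * (C * M) := mul_le_mul h4 hb (norm_nonneg _) (by positivity)
        _ = _ := by ring
    · rw [if_neg h.ne', N_pow_apply_eq_zero _ hd h]
      simp only [ZeroMemClass.coe_zero, Pi.zero_apply, mul_zero, sub_zero, norm_zero]
      positivity
  have hsplit : ((((1 + t) ^ d)⁻¹ : ℝ) : ℂ) * (H.expN t f : E → ℂ) x -
      (d.factorial : ℂ)⁻¹ * ((H.N ^ d) f : E → ℂ) x =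
      ∑ n ∈ Finset.range K, (((((1 + t) ^ d)⁻¹ : ℝ) : ℂ) * (((t : ℂ) ^ n / (n.factorial : ℂ)) *
        ((H.N ^ n) f : E → ℂ) x) - (if n = d then (d.factorial : ℂ)⁻¹ * ((H.N ^ d) f : E → ℂ) x
        else 0)) := by
    rw [Finset.sum_sub_distrib, ← Finset.mul_sum, Finset.sum_ite_eq' _ d,
      if_pos (Finset.mem_range.2 hdK), expN, BddFun.coe_sum]
    simp_rw [BddFun.coe_smul]
    rfl
  rw [hsplit]
  refine (norm_sum_le_of_le _ fun n hn => hcoef n (Finset.mem_range.1 hn)).trans (le_of_eq ?_)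
  rw [Finset.sum_const, Finset.card_range, nsmul_eq_mul]
  ring

end AssumptionH1

end Spectral


/-! ### Growth of the expectation semigroup -/

lemma exists_one_add_pow_le_exp {κ : ℝ} (hκ : 0 < κ) (d : ℕ) :
    ∃ C : ℝ, 1 ≤ C ∧ ∀ s : ℝ, 0 ≤ s → (1 + s) ^ d ≤ C * Real.exp (κ * s) := by
  refine ⟨max 1 (d.factorial * Real.exp κ / κ ^ d), le_max_left _ _, fun s hs => ?_⟩
  have h := Real.pow_div_factorial_le_exp (κ * (1 + s)) (by positivity) d
  have hd : (0 : ℝ) < d.factorial := by exact_mod_cast d.factorial_pos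
  calc (1 + s) ^ d = d.factorial / κ ^ d * ((κ * (1 + s)) ^ d / d.factorial) := by
        rw [mul_pow]
        field_simp
    _ ≤ d.factorial / κ ^ d * Real.exp (κ * (1 + s)) := by gcongr
    _ = d.factorial * Real.exp κ / κ ^ d * Real.exp (κ * s) := by
        rw [mul_add, mul_one, Real.exp_add]
        ring
    _ ≤ _ := by
        gcongr
        exact le_max_right _ _

section Growth

variable {E Ω : Type*} [MeasurableSpace E] [MeasurableSpace Ω]
  {γ : E → ℝ≥0} {off : Kernel E (Config E)} {Pr : Kernel E Ω} [IsMarkovKernel Pr]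
  {X : ℝ≥0 → Ω → Config E} {k : ℕ} {C : ℝ≥0} {M β : ℝ}

lemma pair_mul (c : Config E) (a : ℂ) (f : E → ℂ) : pair c (fun y => a * f y) = a * pair c f := by
  simp [pair, Finset.mul_sum]

lemma pair_sub (c : Config E) (f g : E → ℂ) :
    pair c (fun y => f y - g y) = pair c f - pair c g := by
  simp [pair]

lemma psi_mul (t : ℝ≥0) (a : ℂ) (f : E → ℂ) (x : E) :
    psi Pr X t (fun y => a * f y) x = a * psi Pr X t f x := by
  simp_rw [psi, pair_mul]
  exact integral_const_mul _ _

lemma MomentBounds.psi_sub (h : MomentBounds γ off Pr X k C M β) {f g : E → ℂ}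
    (hf : Measurable f) {D : ℝ} (hD : ∀ y, ‖f y‖ ≤ D) (hg : Measurable g) {D' : ℝ}
    (hD' : ∀ y, ‖g y‖ ≤ D') (t : ℝ≥0) (x : E) :
    psi Pr X t (fun y => f y - g y) x = psi Pr X t f x - psi Pr X t g x := by
  simp_rw [psi, pair_sub]
  exact integral_sub (h.integrable_pair_X hf hD t x) (h.integrable_pair_X hg hD' t x)

namespace AssumptionH1

open SpectralData

variable (H : AssumptionH1 (psi Pr X))

/-- The leading part `∑ᵢ e^{(λ_i + 𝒩) t} Φ_i[f]` of `ψ_t[f]`. -/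
noncomputable def leading (t : ℝ) (f : BddFun E) (x : E) : ℂ :=
  ∑ i : Fin (H.r + 1), Complex.exp (H.lam i * (t : ℝ)) * (H.expN t (H.Phi i f) : E → ℂ) x

lemma leading_smul (t : ℝ) (a : ℂ) (f : BddFun E) (x : E) :
    H.leading t (a • f) x = a * H.leading t f x := by
  simp_rw [leading, Phi_smul, expN_smul, BddFun.coe_smul, Finset.mul_sum]
  exact Finset.sum_congr rfl fun i _ => by ring

lemma exists_norm_psi_sub_leading_le {ε : ℝ} (hε : 0 < ε) :
    ∃ T : ℝ≥0, ∀ t, T ≤ t → ∀ (f : BddFun E) (m : ℝ), (∀ x, ‖(f : E → ℂ) x‖ ≤ m) → ∀ x,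
      ‖psi Pr X t f x - H.leading t f x‖ ≤
        ε * Real.exp ((H.lam (Fin.last H.r)).re * t) * m := by
  have h1 := (ENNReal.tendsto_nhds_zero.1 H.psi_asymp) (ENNReal.ofReal ε) (by simpa using hε)
  obtain ⟨T, hT⟩ := eventually_atTop.1 h1
  have hone : ∀ t, T ≤ t → ∀ f : BddFun E, (∀ x, ‖(f : E → ℂ) x‖ ≤ 1) → ∀ x,
      ‖psi Pr X t f x - H.leading t f x‖ ≤ ε * Real.exp ((H.lam (Fin.last H.r)).re * t) := by
    intro t ht f hf x
    have h2 := (le_iSup_of_le x (le_iSup_of_le f (le_iSup_of_le hf le_rfl))).trans (hT t ht)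
    rw [← ofReal_norm, ENNReal.ofReal_le_ofReal_iff hε.le, norm_mul, Complex.norm_real,
      Real.norm_of_nonneg (Real.exp_pos _).le, Real.exp_neg, inv_mul_le_iff₀ (Real.exp_pos _),
      mul_comm] at h2
    exact h2
  refine ⟨T, fun t ht f m hf x => ?_⟩
  have hm : 0 ≤ m := (norm_nonneg _).trans (hf x)
  have hscale : ∀ a : ℝ, 0 ≤ a → (∀ x, a * ‖(f : E → ℂ) x‖ ≤ 1) →
      a * ‖psi Pr X t f x - H.leading t f x‖ ≤
        ε * Real.exp ((H.lam (Fin.last H.r)).re * t) := by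
    intro a ha h3
    have h4 := hone t ht ((a : ℂ) • f) (fun y => by
      rw [BddFun.coe_smul, norm_mul, Complex.norm_real, Real.norm_of_nonneg ha]
      exact h3 y) x
    have h5 : psi Pr X t (((a : ℂ) • f : BddFun E) : E → ℂ) x = a * psi Pr X t f x :=
      psi_mul t _ _ x
    rwa [h5, leading_smul, ← mul_sub, norm_mul, Complex.norm_real, Real.norm_of_nonneg ha] at h4
  rcases hm.eq_or_lt with rfl | hm
  -- If `m = 0` then `f = 0`, and every multiple of `f` is admissible in `hscale`. A sufficiently
  -- large factor contradicts a nonzero left side.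
  · rw [mul_zero]
    by_contra hcon
    push Not at hcon
    set y := ‖psi Pr X t f x - H.leading t f x‖
    set b := ε * Real.exp ((H.lam (Fin.last H.r)).re * t)
    have hb : 0 ≤ b := by positivity
    have h6 := hscale ((b + 1) / y) (by positivity) fun z => by
      rw [le_antisymm (hf z) (norm_nonneg _), mul_zero]
      exact zero_le_one
    rw [div_mul_cancel₀ _ hcon.ne'] at h6
    linarith
  · have h6 := hscale m⁻¹ (by positivity) fun z => by
      rw [inv_mul_le_iff₀ hm, mul_one]
      exact hf z
    rwa [inv_mul_le_iff₀ hm, mul_comm] at h6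

lemma re_le (i : Fin (H.r + 1)) : (H.lam i).re ≤ (H.lam 0).re :=
  H.lam_antitone (Fin.zero_le i)

lemma norm_exp_lam (a : ℂ) (t : ℝ) : ‖Complex.exp (a * t)‖ = Real.exp (a.re * t) := by
  rw [Complex.norm_exp]
  simp

lemma exists_norm_expN_Phi_le : ∃ C : ℝ, 1 ≤ C ∧ ∀ (u : ℝ) (i : Fin (H.r + 1)) (f : BddFun E)
    (m : ℝ), (∀ x, ‖(f : E → ℂ) x‖ ≤ m) → ∀ x,
    ‖(H.expN u (H.Phi i f) : E → ℂ) x‖ ≤ C * (1 + |u|) ^ nilpotencyClass H.N * m := by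
  obtain ⟨C₁, hC₁, h1⟩ := H.exists_norm_expN_le
  obtain ⟨C₂, hC₂, h2⟩ := H.exists_opBound_Phi
  refine ⟨C₁ * (C₂ + 1), one_le_mul_of_one_le_of_one_le hC₁ (by linarith), fun u i f m hf x => ?_⟩
  have hm : 0 ≤ m := (norm_nonneg _).trans (hf x)
  refine (h1 u (nilpotencyClass H.N) (H.Phi i f) _ ?_ (h2 i f m hf) x).trans ?_
  · rw [H.N_pow_eq_zero (Nat.le_succ _), LinearMap.zero_apply]
  · calc C₁ * (1 + |u|) ^ nilpotencyClass H.N * (C₂ * m)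
        ≤ C₁ * (1 + |u|) ^ nilpotencyClass H.N * ((C₂ + 1) * m) := by gcongr; linarith
      _ = _ := by ring

/-- For large `t` the spectral expansion dominates, and the polynomial growth of `e^{𝒩t}` is paid
for with `κ` in the exponent. For `t` below the threshold `T` the crude moment bound `2 exp(βT)` is
absorbed into the constant. -/
lemma exists_norm_psi_le (h : MomentBounds γ off Pr X k C M β) {κ : ℝ} (hκ : 0 < κ) :
    ∃ C' : ℝ, 1 ≤ C' ∧ ∀ (t : ℝ≥0) (f : E → ℂ) (m : ℝ), Measurable f → (∀ x, ‖f x‖ ≤ m) →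
      ∀ x, ‖psi Pr X t f x‖ ≤ C' * Real.exp (((H.lam 0).re + κ) * t) * m := by
  obtain ⟨T, hT⟩ := H.exists_norm_psi_sub_leading_le one_pos
  obtain ⟨C₁, hC₁, h1⟩ := H.exists_norm_expN_Phi_le
  obtain ⟨C₂, hC₂, h2⟩ := exists_one_add_pow_le_exp hκ (nilpotencyClass H.N)
  have hR := H.lam_zero_pos
  refine ⟨2 * Real.exp (β * T) + 1 + (H.r + 1) * (C₁ * C₂), ?_, fun t f m hf hfm x => ?_⟩
  · have : 0 ≤ 2 * Real.exp (β * T) + (H.r + 1) * (C₁ * C₂) := by positivity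
    linarith
  have hm : 0 ≤ m := (norm_nonneg _).trans (hfm x)
  have hE1 : 1 ≤ Real.exp (((H.lam 0).re + κ) * t) := Real.one_le_exp (by positivity)
  rcases le_total T t with ht | ht
  · set F : BddFun E := ⟨f, hf, m, hfm⟩
    have h3 : ‖psi Pr X t f x - H.leading t F x‖ ≤ _ := hT t ht F m hfm x
    have h4 : ‖H.leading t F x‖ ≤
        (H.r + 1) * (C₁ * C₂) * Real.exp (((H.lam 0).re + κ) * t) * m := by
      calc _ ≤ ∑ i : Fin (H.r + 1), Real.exp ((H.lam 0).re * t) *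
            (C₁ * (C₂ * Real.exp (κ * t)) * m) := by
            refine norm_sum_le_of_le _ fun i _ => ?_
            rw [norm_mul, norm_exp_lam]
            refine mul_le_mul (Real.exp_le_exp.2 (mul_le_mul_of_nonneg_right (H.re_le i)
              t.coe_nonneg)) ((h1 t i F m hfm x).trans ?_) (norm_nonneg _) (Real.exp_pos _).le
            have := h2 t t.coe_nonneg
            rw [abs_of_nonneg t.coe_nonneg]
            gcongr
        _ = _ := by
            rw [Finset.sum_const, Finset.card_univ, Fintype.card_fin, nsmul_eq_mul, add_mul (H.lam 0).re,
              Real.exp_add]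
            push_cast
            ring
    have h5 : Real.exp ((H.lam (Fin.last H.r)).re * t) ≤ Real.exp (((H.lam 0).re + κ) * t) :=
      Real.exp_le_exp.2 (mul_le_mul_of_nonneg_right ((H.re_le _).trans (by linarith))
        t.coe_nonneg)
    calc _ = ‖(psi Pr X t f x - H.leading t F x) + H.leading t F x‖ := by rw [sub_add_cancel]
      _ ≤ 1 * Real.exp (((H.lam 0).re + κ) * t) * m +
          (H.r + 1) * (C₁ * C₂) * Real.exp (((H.lam 0).re + κ) * t) * m :=
          (norm_add_le _ _).trans (add_le_add (h3.trans (by gcongr)) h4)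
      _ ≤ 2 * Real.exp (β * T) * Real.exp (((H.lam 0).re + κ) * t) * m +
          (1 * Real.exp (((H.lam 0).re + κ) * t) * m +
          (H.r + 1) * (C₁ * C₂) * Real.exp (((H.lam 0).re + κ) * t) * m) :=
          le_add_of_nonneg_left (by positivity)
      _ = _ := by ring
  · refine (h.norm_psi_le hfm t x).trans ?_
    have h6 : Real.exp (β * t) ≤ Real.exp (β * T) :=
      Real.exp_le_exp.2 (mul_le_mul_of_nonneg_left (NNReal.coe_le_coe.2 ht) h.beta_nonneg)
    have h7 : 0 ≤ 1 + (H.r + 1) * (C₁ * C₂) := by positivity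
    calc m * (2 * Real.exp (β * t)) ≤ m * (2 * Real.exp (β * T)) := by gcongr
      _ = (2 * Real.exp (β * T)) * 1 * m := by ring
      _ ≤ _ := by
          gcongr
          linarith

lemma exists_gap : ∃ κ : ℝ, 0 < κ ∧ ∀ i, (H.lam 0).re < 2 * (H.lam i).re →
    (H.lam 0).re / 2 + κ ≤ (H.lam i).re := by
  have : ∀ i, ∃ κ : ℝ, 0 < κ ∧ ((H.lam 0).re < 2 * (H.lam i).re →
      (H.lam 0).re / 2 + κ ≤ (H.lam i).re) := by
    intro i
    by_cases hi : (H.lam 0).re < 2 * (H.lam i).re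
    · exact ⟨(H.lam i).re - (H.lam 0).re / 2, by linarith, fun _ => by linarith⟩
    · exact ⟨1, one_pos, fun h => absurd h hi⟩
  choose κ hκ hκ' using this
  refine ⟨Finset.univ.inf' Finset.univ_nonempty κ, ?_, fun i hi => ?_⟩
  · exact (Finset.lt_inf'_iff _).2 fun i _ => hκ i
  · have := Finset.inf'_le κ (Finset.mem_univ i)
    linarith [hκ' i hi]

end AssumptionH1

end Growth


/-! ### The limit functionals -/

section Limit

variable {E Ω : Type*} [MeasurableSpace E] [MeasurableSpace Ω]
  {γ : E → ℝ≥0} {off : Kernel E (Config E)} [IsMarkovKernel off] {Pr : Kernel E Ω}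
  [IsMarkovKernel Pr] {X : ℝ≥0 → Ω → Config E} {k : ℕ} {C : ℝ≥0} {M β : ℝ}

section General

variable {D : SpectralData E} {ℓ : ℕ} (ν : Fin ℓ → Fin (D.r + 1))

lemma limitL_of_card_le_one {A : Finset (Fin ℓ)} (hA : A.card ≤ 1) (h : Fin ℓ → BddFun E) (x : E) :
    limitL Pr X γ off D ν A h x = ∏ i ∈ A, (D.Phi (ν i) (h i) : E → ℂ) x := by
  rw [limitL, if_pos hA]

lemma limitIntegrand_congr {A : Finset (Fin ℓ)} {G G' : ℝ → Finset (Fin ℓ) → E → ℂ} {s : ℝ}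
    (h : ∀ B, B ⊂ A → G s B = G' s B) (x : E) :
    limitIntegrand Pr X γ off D ν A G x s = limitIntegrand Pr X γ off D ν A G' x s := by
  unfold limitIntegrand
  congr 3
  funext y
  rw [zeta_congr off h]

/-- The guard `B ⊂ A`, needed for termination of the recursion, can be dropped because `ζ_A`
evaluates its argument only at proper subsets. -/
lemma limitL_of_two_le_card {A : Finset (Fin ℓ)} (hA : 2 ≤ A.card) (h : Fin ℓ → BddFun E) (x : E) :
    limitL Pr X γ off D ν A h x = ∫ s in Set.Ioi (0 : ℝ), limitIntegrand Pr X γ off D ν A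
      (fun s B => limitL Pr X γ off D ν B (fun i => D.expN (-s) (h i))) x s := by
  rw [limitL, if_neg (by omega)]
  refine integral_congr_ae (ae_of_all _ fun s => limitIntegrand_congr ν (fun B hB => ?_) x)
  funext y
  simp [hB]

lemma limitL_smul (A : Finset (Fin ℓ)) (c : Fin ℓ → ℂ) (h : Fin ℓ → BddFun E) (x : E) :
    limitL Pr X γ off D ν A (fun i => c i • h i) x =
      (∏ i ∈ A, c i) * limitL Pr X γ off D ν A h x := by
  induction A using Finset.strongInduction generalizing h x with
  | H A ih =>
    rcases le_or_gt A.card 1 with hA | hA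
    · simp_rw [limitL_of_card_le_one ν hA, SpectralData.Phi_smul, BddFun.coe_smul,
        Finset.prod_mul_distrib]
    · rw [limitL_of_two_le_card ν hA, limitL_of_two_le_card ν hA, ← integral_const_mul]
      refine integral_congr_ae (ae_of_all _ fun s => ?_)
      beta_reduce
      rw [limitIntegrand_congr (G' := fun s B y => (∏ i ∈ B, c i) *
        limitL Pr X γ off D ν B (fun i => D.expN (-s) (h i)) y)]
      · unfold limitIntegrand
        simp_rw [zeta_mul, mul_left_comm _ (∏ i ∈ A, c i)]
        rw [psi_mul]
        ring
      · intro B hB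
        funext y
        simp_rw [SpectralData.expN_smul]
        exact ih B hB _ y

end General

lemma MomentBounds.measurable_psi_zeta {ℓ : ℕ} (h : MomentBounds γ off Pr X k C M β) {A : Finset (Fin ℓ)}
    {G : ℝ → Finset (Fin ℓ) → E → ℂ}
    (hG : ∀ B, B ⊂ A → Measurable fun p : ℝ × E => G p.1 B p.2) :
    Measurable fun p : ℝ × ℝ × E => psi Pr X p.2.1.toNNReal
      (fun y => (γ y : ℂ) * zeta off A (G p.1) y) p.2.2 := by
  have h1 : Measurable fun p : ℝ × E => (γ p.2 : ℂ) * zeta off A (G p.1) p.2 := by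
    refine Measurable.mul ?_ (measurable_zeta off hG)
    exact Complex.measurable_ofReal.comp
      (measurable_coe_nnreal_real.comp (h.measurable_rate.comp measurable_snd))
  exact (h.measurable_psi (G := fun u y => (γ y : ℂ) * zeta off A (G u) y) h1).comp
    (f := fun p : ℝ × ℝ × E => (p.1, p.2.1.toNNReal, p.2.2)) (by fun_prop)

namespace AssumptionH1

open SpectralData

variable (H : AssumptionH1 (psi Pr X)) {ℓ : ℕ} (ν : Fin ℓ → Fin (H.r + 1))

/-- The recursion evaluates smaller functionals at `e^{-𝒩s} h`, so the induction needs joint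
measurability along the orbit of `e^{𝒩u}`. By the group law the recursion only shifts `u`. -/
lemma measurable_limitL_expN (h : MomentBounds γ off Pr X k C M β) (A : Finset (Fin ℓ))
    (f : Fin ℓ → BddFun E) :
    Measurable fun p : ℝ × E =>
      limitL Pr X γ off H.toSpectralData ν A (fun i => H.expN p.1 (f i)) p.2 := by
  induction A using Finset.strongInduction with
  | H A ih =>
    rcases le_or_gt A.card 1 with hA | hA
    · simp_rw [limitL_of_card_le_one ν hA, Phi_expN]
      exact Finset.measurable_fun_prod _ fun i _ => measurable_expN _
    · simp_rw [limitL_of_two_le_card ν hA, expN_expN]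
      have h1 : Measurable fun q : (ℝ × E) × ℝ =>
          Complex.exp (-(∑ i ∈ A, H.lam (ν i)) * q.2) * psi Pr X q.2.toNNReal
            (fun y => (γ y : ℂ) * zeta off A (fun B => limitL Pr X γ off H.toSpectralData ν B
              (fun i => H.expN (-q.2 + q.1.1) (f i))) y) q.1.2 := by
        refine Measurable.mul (by fun_prop) ?_
        have h2 := h.measurable_psi_zeta (G := fun u B =>
          limitL Pr X γ off H.toSpectralData ν B (fun i => H.expN u (f i))) ih
        exact h2.comp (f := fun q : (ℝ × E) × ℝ => (-q.2 + q.1.1, q.2, q.1.2)) (by fun_prop)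
      exact (StronglyMeasurable.integral_prod_right
        (ν := (volume : Measure ℝ).restrict (Set.Ioi 0)) h1.stronglyMeasurable).measurable

/-- If the nilpotency class is `0` then `𝒩^0 = 0`, so the function space is trivial and the empty
sum defining `expN` is still correct. -/
lemma expN_zero (f : BddFun E) : H.expN 0 f = f := by
  have h0 : ∀ g, H.expN 0 (H.expN 0 g) = H.expN 0 g := fun g => by rw [expN_expN, add_zero]
  rcases Nat.eq_zero_or_pos (nilpotencyClass H.N) with hK | hK
  · have h1 := H.N_pow_eq_zero (n := 0) hK.le
    have h2 : f = (H.N ^ 0) f := by simp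
    rw [h2, h1]
    simp [expN, hK]
  · rw [expN, Finset.sum_eq_single 0]
    · simp
    · intro n _ hn
      simp [hn]
    · intro hn
      exact absurd (Finset.mem_range.2 hK) hn

lemma measurable_limitL (h : MomentBounds γ off Pr X k C M β) (A : Finset (Fin ℓ))
    (f : Fin ℓ → BddFun E) : Measurable (limitL Pr X γ off H.toSpectralData ν A f) := by
  have h1 := (H.measurable_limitL_expN ν h A f).comp (f := fun x => ((0 : ℝ), x)) (by fun_prop)
  simpa [Function.comp_def, expN_zero] using h1

lemma aestronglyMeasurable_limitIntegrand (h : MomentBounds γ off Pr X k C M β)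
    {A : Finset (Fin ℓ)} {G : ℝ → Finset (Fin ℓ) → E → ℂ}
    (hG : ∀ B, B ⊂ A → Measurable fun p : ℝ × E => G p.1 B p.2) (x : E) (μ : Measure ℝ) :
    AEStronglyMeasurable (limitIntegrand Pr X γ off H.toSpectralData ν A G x) μ := by
  have h1 : Measurable fun s : ℝ => Complex.exp (-(∑ i ∈ A, H.lam (ν i)) * s) *
      psi Pr X s.toNNReal (fun y => (γ y : ℂ) * zeta off A (G s) y) x := by
    refine Measurable.mul (by fun_prop) ?_
    exact (h.measurable_psi_zeta hG).comp
      (f := fun s : ℝ => (s, s, x)) (by fun_prop)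
  exact h1.aestronglyMeasurable

variable {ν} {κ : ℝ}

/-- The weights `e^{-λ̃_A s}` beat the growth of the semigroup as soon as `|A| ≥ 2`. -/
lemma norm_exp_weight_le (hκ : 0 < κ) (hν : ∀ i, (H.lam 0).re / 2 + κ ≤ (H.lam (ν i)).re)
    {A : Finset (Fin ℓ)} (hA : 2 ≤ A.card) {s : ℝ} (hs : 0 ≤ s) :
    ‖Complex.exp (-(∑ i ∈ A, H.lam (ν i)) * s)‖ ≤ Real.exp (-((H.lam 0).re + 2 * κ) * s) := by
  rw [norm_exp_lam]
  refine Real.exp_le_exp.2 (mul_le_mul_of_nonneg_right ?_ hs)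
  rw [Complex.neg_re, Complex.re_sum, neg_le_neg_iff]
  have hR := H.lam_zero_pos
  have h1 : A.card • ((H.lam 0).re / 2 + κ) ≤ ∑ i ∈ A, (H.lam (ν i)).re :=
    Finset.card_nsmul_le_sum _ _ _ fun i _ => hν i
  have h2 : (2 : ℝ) ≤ A.card := by exact_mod_cast hA
  rw [nsmul_eq_mul] at h1
  nlinarith

/-- The weight `e^{-(λ_1+2κ)s}` against the growth `e^{(λ_1+κ)s}` leaves `e^{-κs}`. The block bounds
`a B` and their product bound `W` are left free, because the same estimate is applied to the limit
functionals and to the rescaled moments. -/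
lemma exists_limitIntegrand_bound (h : MomentBounds γ off Pr X k C M β) (hκ : 0 < κ)
    (hν : ∀ i, (H.lam 0).re / 2 + κ ≤ (H.lam (ν i)).re) :
    ∃ C' : ℝ, 0 ≤ C' ∧ ∀ (A : Finset (Fin ℓ)) (s : ℝ) (G G' : ℝ → Finset (Fin ℓ) → E → ℂ)
      (a : Finset (Fin ℓ) → ℝ) (ε W : ℝ), 2 ≤ A.card → A.card ≤ k → 0 ≤ s → 0 ≤ ε → 0 ≤ W →
      (∀ B, B ⊂ A → Measurable (G s B)) → (∀ B, B ⊂ A → Measurable (G' s B)) →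
      (∀ B, B ⊂ A → B.Nonempty → ∀ y, ‖G s B y‖ ≤ a B) →
      (∀ B, B ⊂ A → B.Nonempty → ∀ y, ‖G' s B y‖ ≤ a B) →
      (∀ B, B ⊂ A → B.Nonempty → ∀ y, ‖G s B y - G' s B y‖ ≤ ε * a B) →
      (∀ σ : Finpartition A, σ.parts ≠ {A} → ∏ B ∈ σ.parts, a B ≤ W) → ∀ x,
      ‖limitIntegrand Pr X γ off H.toSpectralData ν A G x s‖ ≤ C' * Real.exp (-κ * s) * W ∧
      ‖limitIntegrand Pr X γ off H.toSpectralData ν A G x s -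
        limitIntegrand Pr X γ off H.toSpectralData ν A G' x s‖ ≤
        C' * Real.exp (-κ * s) * (ε * W) := by
  obtain ⟨Cψ, hCψ, hψ⟩ := H.exists_norm_psi_le h hκ
  have hCψ0 : 0 ≤ Cψ := by linarith
  -- Nonnegativity of `M` comes from an offspring law, hence requires a point of `E`.
  rcases isEmpty_or_nonempty E with hE | ⟨⟨x₀⟩⟩
  · exact ⟨0, le_rfl, fun _ _ _ _ _ _ _ _ _ _ _ _ _ _ _ _ _ _ x => (hE.false x).elim⟩
  have hM : 0 ≤ M := h.offspring.nonneg x₀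
  refine ⟨Cψ * (C * (k * M)), by positivity,
    fun A s G G' a ε W hA hAk hs hε hW hGm hGm' hGa hGa' hGG ha x => ?_⟩
  have hAne : A.Nonempty := Finset.card_pos.1 (by omega)
  have hAk' : (A.card : ℝ) ≤ k := by exact_mod_cast hAk
  have hγ : ∀ y, ‖((γ y : ℝ) : ℂ)‖ ≤ C := fun y => by
    rw [Complex.norm_real, Real.norm_of_nonneg (γ y).coe_nonneg]
    exact_mod_cast h.rate_le y
  have hγm : Measurable fun y => ((γ y : ℝ) : ℂ) :=
    Complex.measurable_ofReal.comp (measurable_coe_nnreal_real.comp h.measurable_rate)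
  have hζm : ∀ g : Finset (Fin ℓ) → E → ℂ, (∀ B, B ⊂ A → Measurable (g B)) →
      Measurable fun y => (γ y : ℂ) * zeta off A g y := fun g hg =>
    hγm.mul ((measurable_zeta (α := Unit) off (G := fun _ => g)
      fun B hB => (hg B hB).comp measurable_snd).comp (f := fun y => ((), y)) (by fun_prop))
  have hζ : ∀ g : Finset (Fin ℓ) → E → ℂ, (∀ B, B ⊂ A → B.Nonempty → ∀ y, ‖g B y‖ ≤ a B) → ∀ y,
      ‖(γ y : ℂ) * zeta off A g y‖ ≤ C * (k * M) * W := fun g hg y => by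
    rw [norm_mul]
    refine (mul_le_mul (hγ y) (norm_zeta_le h.offspring hAne hAk hW hg ha y) (norm_nonneg _)
      C.coe_nonneg).trans ?_
    calc (C : ℝ) * (A.card * W * M) ≤ C * (k * W * M) := by gcongr
      _ = _ := by ring
  have hmain : ∀ (F : E → ℂ) (m : ℝ), 0 ≤ m → Measurable F → (∀ y, ‖F y‖ ≤ C * (k * M) * m) →
      ‖Complex.exp (-(∑ i ∈ A, H.lam (ν i)) * s) * psi Pr X s.toNNReal F x‖ ≤
        Cψ * (C * (k * M)) * Real.exp (-κ * s) * m := by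
    intro F m hm hF hFm
    rw [norm_mul]
    have h1 := hψ s.toNNReal F _ hF hFm x
    rw [Real.coe_toNNReal _ hs] at h1
    calc _ ≤ Real.exp (-((H.lam 0).re + 2 * κ) * s) *
          (Cψ * Real.exp (((H.lam 0).re + κ) * s) * (C * (k * M) * m)) :=
          mul_le_mul (H.norm_exp_weight_le hκ hν hA hs) h1 (norm_nonneg _) (Real.exp_pos _).le
      _ = Cψ * (C * (k * M)) * (Real.exp (-((H.lam 0).re + 2 * κ) * s) *
          Real.exp (((H.lam 0).re + κ) * s)) * m := by ring
      _ = _ := by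
          rw [← Real.exp_add]
          ring_nf
  refine ⟨hmain _ W hW (hζm _ hGm) (hζ _ hGa), ?_⟩
  unfold limitIntegrand
  rw [← mul_sub, ← h.psi_sub (hζm _ hGm) (hζ _ hGa) (hζm _ hGm') (hζ _ hGa')]
  refine hmain _ (ε * W) (by positivity) ((hζm _ hGm).sub (hζm _ hGm')) fun y => ?_
  rw [← mul_sub, norm_mul]
  refine (mul_le_mul (hγ y) (norm_zeta_sub_le h.offspring hAne hAk hε hW hGm hGm' hGa hGa' hGG
    ha y) (norm_nonneg _) C.coe_nonneg).trans ?_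
  calc (C : ℝ) * (A.card * ε * W * M) ≤ C * (k * ε * W * M) := by gcongr
    _ = _ := by ring

end AssumptionH1

end Limit


/-! ### Boundedness, Lipschitz continuity and absolute convergence of the limit functionals -/

lemma integrableOn_Ioi_of_norm_le_exp {F : ℝ → ℂ} {b κ : ℝ} (hκ : 0 < κ)
    (hF : AEStronglyMeasurable F (volume.restrict (Set.Ioi 0)))
    (hb : ∀ s, 0 < s → ‖F s‖ ≤ b * Real.exp (-κ * s)) : IntegrableOn F (Set.Ioi 0) :=
  ((exp_neg_integrableOn_Ioi 0 hκ).const_mul b).mono' hF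
    ((ae_restrict_iff' measurableSet_Ioi).2 (ae_of_all _ fun s hs => hb s hs))

lemma norm_integral_Ioi_le_of_norm_le_exp {F : ℝ → ℂ} {b κ : ℝ} (hκ : 0 < κ)
    (hb : ∀ s, 0 < s → ‖F s‖ ≤ b * Real.exp (-κ * s)) :
    ‖∫ s in Set.Ioi (0 : ℝ), F s‖ ≤ b / κ := by
  refine (norm_integral_le_of_norm_le ((exp_neg_integrableOn_Ioi 0 hκ).const_mul b)
    ((ae_restrict_iff' measurableSet_Ioi).2 (ae_of_all _ fun s hs => hb s hs))).trans ?_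
  rw [integral_const_mul, integral_exp_mul_Ioi (by linarith)]
  simp [div_eq_mul_inv]

lemma prod_parts_le {ι : Type*} [DecidableEq ι] {A : Finset ι} (σ : Finpartition A) {k : ℕ}
    (hAk : A.card ≤ k) {c : ℝ} (hc : 1 ≤ c) {w : ι → ℝ} (hw : ∀ i, 0 ≤ w i) :
    ∏ B ∈ σ.parts, (c * ∏ i ∈ B, w i) ≤ c ^ k * ∏ i ∈ A, w i := by
  rw [Finset.prod_mul_distrib, Finset.prod_const, prod_parts σ w]
  exact mul_le_mul_of_nonneg_right (pow_le_pow_right₀ hc (σ.card_parts_le_card.trans hAk))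
    (Finset.prod_nonneg fun i _ => hw i)

section Limit

variable {E Ω : Type*} [MeasurableSpace E] [MeasurableSpace Ω]
  {γ : E → ℝ≥0} {off : Kernel E (Config E)} [IsMarkovKernel off] {Pr : Kernel E Ω}
  [IsMarkovKernel Pr] {X : ℝ≥0 → Ω → Config E} {k : ℕ} {C : ℝ≥0} {M β : ℝ}

variable (Pr X γ off) in
/-- `L_A` is bounded and Lipschitz, with constant `c`, relative to products of sup bounds. -/
def LimitBound (D : SpectralData E) {ℓ : ℕ} (ν : Fin ℓ → Fin (D.r + 1)) (A : Finset (Fin ℓ))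
    (c : ℝ) : Prop :=
  ∀ (f f' : Fin ℓ → BddFun E) (m : Fin ℓ → ℝ) (ε : ℝ), 0 ≤ ε →
    (∀ i x, ‖(f i : E → ℂ) x‖ ≤ m i) → (∀ i x, ‖(f' i : E → ℂ) x‖ ≤ m i) →
    (∀ i x, ‖(f i : E → ℂ) x - (f' i : E → ℂ) x‖ ≤ ε * m i) → ∀ x,
    ‖limitL Pr X γ off D ν A f x‖ ≤ c * ∏ i ∈ A, m i ∧
    ‖limitL Pr X γ off D ν A f x - limitL Pr X γ off D ν A f' x‖ ≤ c * (ε * ∏ i ∈ A, m i)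

namespace AssumptionH1

open SpectralData

variable (H : AssumptionH1 (psi Pr X)) {ℓ : ℕ} {ν : Fin ℓ → Fin (H.r + 1)} {κ : ℝ}

lemma exists_limitIntegrand_limitL_bound (h : MomentBounds γ off Pr X k C M β) (hκ : 0 < κ)
    (hν : ∀ i, (H.lam 0).re / 2 + κ ≤ (H.lam (ν i)).re) {c : ℝ} (hc : 1 ≤ c) :
    ∃ C' : ℝ, 0 ≤ C' ∧ ∀ A : Finset (Fin ℓ), 2 ≤ A.card → A.card ≤ k →
      (∀ B, B ⊂ A → B.Nonempty → LimitBound γ off Pr X H.toSpectralData ν B c) →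
      ∀ (f f' : Fin ℓ → BddFun E) (m : Fin ℓ → ℝ) (ε : ℝ), 0 ≤ ε →
      (∀ i x, ‖(f i : E → ℂ) x‖ ≤ m i) → (∀ i x, ‖(f' i : E → ℂ) x‖ ≤ m i) →
      (∀ i x, ‖(f i : E → ℂ) x - (f' i : E → ℂ) x‖ ≤ ε * m i) → ∀ (s : ℝ), 0 ≤ s → ∀ x,
      ‖limitIntegrand Pr X γ off H.toSpectralData ν A (fun s B =>
        limitL Pr X γ off H.toSpectralData ν B fun i => H.expN (-s) (f i)) x s‖ ≤
        C' * (∏ i ∈ A, m i) * Real.exp (-(κ / 2) * s) ∧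
      ‖limitIntegrand Pr X γ off H.toSpectralData ν A (fun s B =>
          limitL Pr X γ off H.toSpectralData ν B fun i => H.expN (-s) (f i)) x s -
        limitIntegrand Pr X γ off H.toSpectralData ν A (fun s B =>
          limitL Pr X γ off H.toSpectralData ν B fun i => H.expN (-s) (f' i)) x s‖ ≤
        C' * (ε * ∏ i ∈ A, m i) * Real.exp (-(κ / 2) * s) := by
  obtain ⟨C₁, hC₁, h1⟩ := H.exists_limitIntegrand_bound h hκ hν
  obtain ⟨C₂, hC₂, h2⟩ := H.exists_norm_expN_le
  set K := nilpotencyClass H.N with hK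
  -- At most `k` factors `e^{-𝒩s}` occur, each growing like `(1+s)^K`. Half of the decay rate `κ`
  -- absorbs them.
  obtain ⟨C₃, hC₃, h3⟩ := exists_one_add_pow_le_exp (half_pos hκ) (K * k)
  refine ⟨C₁ * (c ^ k * C₂ ^ k * C₃), by positivity,
    fun A hA hAk hB f f' m ε hε hf hf' hff s hs x => ?_⟩
  have hm : ∀ i, 0 ≤ m i := fun i => (norm_nonneg _).trans (hf i x)
  have hs1 : 1 ≤ 1 + s := by linarith
  have hN0 : ∀ g, (H.N ^ (K + 1)) g = 0 := fun g => by
    rw [H.N_pow_eq_zero (Nat.le_succ _), LinearMap.zero_apply]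
  have hexp : ∀ (g : BddFun E) (b : ℝ), (∀ x, ‖(g : E → ℂ) x‖ ≤ b) → ∀ x,
      ‖(H.expN (-s) g : E → ℂ) x‖ ≤ C₂ * (1 + s) ^ K * b := fun g b hg y => by
    have := h2 (-s) K g b (hN0 g) hg y
    rwa [abs_neg, abs_of_nonneg hs] at this
  have hsub : ∀ i x, ‖(H.expN (-s) (f i) : E → ℂ) x - (H.expN (-s) (f' i) : E → ℂ) x‖ ≤
      ε * (C₂ * (1 + s) ^ K * m i) := fun i y => by
    have h4 := hexp (f i - f' i) (ε * m i) (hff i) y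
    rw [expN_sub] at h4
    exact h4.trans (le_of_eq (by ring))
  have hb := fun B (hBA : B ⊂ A) hBn => hB B hBA hBn (fun i => H.expN (-s) (f i))
    (fun i => H.expN (-s) (f' i)) (fun i => C₂ * (1 + s) ^ K * m i) ε hε
    (fun i => hexp _ _ (hf i)) (fun i => hexp _ _ (hf' i)) hsub
  have hb' := fun B (hBA : B ⊂ A) hBn => hB B hBA hBn (fun i => H.expN (-s) (f' i))
    (fun i => H.expN (-s) (f' i)) (fun i => C₂ * (1 + s) ^ K * m i) 0 le_rfl
    (fun i => hexp _ _ (hf' i)) (fun i => hexp _ _ (hf' i)) (by simp)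
  have hP : 0 ≤ ∏ i ∈ A, m i := Finset.prod_nonneg fun i _ => hm i
  have hw : ∀ i, 0 ≤ C₂ * (1 + s) ^ K * m i := fun i => by
    have := hm i
    positivity
  have hmain := h1 A s
    (fun s B => limitL Pr X γ off H.toSpectralData ν B fun i => H.expN (-s) (f i))
    (fun s B => limitL Pr X γ off H.toSpectralData ν B fun i => H.expN (-s) (f' i))
    (fun B => c * ∏ i ∈ B, (C₂ * (1 + s) ^ K * m i)) ε
    (c ^ k * ∏ i ∈ A, (C₂ * (1 + s) ^ K * m i)) hA hAk hs hε
    (mul_nonneg (by positivity) (Finset.prod_nonneg fun i _ => hw i))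
    (fun B _ => H.measurable_limitL ν h B _) (fun B _ => H.measurable_limitL ν h B _)
    (fun B hBA hBn y => (hb B hBA hBn y).1) (fun B hBA hBn y => (hb' B hBA hBn y).1)
    (fun B hBA hBn y => (hb B hBA hBn y).2.trans (le_of_eq (by ring)))
    (fun σ _ => prod_parts_le σ hAk hc hw) x
  have hW : c ^ k * ∏ i ∈ A, (C₂ * (1 + s) ^ K * m i) ≤
      (c ^ k * C₂ ^ k * C₃) * Real.exp (κ / 2 * s) * ∏ i ∈ A, m i := by
    rw [Finset.prod_mul_distrib, Finset.prod_const, mul_pow, ← mul_assoc]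
    refine mul_le_mul_of_nonneg_right ?_ hP
    calc c ^ k * (C₂ ^ A.card * ((1 + s) ^ K) ^ A.card)
        ≤ c ^ k * (C₂ ^ k * ((1 + s) ^ K) ^ k) := by
          have e1 : C₂ ^ A.card ≤ C₂ ^ k := pow_le_pow_right₀ hC₂ hAk
          have e2 : ((1 + s) ^ K) ^ A.card ≤ ((1 + s) ^ K) ^ k :=
            pow_le_pow_right₀ (one_le_pow₀ hs1) hAk
          gcongr
      _ ≤ c ^ k * (C₂ ^ k * (C₃ * Real.exp (κ / 2 * s))) := by
          rw [← pow_mul]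
          have := h3 s hs
          gcongr
      _ = _ := by ring
  have hE : Real.exp (-κ * s) * Real.exp (κ / 2 * s) = Real.exp (-(κ / 2) * s) := by
    rw [← Real.exp_add]
    ring_nf
  constructor
  · calc _ ≤ _ := hmain.1
      _ ≤ C₁ * Real.exp (-κ * s) *
          ((c ^ k * C₂ ^ k * C₃) * Real.exp (κ / 2 * s) * ∏ i ∈ A, m i) := by gcongr
      _ = C₁ * (c ^ k * C₂ ^ k * C₃) * (∏ i ∈ A, m i) *
          (Real.exp (-κ * s) * Real.exp (κ / 2 * s)) := by ring
      _ = _ := by rw [hE]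
  · calc _ ≤ _ := hmain.2
      _ ≤ C₁ * Real.exp (-κ * s) *
          (ε * ((c ^ k * C₂ ^ k * C₃) * Real.exp (κ / 2 * s) * ∏ i ∈ A, m i)) := by gcongr
      _ = C₁ * (c ^ k * C₂ ^ k * C₃) * (ε * ∏ i ∈ A, m i) *
          (Real.exp (-κ * s) * Real.exp (κ / 2 * s)) := by ring
      _ = _ := by rw [hE]

lemma integrableOn_limitIntegrand_of (h : MomentBounds γ off Pr X k C M β) (hκ : 0 < κ)
    (hν : ∀ i, (H.lam 0).re / 2 + κ ≤ (H.lam (ν i)).re) {c : ℝ} (hc : 1 ≤ c)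
    {A : Finset (Fin ℓ)} (hA : 2 ≤ A.card) (hAk : A.card ≤ k)
    (hB : ∀ B, B ⊂ A → B.Nonempty → LimitBound γ off Pr X H.toSpectralData ν B c)
    (f : Fin ℓ → BddFun E) (x : E) :
    IntegrableOn (limitIntegrand Pr X γ off H.toSpectralData ν A (fun s B =>
      limitL Pr X γ off H.toSpectralData ν B fun i => H.expN (-s) (f i)) x) (Set.Ioi 0) := by
  obtain ⟨C₁, -, h1⟩ := H.exists_limitIntegrand_limitL_bound h hκ hν hc
  choose m hm hfm using fun i => BddFun.exists_bound (f i)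
  refine integrableOn_Ioi_of_norm_le_exp (half_pos hκ) ?_ fun s hs =>
    (h1 A hA hAk hB f f m 0 le_rfl hfm hfm (by simp) s hs.le x).1
  refine H.aestronglyMeasurable_limitIntegrand ν h (fun B _ => ?_) x _
  exact (H.measurable_limitL_expN ν h B f).comp (f := fun p : ℝ × E => (-p.1, p.2)) (by fun_prop)

/-- Induction on cardinality. Singletons inherit the bound of the projections `Φ`; larger sets
integrate the decay `e^{-(κ/2)s}` established from the bounds on proper subsets. -/
lemma exists_limitBound (h : MomentBounds γ off Pr X k C M β) (hκ : 0 < κ)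
    (hν : ∀ i, (H.lam 0).re / 2 + κ ≤ (H.lam (ν i)).re) :
    ∃ c : ℝ, 1 ≤ c ∧ ∀ A : Finset (Fin ℓ), A.Nonempty → A.card ≤ k →
      LimitBound γ off Pr X H.toSpectralData ν A c := by
  suffices hn : ∀ n ≤ k, ∃ c : ℝ, 1 ≤ c ∧ ∀ A : Finset (Fin ℓ), A.Nonempty → A.card ≤ n →
      LimitBound γ off Pr X H.toSpectralData ν A c from hn k le_rfl
  obtain ⟨C₀, hC₀, h0⟩ := H.exists_opBound_Phi
  intro n
  induction n with
  | zero =>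
    exact fun _ => ⟨1, le_rfl, fun A hA hA0 => absurd hA.card_pos (by omega)⟩
  | succ n ih =>
    intro hn
    obtain ⟨c, hc, hb⟩ := ih (by omega)
    obtain ⟨C₁, hC₁, h1⟩ := H.exists_limitIntegrand_limitL_bound h hκ hν hc
    -- A common constant: `C₀` serves the singletons and `C₁ / (κ / 2)` the larger sets, while the
    -- old `c` keeps it at least `1`.
    refine ⟨c + C₀ + C₁ / (κ / 2), ?_, fun A hA hAn f f' m ε hε hf hf' hff x => ?_⟩
    · have : 0 ≤ C₁ / (κ / 2) := by positivity
      linarith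
    have hm : ∀ i, 0 ≤ m i := fun i => (norm_nonneg _).trans (hf i x)
    have hP : 0 ≤ ∏ i ∈ A, m i := Finset.prod_nonneg fun i _ => hm i
    have hq : 0 ≤ C₁ / (κ / 2) := by positivity
    have hmono : ∀ b c' : ℝ, 0 ≤ b → c' ≤ c + C₀ + C₁ / (κ / 2) →
        c' * b ≤ (c + C₀ + C₁ / (κ / 2)) * b := fun b c' hb' hc' =>
      mul_le_mul_of_nonneg_right hc' hb'
    rcases le_or_gt A.card 1 with hA1 | hA1
    · obtain ⟨i, rfl⟩ := Finset.card_eq_one.1 (le_antisymm hA1 hA.card_pos)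
      rw [limitL_of_card_le_one ν hA1, limitL_of_card_le_one ν hA1]
      simp only [Finset.prod_singleton] at hP ⊢
      refine ⟨(h0 (ν i) (f i) _ (hf i) x).trans (hmono _ _ hP (by linarith)), ?_⟩
      have h2 := h0 (ν i) (f i - f' i) (ε * m i) (hff i) x
      rw [Phi_sub] at h2
      exact h2.trans (hmono _ _ (by positivity) (by linarith))
    · have hB : ∀ B, B ⊂ A → B.Nonempty → LimitBound γ off Pr X H.toSpectralData ν B c :=
        fun B hBA hBn => hb B hBn (by have := Finset.card_lt_card hBA; omega)
      have h2 := h1 A hA1 (hAn.trans hn) hB f f' m ε hε hf hf' hff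
      have hi := H.integrableOn_limitIntegrand_of h hκ hν hc hA1 (hAn.trans hn) hB f x
      have hi' := H.integrableOn_limitIntegrand_of h hκ hν hc hA1 (hAn.trans hn) hB f' x
      rw [limitL_of_two_le_card ν hA1, limitL_of_two_le_card ν hA1]
      refine ⟨(norm_integral_Ioi_le_of_norm_le_exp (half_pos hκ) fun s hs =>
        (h2 s hs.le x).1).trans ?_, ?_⟩
      · rw [mul_div_right_comm]
        exact hmono _ _ hP (by linarith)
      · rw [← integral_sub hi hi']
        refine (norm_integral_Ioi_le_of_norm_le_exp (half_pos hκ) fun s hs =>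
          (h2 s hs.le x).2).trans ?_
        rw [mul_div_right_comm]
        exact hmono _ _ (by positivity) (by linarith)

lemma limitL_mem_bddFun (h : MomentBounds γ off Pr X k C M β) (hκ : 0 < κ)
    (hν : ∀ i, (H.lam 0).re / 2 + κ ≤ (H.lam (ν i)).re) {A : Finset (Fin ℓ)} (hA : A.Nonempty)
    (hAk : A.card ≤ k) (f : Fin ℓ → BddFun E) :
    limitL Pr X γ off H.toSpectralData ν A f ∈ BddFun E := by
  obtain ⟨c, hc, hb⟩ := H.exists_limitBound h hκ hν
  choose m hm hfm using fun i => BddFun.exists_bound (f i)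
  exact ⟨H.measurable_limitL ν h A f, c * ∏ i ∈ A, m i, fun x =>
    (hb A hA hAk f f m 0 le_rfl hfm hfm (by simp) x).1⟩

lemma integrableOn_limitIntegrand (h : MomentBounds γ off Pr X k C M β) (hκ : 0 < κ)
    (hν : ∀ i, (H.lam 0).re / 2 + κ ≤ (H.lam (ν i)).re) {A : Finset (Fin ℓ)} (hA : 2 ≤ A.card)
    (hAk : A.card ≤ k) (f : Fin ℓ → BddFun E) (x : E) :
    IntegrableOn (limitIntegrand Pr X γ off H.toSpectralData ν A (fun s B =>
      limitL Pr X γ off H.toSpectralData ν B fun i => H.expN (-s) (f i)) x) (Set.Ioi 0) := by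
  obtain ⟨c, hc, hb⟩ := H.exists_limitBound h hκ hν
  exact H.integrableOn_limitIntegrand_of h hκ hν hc hA hAk
    (fun B hBA hBn => hb B hBn ((Finset.card_le_card hBA.subset).trans hAk)) f x

end AssumptionH1

end Limit


/-! ### First moments -/

/-- A decreasing rate function for a uniformly bounded and uniformly vanishing family. -/
lemma exists_antitone_rate {J : Type*} (v : J → ℝ≥0 → ℝ) {b : ℝ} (hb : ∀ j t, v j t ≤ b)
    (hlim : ∀ ε > 0, ∃ T : ℝ≥0, ∀ t, T ≤ t → ∀ j, v j t ≤ ε) :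
    ∃ η : ℝ → ℝ, (∀ t, 0 ≤ η t) ∧ Antitone η ∧ Tendsto η atTop (𝓝 0) ∧
      ∀ j (t : ℝ≥0), v j t ≤ η t := by
  -- The rate is the supremum over all later times. Inserting `0` makes it nonnegative and covers an
  -- empty index type.
  set S : ℝ → Set ℝ := fun t => insert 0 {y | ∃ j, ∃ s : ℝ≥0, t ≤ s ∧ y = v j s} with hS
  have hbdd : ∀ t, BddAbove (S t) := fun t => ⟨max 0 b, by
    rintro y (rfl | ⟨j, s, -, rfl⟩)
    · exact le_max_left _ _
    · exact (hb j s).trans (le_max_right _ _)⟩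
  have hnonneg : ∀ t, 0 ≤ sSup (S t) := fun t => le_csSup (hbdd t) (Set.mem_insert _ _)
  refine ⟨fun t => sSup (S t), hnonneg, fun t t' htt => ?_, ?_, fun j t => ?_⟩
  · refine csSup_le_csSup (hbdd t) ⟨0, Set.mem_insert _ _⟩ (Set.insert_subset_insert ?_)
    rintro y ⟨j, s, hs, rfl⟩
    exact ⟨j, s, htt.trans hs, rfl⟩
  · rw [Metric.tendsto_atTop]
    intro ε hε
    obtain ⟨T, hT⟩ := hlim (ε / 2) (half_pos hε)
    refine ⟨T, fun t ht => ?_⟩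
    rw [Real.dist_eq, sub_zero, abs_of_nonneg (hnonneg t)]
    refine lt_of_le_of_lt (csSup_le ⟨0, Set.mem_insert _ _⟩ ?_) (half_lt_self hε)
    rintro y (rfl | ⟨j, s, hs, rfl⟩)
    · exact (half_pos hε).le
    · exact hT s (NNReal.coe_le_coe.1 (le_trans ht hs)) j
  · exact le_csSup (hbdd _) (Set.mem_insert_of_mem _ ⟨j, t, le_rfl, rfl⟩)

section FirstMoment

variable {E Ω : Type*} [MeasurableSpace E] [MeasurableSpace Ω]
  {γ : E → ℝ≥0} {off : Kernel E (Config E)} {Pr : Kernel E Ω} [IsMarkovKernel Pr]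
  {X : ℝ≥0 → Ω → Config E} {k : ℕ} {C : ℝ≥0} {M β : ℝ}

namespace AssumptionH1

open SpectralData

/-- `f` is bounded by one, `𝒩^{d+1} f = 0`, and `f` has no component along eigenvalues other than
`λ_i` whose real part is at least `Re λ_i`. -/
structure IsDominatedBy {ψ : ℝ≥0 → (E → ℂ) → E → ℂ} (H : AssumptionH1 ψ) (i : Fin (H.r + 1))
    (d : ℕ) (f : BddFun E) : Prop where
  norm_le : ∀ x, ‖(f : E → ℂ) x‖ ≤ 1
  lt : d < nilpotencyClass H.N
  N_pow : (H.N ^ (d + 1)) f = 0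
  Phi_eq_zero : ∀ i', i' ≠ i → (H.lam i).re ≤ (H.lam i').re → H.Phi i' f = 0

variable (H : AssumptionH1 (psi Pr X))

lemma exists_eigenvalue_gap (i : Fin (H.r + 1)) : ∃ δ : ℝ, 0 < δ ∧ ∀ i',
    (H.lam i').re < (H.lam i).re → (H.lam i').re - (H.lam i).re ≤ -δ := by
  have : ∀ i', ∃ δ : ℝ, 0 < δ ∧ ((H.lam i').re < (H.lam i).re →
      (H.lam i').re - (H.lam i).re ≤ -δ) := by
    intro i'
    by_cases hi : (H.lam i').re < (H.lam i).re
    · exact ⟨(H.lam i).re - (H.lam i').re, by linarith, fun _ => by linarith⟩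
    · exact ⟨1, one_pos, fun h => absurd h hi⟩
  choose δ hδ hδ' using this
  refine ⟨Finset.univ.inf' Finset.univ_nonempty δ, ?_, fun i' hi => ?_⟩
  · exact (Finset.lt_inf'_iff _).2 fun i _ => hδ i
  · have := Finset.inf'_le δ (Finset.mem_univ i')
    linarith [hδ' i' hi]

/-- The block of `λ_i` gives `Φ_i[e^{𝒩t} f]` exactly, and the other blocks with real part at least
`Re λ_i` vanish on `f`. The remaining ones decay at the rate of the eigenvalue gap, half of which
absorbs the polynomial factor. -/
lemma exists_norm_leading_sub_le (i : Fin (H.r + 1)) : ∃ C' δ : ℝ, 0 ≤ C' ∧ 0 < δ ∧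
    ∀ (d : ℕ) (f : BddFun E), H.IsDominatedBy i d f → ∀ (t : ℝ≥0) (x : E),
    ‖Complex.exp (-H.lam i * (t : ℝ)) * H.leading t f x - (H.Phi i (H.expN t f) : E → ℂ) x‖ ≤
      C' * Real.exp (-δ * t) := by
  obtain ⟨δ, hδ, hgap⟩ := H.exists_eigenvalue_gap i
  obtain ⟨C₁, hC₁, h1⟩ := H.exists_norm_expN_Phi_le
  obtain ⟨C₂, hC₂, h2⟩ := exists_one_add_pow_le_exp (half_pos hδ) (nilpotencyClass H.N)
  refine ⟨(H.r + 1 : ℕ) * (C₁ * C₂), δ / 2, by positivity, half_pos hδ, fun d f hf t x => ?_⟩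
  have ht := t.coe_nonneg
  have hsplit : Complex.exp (-H.lam i * (t : ℝ)) * H.leading t f x -
      (H.Phi i (H.expN t f) : E → ℂ) x =
      ∑ i', (Complex.exp ((H.lam i' - H.lam i) * (t : ℝ)) * (H.expN t (H.Phi i' f) : E → ℂ) x -
        if i' = i then (H.expN t (H.Phi i f) : E → ℂ) x else 0) := by
    rw [Finset.sum_sub_distrib, Finset.sum_ite_eq' _ i, if_pos (Finset.mem_univ _), Phi_expN,
      leading, Finset.mul_sum]
    congr 1
    refine Finset.sum_congr rfl fun i' _ => ?_
    rw [← mul_assoc, ← Complex.exp_add]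
    congr 2
    ring
  have hterm : ∀ i', ‖Complex.exp ((H.lam i' - H.lam i) * (t : ℝ)) *
      (H.expN t (H.Phi i' f) : E → ℂ) x -
        (if i' = i then (H.expN t (H.Phi i f) : E → ℂ) x else 0)‖ ≤
      C₁ * C₂ * Real.exp (-(δ / 2) * t) := by
    intro i'
    rcases eq_or_ne i' i with rfl | hi
    · simp only [sub_self, zero_mul, Complex.exp_zero, one_mul, if_true, norm_zero]
      positivity
    rw [if_neg hi, sub_zero]
    rcases le_or_gt (H.lam i).re (H.lam i').re with hre | hre
    · rw [hf.Phi_eq_zero i' hi hre, show H.expN (t : ℝ) 0 = 0 by simp [expN]]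
      simp only [ZeroMemClass.coe_zero, Pi.zero_apply, mul_zero, norm_zero]
      positivity
    · rw [norm_mul, norm_exp_lam, Complex.sub_re]
      have h3 := h1 t i' f 1 hf.norm_le x
      rw [abs_of_nonneg ht, mul_one] at h3
      calc _ ≤ Real.exp (-δ * t) * (C₁ * (C₂ * Real.exp (δ / 2 * t))) := by
            refine mul_le_mul (Real.exp_le_exp.2 (mul_le_mul_of_nonneg_right (hgap i' hre) ht))
              (h3.trans ?_) (norm_nonneg _) (Real.exp_pos _).le
            have := h2 t ht
            gcongr
        _ = C₁ * C₂ * (Real.exp (-δ * t) * Real.exp (δ / 2 * t)) := by ring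
        _ = _ := by
            rw [← Real.exp_add]
            ring_nf
  rw [hsplit]
  refine (norm_sum_le_of_le _ fun i' _ => hterm i').trans (le_of_eq ?_)
  rw [Finset.sum_const, Finset.card_univ, Fintype.card_fin, nsmul_eq_mul]
  ring

/-- First moments: uniform convergence for the functions dominated by `λ_i`. -/
lemma exists_rate_psi (h : MomentBounds γ off Pr X k C M β) {i : Fin (H.r + 1)}
    (hi : 0 ≤ (H.lam i).re) :
    ∃ η : ℝ → ℝ, (∀ t, 0 ≤ η t) ∧ Antitone η ∧ Tendsto η atTop (𝓝 0) ∧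
      ∀ (d : ℕ) (f : BddFun E), H.IsDominatedBy i d f → ∀ (t : ℝ≥0) (x : E),
      ‖Complex.exp (-H.lam i * (t : ℝ)) * psi Pr X t f x - (H.Phi i (H.expN t f) : E → ℂ) x‖ ≤
        η t := by
  obtain ⟨C₁, δ, hC₁, hδ, h1⟩ := H.exists_norm_leading_sub_le i
  obtain ⟨C₂, hC₂, h2⟩ := H.exists_norm_psi_le h one_pos
  obtain ⟨C₃, hC₃, h3⟩ := H.exists_norm_expN_Phi_le
  have hR := H.lam_zero_pos
  -- Degree, function and starting point are bundled into one index, so that a single rate serves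
  -- all of them.
  have hlim : ∀ ε > 0, ∃ T : ℝ≥0, ∀ t, T ≤ t → ∀ j : {q : (ℕ × BddFun E) × E //
      H.IsDominatedBy i q.1.1 q.1.2}, ‖Complex.exp (-H.lam i * (t : ℝ)) *
        psi Pr X t j.1.1.2 j.1.2 - (H.Phi i (H.expN t j.1.1.2) : E → ℂ) j.1.2‖ ≤ ε := by
    intro ε hε
    obtain ⟨T₁, hT₁⟩ := H.exists_norm_psi_sub_leading_le (half_pos hε)
    have hexp : Tendsto (fun t : ℝ≥0 => C₁ * Real.exp (-δ * t)) atTop (𝓝 0) := by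
      have h4 : Tendsto (fun t : ℝ≥0 => δ * (t : ℝ)) atTop atTop :=
        (NNReal.tendsto_coe_atTop.2 tendsto_id).const_mul_atTop hδ
      simpa using (Real.tendsto_exp_neg_atTop_nhds_zero.comp h4).const_mul C₁
    obtain ⟨T₂, hT₂⟩ := eventually_atTop.1 (hexp.eventually_le_const (half_pos hε))
    refine ⟨max T₁ T₂, fun t ht ⟨⟨⟨d, f⟩, x⟩, hf⟩ => ?_⟩
    simp only at hf ⊢
    have h5 := hT₁ t ((le_max_left _ _).trans ht) f 1 hf.norm_le x
    have h6 := (h1 d f hf t x).trans (hT₂ t ((le_max_right _ _).trans ht))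
    have h7 : ‖Complex.exp (-H.lam i * (t : ℝ)) * (psi Pr X t f x - H.leading t f x)‖ ≤ ε / 2 := by
      rw [norm_mul, norm_exp_lam]
      have hle : (H.lam (Fin.last H.r)).re ≤ (H.lam i).re := H.lam_antitone (Fin.le_last i)
      calc _ ≤ Real.exp ((-H.lam i).re * t) *
            (ε / 2 * Real.exp ((H.lam (Fin.last H.r)).re * t) * 1) := by gcongr
        _ = ε / 2 * (Real.exp ((-H.lam i).re * t) *
            Real.exp ((H.lam (Fin.last H.r)).re * t)) := by ring
        _ ≤ ε / 2 * 1 := by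
            refine mul_le_mul_of_nonneg_left ?_ (half_pos hε).le
            rw [← Real.exp_add, Real.exp_le_one_iff, Complex.neg_re, ← add_mul]
            exact mul_nonpos_of_nonpos_of_nonneg (by linarith) t.coe_nonneg
        _ = _ := mul_one _
    calc _ = ‖Complex.exp (-H.lam i * (t : ℝ)) * (psi Pr X t f x - H.leading t f x) +
          (Complex.exp (-H.lam i * (t : ℝ)) * H.leading t f x -
            (H.Phi i (H.expN t f) : E → ℂ) x)‖ := by
          congr 1
          ring
      _ ≤ ε / 2 + ε / 2 := (norm_add_le _ _).trans (add_le_add h7 h6)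
      _ = ε := add_halves ε
  -- Past `T` the error is at most `1`. Before `T` the two terms are bounded separately, and `0 ≤ Re
  -- λ_i` makes the exponential weight at most `1`.
  obtain ⟨T, hT⟩ := hlim 1 one_pos
  obtain ⟨η, hη0, hη, hηlim, hle⟩ := exists_antitone_rate
    (J := {q : (ℕ × BddFun E) × E // H.IsDominatedBy i q.1.1 q.1.2})
    (fun j t => ‖Complex.exp (-H.lam i * (t : ℝ)) *
        psi Pr X t j.1.1.2 j.1.2 - (H.Phi i (H.expN t j.1.1.2) : E → ℂ) j.1.2‖)
    (b := 1 + (C₂ * Real.exp (((H.lam 0).re + 1) * T) + C₃ * (1 + T) ^ nilpotencyClass H.N))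
    (fun ⟨⟨⟨d, f⟩, x⟩, hf⟩ t => by
      rcases le_total T t with ht | ht
      · refine (hT t ht ⟨⟨⟨d, f⟩, x⟩, hf⟩).trans (le_add_of_nonneg_right ?_)
        positivity
      · simp only at hf ⊢
        have ht' : (t : ℝ) ≤ T := ht
        refine le_trans ?_ (le_add_of_nonneg_left zero_le_one)
        refine (norm_sub_le _ _).trans (add_le_add ?_ ?_)
        · rw [norm_mul, norm_exp_lam]
          have h4 := h2 t f 1 f.2.1 hf.norm_le x
          have h5 : Real.exp ((-H.lam i).re * t) ≤ 1 := by
            rw [Real.exp_le_one_iff, Complex.neg_re]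
            exact mul_nonpos_of_nonpos_of_nonneg (by linarith) t.coe_nonneg
          calc _ ≤ 1 * (C₂ * Real.exp (((H.lam 0).re + 1) * t) * 1) :=
                mul_le_mul h5 h4 (norm_nonneg _) zero_le_one
            _ = C₂ * Real.exp (((H.lam 0).re + 1) * t) := by ring
            _ ≤ _ := by gcongr
        · rw [Phi_expN]
          have h4 := h3 t i f 1 hf.norm_le x
          rw [abs_of_nonneg t.coe_nonneg, mul_one] at h4
          exact h4.trans (by gcongr))
    hlim
  exact ⟨η, hη0, hη, hηlim, fun d f hf t x => hle ⟨⟨⟨d, f⟩, x⟩, hf⟩ t⟩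

end AssumptionH1

end FirstMoment


/-! ### Convergence of the product moments -/

lemma exp_neg_sum_mul {ι : Type*} (A : Finset ι) (a : ι → ℂ) (t : ℂ) :
    Complex.exp (-(∑ i ∈ A, a i) * t) = ∏ i ∈ A, Complex.exp (-a i * t) := by
  rw [← Complex.exp_sum, ← Finset.sum_neg_distrib, Finset.sum_mul]

section Moments

variable {E Ω₀ Ω : Type*} [MeasurableSpace E] [MeasurableSpace Ω₀] [MeasurableSpace Ω]
  {P : Kernel E Ω₀} [IsMarkovKernel P] {ξ : ℝ≥0 → Ω₀ → E ⊕ Unit} {γ : E → ℝ≥0}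
  {off : Kernel E (Config E)} [IsMarkovKernel off] {Pr : Kernel E Ω}
  [IsMarkovKernel Pr] {X : ℝ≥0 → Ω → Config E} {k : ℕ} {C : ℝ≥0} {M β : ℝ}
  [IsFiniteKernel (killedKernel P ξ γ)]

variable (Pr X) in
/-- The rescaled product moments `e^{-λ̃_B (t-s)} ψ^{(B)}_{t-s}`, as a function of `s`. -/
noncomputable def scaledMoment (D : SpectralData E) {ℓ : ℕ} (ν : Fin ℓ → Fin (D.r + 1))
    (f : Fin ℓ → BddFun E) (t : ℝ≥0) (s : ℝ) (B : Finset (Fin ℓ)) (y : E) : ℂ :=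
  (∏ i ∈ B, Complex.exp (-D.lam (ν i) * ((t : ℝ) - s : ℝ))) *
    prodMoment Pr X (fun i => (f i : E → ℂ)) B (t - s.toNNReal) y

/-- Split `e^{-λ̃_A t}` into its parts for the times `s` and `t - s` and distribute the second over
the blocks of each partition. The evolution equation then has the same integrand as `L_A`, with
rescaled moments in place of limit functionals. -/
lemma limitIntegrand_scaledMoment {D : SpectralData E} {ℓ : ℕ} (ν : Fin ℓ → Fin (D.r + 1))
    (f : Fin ℓ → BddFun E) (t : ℝ≥0) (s : ℝ) (A : Finset (Fin ℓ)) (x : E) :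
    limitIntegrand Pr X γ off D ν A (scaledMoment Pr X D ν f t) x s =
      (∏ i ∈ A, Complex.exp (-D.lam (ν i) * (t : ℝ))) *
        psi Pr X s.toNNReal (fun y => (γ y : ℂ) *
          zeta off A (fun B => prodMoment Pr X (fun i => (f i : E → ℂ)) B (t - s.toNNReal)) y) x := by
  have h1 : ∀ y, (γ y : ℂ) * zeta off A (scaledMoment Pr X D ν f t s) y =
      (∏ i ∈ A, Complex.exp (-D.lam (ν i) * ((t : ℝ) - s : ℝ))) * ((γ y : ℂ) *
        zeta off A (fun B => prodMoment Pr X (fun i => (f i : E → ℂ)) B (t - s.toNNReal)) y) := by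
    intro y
    rw [mul_left_comm, ← zeta_mul]
    rfl
  unfold limitIntegrand
  simp_rw [h1]
  rw [psi_mul, ← mul_assoc, exp_neg_sum_mul, ← Finset.prod_mul_distrib]
  congr 1
  refine Finset.prod_congr rfl fun i _ => ?_
  rw [← Complex.exp_add]
  congr 1
  push_cast
  ring

lemma MomentBounds.measurable_scaledMoment (h : MomentBounds γ off Pr X k C M β)
    {D : SpectralData E} {ℓ : ℕ} (ν : Fin ℓ → Fin (D.r + 1)) (f : Fin ℓ → BddFun E) (t : ℝ≥0)
    (B : Finset (Fin ℓ)) :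
    Measurable fun p : ℝ × E => scaledMoment Pr X D ν f t p.1 B p.2 := by
  refine Measurable.mul ?_ ?_
  · exact Finset.measurable_fun_prod _ fun i _ => by fun_prop
  · exact (h.measurable_prodMoment (f := fun i => (f i : E → ℂ))
      (fun i => BddFun.measurable (f i)) B).comp
      (f := fun p : ℝ × E => (t - p.1.toNNReal, p.2)) (by fun_prop)

namespace AssumptionH1

open SpectralData

variable (H : AssumptionH1 (psi Pr X)) {ℓ : ℕ} {ν : Fin ℓ → Fin (H.r + 1)} {κ : ℝ}

/-- The rescaled product moments over `A` converge at rate `η`, uniformly over dominated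
functions. -/
def MomentRate (γ : E → ℝ≥0) (off : Kernel E (Config E)) (ν : Fin ℓ → Fin (H.r + 1))
    (A : Finset (Fin ℓ)) (η : ℝ → ℝ) : Prop :=
  ∀ (d : Fin ℓ → ℕ) (f : Fin ℓ → BddFun E), (∀ i, H.IsDominatedBy (ν i) (d i) (f i)) →
    ∀ (t : ℝ≥0) (x : E),
    ‖(∏ i ∈ A, Complex.exp (-H.lam (ν i) * (t : ℝ))) *
        prodMoment Pr X (fun i => (f i : E → ℂ)) A t x -
      limitL Pr X γ off H.toSpectralData ν A (fun i => H.expN t (f i)) x‖ ≤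
      η t * ∏ i ∈ A, (1 + (t : ℝ)) ^ d i

/-- Before time `t`, the integrands in the evolution equation and in `L_A` are close. -/
lemma exists_norm_integrand_sub_le (h : MomentBounds γ off Pr X k C M β) (hκ : 0 < κ)
    (hν : ∀ i, (H.lam 0).re / 2 + κ ≤ (H.lam (ν i)).re) {η : ℝ → ℝ} (hη0 : ∀ t, 0 ≤ η t)
    (hη : Antitone η) :
    ∃ C' : ℝ, 0 ≤ C' ∧ ∀ A : Finset (Fin ℓ), 2 ≤ A.card → A.card ≤ k →
      (∀ B, B ⊂ A → B.Nonempty → H.MomentRate γ off ν B η) →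
      ∀ (d : Fin ℓ → ℕ) (f : Fin ℓ → BddFun E), (∀ i, H.IsDominatedBy (ν i) (d i) (f i)) →
      ∀ (t : ℝ≥0) (s : ℝ), 0 < s → s < t → ∀ x,
      ‖limitIntegrand Pr X γ off H.toSpectralData ν A
          (scaledMoment Pr X H.toSpectralData ν f t) x s -
        limitIntegrand Pr X γ off H.toSpectralData ν A (fun s B =>
          limitL Pr X γ off H.toSpectralData ν B fun i => H.expN (-s) (H.expN t (f i))) x s‖ ≤
        C' * (∏ i ∈ A, (1 + (t : ℝ)) ^ d i) * (Real.exp (-κ * s) * η (t - s)) := by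
  obtain ⟨C₁, hC₁, h1⟩ := H.exists_limitIntegrand_bound h hκ hν
  obtain ⟨C₂, hC₂, h2⟩ := H.exists_norm_expN_le
  obtain ⟨c, hc, hL⟩ := H.exists_limitBound h hκ hν
  have hC₂0 : 0 ≤ C₂ := by linarith
  have h00 := hη0 0
  refine ⟨C₁ * ((c + η 0) ^ k * C₂ ^ k), by positivity,
    fun A hA hAk hB d f hf t s hs hst x => ?_⟩
  have ht1 : 1 ≤ 1 + (t : ℝ) := by linarith [t.coe_nonneg]
  set u : ℝ≥0 := t - s.toNNReal with hu
  have huc : (u : ℝ) = t - s := coe_sub_toNNReal ⟨hs, hst⟩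
  have hut : 1 + (u : ℝ) ≤ 1 + t := by rw [huc]; linarith
  -- Since `u ≤ t`, these weights dominate every `e^{𝒩u} f_i` as well as the normalisation in the
  -- inductive error at time `u`.
  set w : Fin ℓ → ℝ := fun i => C₂ * (1 + (t : ℝ)) ^ d i with hw
  have hw0 : ∀ i, 0 ≤ w i := fun i => by positivity
  have hwu : ∀ B : Finset (Fin ℓ), ∏ i ∈ B, (1 + (u : ℝ)) ^ d i ≤ ∏ i ∈ B, w i := fun B =>
    Finset.prod_le_prod (fun i _ => by positivity) fun i _ =>
      calc (1 + (u : ℝ)) ^ d i ≤ (1 + (t : ℝ)) ^ d i := by gcongr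
        _ ≤ C₂ * (1 + (t : ℝ)) ^ d i := le_mul_of_one_le_left (by positivity) hC₂
  have hexp : ∀ i, H.expN (-s) (H.expN t (f i)) = H.expN u (f i) := fun i => by
    rw [expN_expN, huc]
    ring_nf
  have hcongr : limitIntegrand Pr X γ off H.toSpectralData ν A (fun s B =>
      limitL Pr X γ off H.toSpectralData ν B fun i => H.expN (-s) (H.expN t (f i))) x s =
      limitIntegrand Pr X γ off H.toSpectralData ν A (fun _ B =>
        limitL Pr X γ off H.toSpectralData ν B fun i => H.expN u (f i)) x s :=
    limitIntegrand_congr ν (fun B _ => by simp_rw [hexp]) x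
  rw [hcongr]
  have hG' : ∀ B, B ⊂ A → B.Nonempty → ∀ y,
      ‖limitL Pr X γ off H.toSpectralData ν B (fun i => H.expN u (f i)) y‖ ≤
        c * ∏ i ∈ B, w i := by
    intro B hBA hBn y
    have hbd : ∀ i z, ‖(H.expN u (f i) : E → ℂ) z‖ ≤ w i := fun i z => by
      have h3 := h2 u (d i) (f i) 1 (hf i).N_pow (hf i).norm_le z
      rw [abs_of_nonneg u.coe_nonneg, mul_one] at h3
      refine h3.trans ?_
      change _ ≤ C₂ * (1 + (t : ℝ)) ^ d i
      gcongr
    exact (hL B hBn ((Finset.card_le_card hBA.subset).trans hAk) _ _ w 0 le_rfl hbd hbd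
      (by simp) y).1
  have hdiff : ∀ B, B ⊂ A → B.Nonempty → ∀ y, ‖scaledMoment Pr X H.toSpectralData ν f t s B y -
      limitL Pr X γ off H.toSpectralData ν B (fun i => H.expN u (f i)) y‖ ≤
        η u * ∏ i ∈ B, w i := by
    intro B hBA hBn y
    have h3 := hB B hBA hBn d f hf u y
    rw [scaledMoment, ← huc]
    exact h3.trans (mul_le_mul_of_nonneg_left (hwu B) (hη0 _))
  have hηu : η u ≤ η 0 := hη u.coe_nonneg
  have hprod0 : ∀ B : Finset (Fin ℓ), 0 ≤ ∏ i ∈ B, w i := fun B =>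
    Finset.prod_nonneg fun i _ => hw0 i
  -- The rescaled moments are bounded as limit functional plus error, hence the block constant `c +
  -- η 0`; the relative error is `η u`.
  have hmain := (h1 A s (scaledMoment Pr X H.toSpectralData ν f t)
    (fun _ B => limitL Pr X γ off H.toSpectralData ν B fun i => H.expN u (f i))
    (fun B => (c + η 0) * ∏ i ∈ B, w i) (η u) ((c + η 0) ^ k * ∏ i ∈ A, w i) hA hAk hs.le
    (hη0 _) (mul_nonneg (by positivity) (hprod0 A))
    (fun B _ => (h.measurable_scaledMoment ν f t B).comp (f := fun y => (s, y)) (by fun_prop))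
    (fun B _ => H.measurable_limitL ν h B _)
    (fun B hBA hBn y => by
      have e1 := hdiff B hBA hBn y
      have e2 := hG' B hBA hBn y
      have e3 := norm_add_le (scaledMoment Pr X H.toSpectralData ν f t s B y -
        limitL Pr X γ off H.toSpectralData ν B (fun i => H.expN u (f i)) y)
        (limitL Pr X γ off H.toSpectralData ν B (fun i => H.expN u (f i)) y)
      rw [sub_add_cancel] at e3
      have e4 := mul_le_mul_of_nonneg_right hηu (hprod0 B)
      rw [add_mul]
      linarith)
    (fun B hBA hBn y => (hG' B hBA hBn y).trans
      (mul_le_mul_of_nonneg_right (by linarith) (hprod0 B)))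
    (fun B hBA hBn y => (hdiff B hBA hBn y).trans
      (mul_le_mul_of_nonneg_left (le_mul_of_one_le_left (hprod0 B) (by linarith)) (hη0 _)))
    (fun σ _ => prod_parts_le σ hAk (by linarith) hw0) x).2
  refine hmain.trans ?_
  rw [← huc]
  have hwA : ∏ i ∈ A, w i ≤ C₂ ^ k * ∏ i ∈ A, (1 + (t : ℝ)) ^ d i := by
    rw [hw, Finset.prod_mul_distrib, Finset.prod_const]
    exact mul_le_mul_of_nonneg_right (pow_le_pow_right₀ hC₂ hAk) (by positivity)
  have hηu0 := hη0 u
  calc C₁ * Real.exp (-κ * s) * (η u * ((c + η 0) ^ k * ∏ i ∈ A, w i))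
      ≤ C₁ * Real.exp (-κ * s) *
        (η u * ((c + η 0) ^ k * (C₂ ^ k * ∏ i ∈ A, (1 + (t : ℝ)) ^ d i))) := by gcongr
    _ = _ := by ring

/-- After time `t`, the integrand in `L_A` is small. -/
lemma exists_norm_integrand_tail_le (h : MomentBounds γ off Pr X k C M β) (hκ : 0 < κ)
    (hν : ∀ i, (H.lam 0).re / 2 + κ ≤ (H.lam (ν i)).re) :
    ∃ C' : ℝ, 0 ≤ C' ∧ ∀ A : Finset (Fin ℓ), 2 ≤ A.card → A.card ≤ k →
      ∀ (d : Fin ℓ → ℕ) (f : Fin ℓ → BddFun E), (∀ i, H.IsDominatedBy (ν i) (d i) (f i)) →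
      ∀ (t : ℝ≥0) (s : ℝ), t ≤ s → ∀ x,
      ‖limitIntegrand Pr X γ off H.toSpectralData ν A (fun s B =>
          limitL Pr X γ off H.toSpectralData ν B fun i => H.expN (-s) (H.expN t (f i))) x s‖ ≤
        C' * Real.exp (-(3 * κ / 4) * s) := by
  obtain ⟨C₁, hC₁, h1⟩ := H.exists_limitIntegrand_bound h hκ hν
  obtain ⟨C₂, hC₂, h2⟩ := H.exists_norm_expN_le
  obtain ⟨c, hc, hL⟩ := H.exists_limitBound h hκ hν
  set K := nilpotencyClass H.N with hK
  -- Only a quarter of the decay is spent on the polynomial: of the remaining `3κ/4`, a part `κ/2`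
  -- is kept for integrability and `κ/4` becomes smallness in `t`.
  obtain ⟨C₃, hC₃, h3⟩ := exists_one_add_pow_le_exp (by positivity : 0 < κ / 4) (K * k)
  have hC₂0 : 0 ≤ C₂ := by linarith
  refine ⟨C₁ * (c ^ k * C₂ ^ k * C₃), by positivity, fun A hA hAk d f hf t s hts x => ?_⟩
  have ht0 := t.coe_nonneg
  have hs : 0 ≤ s := ht0.trans hts
  set w : Fin ℓ → ℝ := fun _ => C₂ * (1 + s) ^ K with hw
  have hw0 : ∀ i, 0 ≤ w i := fun i => by positivity
  have hG : ∀ B, B ⊂ A → B.Nonempty → ∀ y, ‖limitL Pr X γ off H.toSpectralData ν B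
      (fun i => H.expN (-s) (H.expN t (f i))) y‖ ≤ c * ∏ i ∈ B, w i := by
    intro B hBA hBn y
    have hbd : ∀ i z, ‖(H.expN (-s) (H.expN t (f i)) : E → ℂ) z‖ ≤ w i := fun i z => by
      rw [expN_expN]
      have h4 := h2 (-s + t) K (f i) 1
        (by rw [H.N_pow_eq_zero (Nat.le_succ _), LinearMap.zero_apply]) (hf i).norm_le z
      rw [mul_one] at h4
      -- Beyond time `t` the nilpotent flow runs backwards, but never for longer than `s`.
      have h5 : |-s + (t : ℝ)| ≤ s := by
        rw [abs_le]
        constructor <;> linarith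
      refine h4.trans ?_
      change _ ≤ C₂ * (1 + s) ^ K
      gcongr
    exact (hL B hBn ((Finset.card_le_card hBA.subset).trans hAk) _ _ w 0 le_rfl hbd hbd
      (by simp) y).1
  have hmain := (h1 A s
    (fun s B => limitL Pr X γ off H.toSpectralData ν B fun i => H.expN (-s) (H.expN t (f i)))
    (fun s B => limitL Pr X γ off H.toSpectralData ν B fun i => H.expN (-s) (H.expN t (f i)))
    (fun B => c * ∏ i ∈ B, w i) 0 (c ^ k * ∏ i ∈ A, w i) hA hAk hs le_rfl
    (mul_nonneg (by positivity) (Finset.prod_nonneg fun i _ => hw0 i))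
    (fun B _ => H.measurable_limitL ν h B _) (fun B _ => H.measurable_limitL ν h B _) hG hG
    (by simp) (fun σ _ => prod_parts_le σ hAk hc hw0) x).1
  refine hmain.trans ?_
  have hwA : ∏ i ∈ A, w i ≤ C₂ ^ k * (C₃ * Real.exp (κ / 4 * s)) := by
    rw [hw, Finset.prod_const]
    have hs1 : 1 ≤ 1 + s := by linarith
    calc (C₂ * (1 + s) ^ K) ^ A.card ≤ (C₂ * (1 + s) ^ K) ^ k :=
          pow_le_pow_right₀ (one_le_mul_of_one_le_of_one_le hC₂ (one_le_pow₀ hs1)) hAk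
      _ = C₂ ^ k * (1 + s) ^ (K * k) := by rw [mul_pow, pow_mul]
      _ ≤ _ := by
          have := h3 s hs
          gcongr
  calc C₁ * Real.exp (-κ * s) * (c ^ k * ∏ i ∈ A, w i)
      ≤ C₁ * Real.exp (-κ * s) * (c ^ k * (C₂ ^ k * (C₃ * Real.exp (κ / 4 * s)))) := by gcongr
    _ = C₁ * (c ^ k * C₂ ^ k * C₃) * (Real.exp (-κ * s) * Real.exp (κ / 4 * s)) := by ring
    _ = _ := by
        rw [← Real.exp_add]
        ring_nf

/-- The evolution equation is compared with the integral defining `L_A`. The term `ψ_t[∏ f_i]` is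
negligible, the integrands are close before time `t` by the bound on proper subsets, and the tail of
`L_A` after time `t` is exponentially small. -/
lemma exists_momentRate_of_ssubset (h : MomentBounds γ off Pr X k C M β)
    (hξ : Measurable fun q : ℝ≥0 × Ω₀ => ξ q.1 q.2)
    (hX : IsBranchingMarkovProcess P ξ γ off Pr X) (hκ : 0 < κ)
    (hν : ∀ i, (H.lam 0).re / 2 + κ ≤ (H.lam (ν i)).re) {η : ℝ → ℝ} (hη0 : ∀ t, 0 ≤ η t)
    (hη : Antitone η) :
    ∃ b : ℝ, 0 ≤ b ∧ ∀ A : Finset (Fin ℓ), 2 ≤ A.card → A.card ≤ k →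
      (∀ B, B ⊂ A → B.Nonempty → H.MomentRate γ off ν B η) →
      H.MomentRate γ off ν A fun t => b * (η (t / 2) + Real.exp (-(κ / 4) * t)) := by
  obtain ⟨C₁, hC₁, h1⟩ := H.exists_norm_integrand_sub_le h hκ hν hη0 hη
  obtain ⟨C₂, hC₂, h2⟩ := H.exists_norm_integrand_tail_le h hκ hν
  obtain ⟨C₃, hC₃, h3⟩ := H.exists_norm_psi_le h hκ
  have h00 := hη0 0
  refine ⟨C₃ + (C₁ * (1 + η 0) + C₂) / (κ / 2), by positivity,
    fun A hA hAk hB d f hf t x => ?_⟩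
  have ht0 := t.coe_nonneg
  set w : ℝ := ∏ i ∈ A, (1 + (t : ℝ)) ^ d i with hw
  have hw1 : 1 ≤ w := by
    refine (Finset.prod_const_one (s := A)).symm.le.trans ?_
    exact Finset.prod_le_prod (fun _ _ => zero_le_one) fun i _ => one_le_pow₀ (by linarith)
  have hηt := hη0 (t / 2)
  set q : ℝ := η (t / 2) + Real.exp (-(κ / 4) * t) with hq
  have hq0 : 0 ≤ q := by positivity
  set I : ℝ → ℂ := limitIntegrand Pr X γ off H.toSpectralData ν A
    (scaledMoment Pr X H.toSpectralData ν f t) x with hI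
  set I' : ℝ → ℂ := limitIntegrand Pr X γ off H.toSpectralData ν A (fun s B =>
    limitL Pr X γ off H.toSpectralData ν B fun i => H.expN (-s) (H.expN t (f i))) x with hI'
  have hIm : AEStronglyMeasurable I (volume.restrict (Set.Ioi 0)) :=
    H.aestronglyMeasurable_limitIntegrand ν h
      (fun B _ => h.measurable_scaledMoment ν f t B) x _
  have hI'int : IntegrableOn I' (Set.Ioi 0) :=
    H.integrableOn_limitIntegrand h hκ hν hA hAk (fun i => H.expN t (f i)) x
  set F : ℝ → ℂ := fun s => (Set.Ioo (0 : ℝ) t).indicator I s - I' s with hF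
  have hFm : AEStronglyMeasurable F (volume.restrict (Set.Ioi 0)) :=
    (hIm.indicator measurableSet_Ioo).sub hI'int.aestronglyMeasurable
  have hFb : ∀ s, 0 < s → ‖F s‖ ≤ ((C₁ * (1 + η 0) + C₂) * q * w) * Real.exp (-(κ / 2) * s) := by
    intro s hs
    have hexp2 : Real.exp (-κ * s) = Real.exp (-(κ / 2) * s) * Real.exp (-(κ / 2) * s) := by
      rw [← Real.exp_add]
      ring_nf
    rcases lt_or_ge s t with hst | hst
    · have hval : F s = I s - I' s := by
        rw [hF]
        simp only
        rw [Set.indicator_of_mem (Set.mem_Ioo.2 ⟨hs, hst⟩)]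
      rw [hval]
      refine (h1 A hA hAk hB d f hf t s hs hst x).trans ?_
      -- For `s ≤ t/2` the inductive rate is small, `η(t-s) ≤ η(t/2)`. For `s ≥ t/2` half of the
      -- decay is at most `e^{-κt/4}` and `η` is merely bounded. The other half stays available for
      -- the integration over `s`.
      have hkey : Real.exp (-κ * s) * η (t - s) ≤ (1 + η 0) * q * Real.exp (-(κ / 2) * s) := by
        have hη_s := hη0 (t - s)
        rcases le_total s (t / 2) with hs2 | hs2
        · have e1 : η (t - s) ≤ η (t / 2) := hη (by linarith)
          have e2 : Real.exp (-κ * s) ≤ Real.exp (-(κ / 2) * s) :=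
            Real.exp_le_exp.2 (by nlinarith)
          calc _ ≤ Real.exp (-(κ / 2) * s) * η (t / 2) := by gcongr
            _ ≤ Real.exp (-(κ / 2) * s) * ((1 + η 0) * q) := by
                refine mul_le_mul_of_nonneg_left ?_ (Real.exp_pos _).le
                calc η (t / 2) ≤ q := le_add_of_nonneg_right (Real.exp_pos _).le
                  _ ≤ (1 + η 0) * q := le_mul_of_one_le_left hq0 (by linarith)
            _ = _ := by ring
        · have e1 : η (t - s) ≤ η 0 := hη (by linarith)
          have e2 : Real.exp (-(κ / 2) * s) ≤ Real.exp (-(κ / 4) * t) :=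
            Real.exp_le_exp.2 (by nlinarith)
          rw [hexp2]
          calc _ ≤ Real.exp (-(κ / 2) * s) * Real.exp (-(κ / 4) * t) * η 0 := by gcongr
            _ = Real.exp (-(κ / 2) * s) * (η 0 * Real.exp (-(κ / 4) * t)) := by ring
            _ ≤ Real.exp (-(κ / 2) * s) * ((1 + η 0) * q) := by
                have e3 : Real.exp (-(κ / 4) * t) ≤ q := le_add_of_nonneg_left hηt
                gcongr
                linarith
            _ = _ := by ring
      calc _ ≤ C₁ * w * ((1 + η 0) * q * Real.exp (-(κ / 2) * s)) := by gcongr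
        _ = (C₁ * (1 + η 0)) * q * w * Real.exp (-(κ / 2) * s) := by ring
        _ ≤ _ := by
            gcongr
            linarith
    · have hval : F s = -I' s := by
        rw [hF]
        simp only
        rw [Set.indicator_of_notMem (fun hmem => absurd hmem.2 (not_lt.2 hst)), zero_sub]
      rw [hval, norm_neg]
      refine (h2 A hA hAk d f hf t s hst x).trans ?_
      have e1 : Real.exp (-(3 * κ / 4) * s) =
          Real.exp (-(κ / 4) * s) * Real.exp (-(κ / 2) * s) := by
        rw [← Real.exp_add]
        ring_nf
      have e2 : Real.exp (-(κ / 4) * s) ≤ q * w := by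
        calc Real.exp (-(κ / 4) * s) ≤ Real.exp (-(κ / 4) * t) :=
              Real.exp_le_exp.2 (by nlinarith)
          _ ≤ q := le_add_of_nonneg_left hηt
          _ ≤ q * w := le_mul_of_one_le_right hq0 hw1
      rw [e1]
      calc _ ≤ C₂ * (q * w * Real.exp (-(κ / 2) * s)) := by gcongr
        _ = C₂ * q * w * Real.exp (-(κ / 2) * s) := by ring
        _ ≤ _ := by
            gcongr
            have : 0 ≤ C₁ * (1 + η 0) := by positivity
            linarith
  have hFint := integrableOn_Ioi_of_norm_le_exp (half_pos hκ) hFm hFb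
  have hevol := h.prodMoment_evolution hξ hX (f := fun i => (f i : E → ℂ))
    (fun i => BddFun.measurable (f i)) le_rfl (fun i y => (hf i).norm_le y) (A := A)
    (Finset.card_pos.1 (by omega)) hAk t x
  have hIeq : ∫ s in Set.Ioi (0 : ℝ), (Set.Ioo (0 : ℝ) t).indicator I s =
      (∏ i ∈ A, Complex.exp (-H.lam (ν i) * (t : ℝ))) *
        ∫ s in Set.Ioo (0 : ℝ) t, psi Pr X s.toNNReal (fun y => (γ y : ℂ) * zeta off A
          (fun B => prodMoment Pr X (fun i => (f i : E → ℂ)) B (t - s.toNNReal)) y) x := by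
    rw [setIntegral_indicator measurableSet_Ioo,
      Set.inter_eq_right.2 (fun s hs => hs.1), ← integral_const_mul]
    refine integral_congr_ae (ae_of_all _ fun s => ?_)
    exact limitIntegrand_scaledMoment ν f t s A x
  have hsum : ∫ s in Set.Ioi (0 : ℝ), F s =
      (∫ s in Set.Ioi (0 : ℝ), (Set.Ioo (0 : ℝ) t).indicator I s) -
        ∫ s in Set.Ioi (0 : ℝ), I' s := by
    refine integral_sub ?_ hI'int
    -- Integrability of the truncated integrand is recovered from that of the difference `F` and of
    -- the limit integrand.
    have e1 := hFint.add hI'int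
    refine e1.congr (ae_of_all _ fun s => ?_)
    simp [hF]
  rw [limitL_of_two_le_card ν hA, hevol, mul_add, add_sub_assoc, ← hIeq, ← hsum]
  -- The product of the `f_i` is again bounded by one, so its first moment grows at most like
  -- `e^{(λ_1+κ)t}`, and the weight leaves `e^{-κt}`.
  have hfirst : ‖(∏ i ∈ A, Complex.exp (-H.lam (ν i) * (t : ℝ))) *
      psi Pr X t (fun y => ∏ i ∈ A, (f i : E → ℂ) y) x‖ ≤ C₃ * (q * w) := by
    rw [← exp_neg_sum_mul, norm_mul]
    have e1 := H.norm_exp_weight_le hκ hν hA ht0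
    have e2 := h3 t (fun y => ∏ i ∈ A, (f i : E → ℂ) y) 1
      (Finset.measurable_fun_prod _ fun i _ => BddFun.measurable (f i))
      (fun y => by
        rw [norm_prod]
        exact Finset.prod_le_one (fun i _ => norm_nonneg _) fun i _ => (hf i).norm_le y) x
    calc _ ≤ Real.exp (-((H.lam 0).re + 2 * κ) * t) *
          (C₃ * Real.exp (((H.lam 0).re + κ) * t) * 1) :=
          mul_le_mul e1 e2 (norm_nonneg _) (Real.exp_pos _).le
      _ = C₃ * (Real.exp (-((H.lam 0).re + 2 * κ) * t) *
          Real.exp (((H.lam 0).re + κ) * t)) := by ring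
      _ = C₃ * Real.exp (-κ * t) := by
          rw [← Real.exp_add]
          ring_nf
      _ ≤ C₃ * (q * w) := by
          refine mul_le_mul_of_nonneg_left ?_ (by linarith)
          calc Real.exp (-κ * t) ≤ Real.exp (-(κ / 4) * t) := Real.exp_le_exp.2 (by nlinarith)
            _ ≤ q := le_add_of_nonneg_left hηt
            _ ≤ q * w := le_mul_of_one_le_right hq0 hw1
  calc _ ≤ C₃ * (q * w) + (C₁ * (1 + η 0) + C₂) * q * w / (κ / 2) :=
        (norm_add_le _ _).trans (add_le_add hfirst
          (norm_integral_Ioi_le_of_norm_le_exp (half_pos hκ) hFb))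
    _ = _ := by ring

/-- Uniform convergence of the rescaled product moments. -/
theorem exists_momentRate (h : MomentBounds γ off Pr X k C M β)
    (hξ : Measurable fun q : ℝ≥0 × Ω₀ => ξ q.1 q.2)
    (hX : IsBranchingMarkovProcess P ξ γ off Pr X) (hκ : 0 < κ)
    (hν : ∀ i, (H.lam 0).re / 2 + κ ≤ (H.lam (ν i)).re) {n : ℕ} (hn : n ≤ k) :
    ∃ η : ℝ → ℝ, (∀ t, 0 ≤ η t) ∧ Antitone η ∧ Tendsto η atTop (𝓝 0) ∧
      ∀ A : Finset (Fin ℓ), A.Nonempty → A.card ≤ n → H.MomentRate γ off ν A η := by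
  have hR := H.lam_zero_pos
  choose η₁ h10 h1a h1t h1 using fun i : Fin ℓ =>
    H.exists_rate_psi h (i := ν i) (by linarith [hν i])
  induction n with
  | zero =>
    exact ⟨fun _ => 0, fun _ => le_rfl, antitone_const, tendsto_const_nhds,
      fun A hA hA0 => absurd hA.card_pos (by omega)⟩
  | succ n ih =>
    obtain ⟨η, hη0, hη, hηt, hrate⟩ := ih (by omega)
    obtain ⟨b, hb, hstep⟩ := H.exists_momentRate_of_ssubset h hξ hX hκ hν hη0 hη
    have hsum0 : ∀ t, 0 ≤ ∑ i, η₁ i t := fun t => Finset.sum_nonneg fun i _ => h10 i t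
    have hs0 : ∀ t, 0 ≤ b * (η (t / 2) + Real.exp (-(κ / 4) * t)) := fun t => by
      have := hη0 (t / 2)
      positivity
    have hmono : ∀ {A : Finset (Fin ℓ)} {η' η'' : ℝ → ℝ}, H.MomentRate γ off ν A η' →
        (∀ t, η' t ≤ η'' t) → H.MomentRate γ off ν A η'' := fun {A η' η''} h' hle d f hf t x =>
      (h' d f hf t x).trans (mul_le_mul_of_nonneg_right (hle t)
        (Finset.prod_nonneg fun i _ => by positivity))
    -- The sum dominates both the first-moment rates used for singletons and the rate from the
    -- inductive step.
    refine ⟨fun t => η t + ((∑ i, η₁ i t) + b * (η (t / 2) + Real.exp (-(κ / 4) * t))),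
      fun t => add_nonneg (hη0 t) (add_nonneg (hsum0 t) (hs0 t)), fun t t' htt => ?_, ?_,
      fun A hA hAn => ?_⟩
    · have e1 := hη htt
      have e2 : η (t' / 2) ≤ η (t / 2) := hη (by linarith)
      have e3 : ∑ i, η₁ i t' ≤ ∑ i, η₁ i t := Finset.sum_le_sum fun i _ => h1a i htt
      have e4 : Real.exp (-(κ / 4) * t') ≤ Real.exp (-(κ / 4) * t) :=
        Real.exp_le_exp.2 (by nlinarith)
      beta_reduce
      gcongr
    · have e1 : Tendsto (fun t => ∑ i, η₁ i t) atTop (𝓝 0) := by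
        simpa using tendsto_finsetSum Finset.univ fun i _ => h1t i
      have e2 : Tendsto (fun t : ℝ => η (t / 2)) atTop (𝓝 0) :=
        hηt.comp (tendsto_id.atTop_div_const two_pos)
      have e3 : Tendsto (fun t : ℝ => Real.exp (-(κ / 4) * t)) atTop (𝓝 0) := by
        have e4 : Tendsto (fun t : ℝ => κ / 4 * t) atTop atTop :=
          tendsto_id.const_mul_atTop (by positivity)
        simpa [Function.comp_def] using Real.tendsto_exp_neg_atTop_nhds_zero.comp e4
      simpa using hηt.add (e1.add ((e2.add e3).const_mul b))
    · rcases Nat.lt_or_ge A.card 2 with hA2 | hA2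
      · obtain ⟨i, rfl⟩ := Finset.card_eq_one.1 (le_antisymm (by omega) hA.card_pos)
        intro d f hf t x
        have e1 := h1 i (d i) (f i) (hf i) t x
        have e2 : prodMoment Pr X (fun i => (f i : E → ℂ)) {i} t x = psi Pr X t (f i) x := by
          simp [prodMoment, psi]
        rw [limitL_of_card_le_one ν (by simp), e2]
        simp only [Finset.prod_singleton]
        refine e1.trans ?_
        have e3 : 1 ≤ (1 + (t : ℝ)) ^ d i := one_le_pow₀ (by linarith [t.coe_nonneg])
        have e4 : η₁ i t ≤ ∑ j, η₁ j t :=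
          Finset.single_le_sum (f := fun j => η₁ j t) (fun j _ => h10 j t) (Finset.mem_univ i)
        have e5 : 0 ≤ η t + ((∑ i, η₁ i t) + b * (η (t / 2) + Real.exp (-(κ / 4) * t))) :=
          add_nonneg (hη0 t) (add_nonneg (hsum0 t) (hs0 t))
        refine le_trans ?_ (le_mul_of_one_le_right e5 e3)
        linarith [hη0 t, hs0 t]
      · refine hmono (hstep A hA2 (hAn.trans hn) fun B hBA hBn => hrate B hBn ?_) fun t => ?_
        · have := Finset.card_lt_card hBA
          omega
        · linarith [hη0 t, hsum0 t]

end AssumptionH1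

end Moments


/-! ### Generalised eigenfunctions -/

namespace AssumptionH1

open SpectralData

section Eigen

variable {E : Type*} [MeasurableSpace E] {ψ : ℝ≥0 → (E → ℂ) → E → ℂ} (H : AssumptionH1 ψ)

lemma Ei_unique {f : BddFun E} {i i' : Fin (H.r + 1)} (hi : f ∈ H.Ei i) (hi' : f ∈ H.Ei i') :
    i = i' := by
  wlog hre : (H.lam i).re ≤ (H.lam i').re generalizing i i'
  · exact (this hi' hi (le_of_not_ge hre)).symm
  by_contra hne
  refine hi.2 (Set.mem_iUnion₂.2 ⟨i', ⟨hre, fun h => hne (H.lam_injective h).symm⟩, hi'.1⟩)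

lemma mem_Ei_nu {f : BddFun E} (hf : f ∈ H.EiLargeOne) :
    f ∈ H.Ei (H.nu f) ∧ (H.lam 0).re < 2 * (H.lam (H.nu f)).re := by
  obtain ⟨⟨i, hi, hfi⟩, -⟩ := hf
  have h1 : f ∈ H.Ei (H.nu f) := Classical.epsilon_spec (p := fun i => f ∈ H.Ei i) ⟨i, hfi⟩
  refine ⟨h1, ?_⟩
  rwa [H.Ei_unique h1 hfi]

/-- Nilpotency bounds the set whose supremum defines `pIndex`, and `f ≠ 0` makes it nonempty, so the
supremum is attained. -/
lemma pIndex_spec {f : BddFun E} (hf : f ≠ 0) :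
    1 ≤ H.pIndex f ∧ (H.N ^ (H.pIndex f - 1)) f ≠ 0 ∧ (H.N ^ (H.pIndex f - 1 + 1)) f = 0 := by
  set S : Set ℕ := {i : ℕ | 1 ≤ i ∧ (H.N ^ (i - 1)) f ≠ 0} with hS
  have hne : S.Nonempty := ⟨1, le_rfl, by simpa using hf⟩
  have hbdd : BddAbove S := ⟨nilpotencyClass H.N, fun i hi => by
    by_contra hlt
    refine hi.2 ?_
    rw [H.N_pow_eq_zero (by omega), LinearMap.zero_apply]⟩
  obtain ⟨h1, h2⟩ : H.pIndex f ∈ S := Nat.sSup_mem hne hbdd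
  refine ⟨h1, h2, ?_⟩
  by_contra h3
  have h4 : H.pIndex f + 1 ∈ S := by
    refine ⟨by omega, ?_⟩
    rwa [Nat.sub_add_cancel h1] at h3
  have h5 : H.pIndex f + 1 ≤ H.pIndex f := le_csSup hbdd h4
  omega

/-- Membership in `Ei` makes some projection of `f` nonzero, hence `f ≠ 0`, and it excludes
components along every other eigenvalue of at least the same real part. -/
lemma isDominatedBy_of_mem {f : BddFun E} (hf : f ∈ H.EiLargeOne) :
    1 ≤ H.pIndex f ∧ H.IsDominatedBy (H.nu f) (H.pIndex f - 1) f := by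
  obtain ⟨h1, -⟩ := H.mem_Ei_nu hf
  have hf0 : f ≠ 0 := by
    rintro rfl
    obtain ⟨j, hj⟩ := h1.1
    refine hj ?_
    simp [PhiJ]
  obtain ⟨h2, h3, h4⟩ := H.pIndex_spec hf0
  refine ⟨h2, hf.2, ?_, h4, fun i' hi' hre => ?_⟩
  · by_contra hlt
    refine h3 ?_
    rw [H.N_pow_eq_zero (by omega), LinearMap.zero_apply]
  · have h5 : f ∉ H.EiStar i' := fun h6 => h1.2 (Set.mem_iUnion₂.2
      ⟨i', ⟨hre, fun h => hi' (H.lam_injective h)⟩, h6⟩)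
    refine Finset.sum_eq_zero fun j _ => ?_
    by_contra h6
    exact h5 ⟨j, h6⟩

end Eigen

/-! ### Leading order in time and the uniform rate -/

section Final

variable {E Ω₀ Ω : Type*} [MeasurableSpace E] [MeasurableSpace Ω₀] [MeasurableSpace Ω]
  {P : Kernel E Ω₀} [IsMarkovKernel P] {ξ : ℝ≥0 → Ω₀ → E ⊕ Unit} {γ : E → ℝ≥0}
  {off : Kernel E (Config E)} [IsMarkovKernel off] {Pr : Kernel E Ω}
  [IsMarkovKernel Pr] {X : ℝ≥0 → Ω → Config E} {k : ℕ} {C : ℝ≥0} {M β : ℝ}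
  [IsFiniteKernel (killedKernel P ξ γ)] (H : AssumptionH1 (psi Pr X)) {ℓ : ℕ}

/-- `L_A[e^{𝒩 t} f]` is of order `∏ t^{d_i}`, with leading coefficient
`∏ (d_i !)⁻¹ L_A[𝒩^{d_i} f_i]`. -/
lemma exists_norm_limitL_expN_sub_le {ν : Fin ℓ → Fin (H.r + 1)} {κ : ℝ}
    (h : MomentBounds γ off Pr X k C M β)
    (hκ : 0 < κ) (hν : ∀ i, (H.lam 0).re / 2 + κ ≤ (H.lam (ν i)).re) {A : Finset (Fin ℓ)}
    (hA : A.Nonempty) (hAk : A.card ≤ k) :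
    ∃ b : ℝ, 0 ≤ b ∧ ∀ (d : Fin ℓ → ℕ) (f : Fin ℓ → BddFun E),
      (∀ i, H.IsDominatedBy (ν i) (d i) (f i)) → ∀ (t : ℝ≥0) (x : E),
      ‖(((∏ i ∈ A, (1 + (t : ℝ)) ^ d i)⁻¹ : ℝ) : ℂ) *
          limitL Pr X γ off H.toSpectralData ν A (fun i => H.expN t (f i)) x -
        (∏ i ∈ A, ((d i).factorial : ℂ)⁻¹) *
          limitL Pr X γ off H.toSpectralData ν A (fun i => (H.N ^ d i) (f i)) x‖ ≤
        b / (1 + (t : ℝ)) := by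
  obtain ⟨c, hc, hL⟩ := H.exists_limitBound h hκ hν
  obtain ⟨C₁, hC₁, h1⟩ := H.exists_norm_expN_le
  obtain ⟨C₂, hC₂, h2⟩ := H.exists_norm_expN_sub_le
  obtain ⟨C₃, hC₃, h3⟩ := H.exists_opBound_N_pow
  refine ⟨c * (C₁ + C₂ + C₃) ^ A.card, by positivity, fun d f hf t x => ?_⟩
  have ht0 := t.coe_nonneg
  have h1t : 0 < 1 + (t : ℝ) := by linarith
  have e1 : ∀ i z, ‖(((((1 + (t : ℝ)) ^ d i)⁻¹ : ℝ) : ℂ) • H.expN t (f i) : BddFun E).1 z‖ ≤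
      C₁ + C₂ + C₃ := fun i z => by
    have e2 := h1 t (d i) (f i) 1 (hf i).N_pow (hf i).norm_le z
    rw [abs_of_nonneg ht0, mul_one] at e2
    change ‖((((1 + (t : ℝ)) ^ d i)⁻¹ : ℝ) : ℂ) * _‖ ≤ _
    rw [norm_mul, Complex.norm_real, Real.norm_of_nonneg (by positivity),
      inv_mul_le_iff₀ (by positivity)]
    refine e2.trans ?_
    rw [mul_comm]
    gcongr
    linarith
  have e2 : ∀ i z, ‖(((d i).factorial : ℂ)⁻¹ • (H.N ^ d i) (f i) : BddFun E).1 z‖ ≤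
      C₁ + C₂ + C₃ := fun i z => by
    have e3 := h3 (d i) (f i) 1 (hf i).norm_le z
    change ‖((d i).factorial : ℂ)⁻¹ * _‖ ≤ _
    rw [norm_mul, norm_inv, Complex.norm_natCast]
    have e4 : ((d i).factorial : ℝ)⁻¹ ≤ 1 :=
      inv_le_one_of_one_le₀ (by exact_mod_cast (d i).factorial_pos)
    calc _ ≤ 1 * (C₃ * 1) := mul_le_mul e4 e3 (norm_nonneg _) zero_le_one
      _ ≤ _ := by linarith
  have e3 : ∀ i z, ‖(((((1 + (t : ℝ)) ^ d i)⁻¹ : ℝ) : ℂ) • H.expN t (f i) : BddFun E).1 z -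
      (((d i).factorial : ℂ)⁻¹ • (H.N ^ d i) (f i) : BddFun E).1 z‖ ≤
      (1 / (1 + (t : ℝ))) * (C₁ + C₂ + C₃) := fun i z => by
    refine (h2 t (d i) (f i) 1 ht0 (hf i).lt (hf i).N_pow (hf i).norm_le z).trans ?_
    rw [mul_one, one_div_mul_eq_div]
    gcongr
    linarith
  -- The Lipschitz bound compares `(1+t)^{-d} e^{𝒩t} f` with `𝒩^d f / d!`, whose relative distance
  -- is `1/(1+t)`. Homogeneity of `L_A` then moves the scalars outside.
  have hmain := (hL A hA hAk _ _ (fun _ => C₁ + C₂ + C₃) (1 / (1 + (t : ℝ))) (by positivity)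
    e1 e2 e3 x).2
  rw [limitL_smul, limitL_smul] at hmain
  have hprod : (((∏ i ∈ A, (1 + (t : ℝ)) ^ d i)⁻¹ : ℝ) : ℂ) =
      ∏ i ∈ A, ((((1 + (t : ℝ)) ^ d i)⁻¹ : ℝ) : ℂ) := by
    rw [← Finset.prod_inv_distrib, Complex.ofReal_prod]
  rw [hprod]
  refine hmain.trans (le_of_eq ?_)
  rw [Finset.prod_const]
  ring

/-- The condition that the eigenvalues be large sits inside the conclusion, so that a rate can be
chosen for every index vector `ν`; for the others it is zero. -/
lemma exists_rate_of_indices (h : MomentBounds γ off Pr X k C M β)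
    (hξ : Measurable fun q : ℝ≥0 × Ω₀ => ξ q.1 q.2)
    (hX : IsBranchingMarkovProcess P ξ γ off Pr X) (hℓ : 1 ≤ ℓ) (hℓk : ℓ ≤ k)
    (ν : Fin ℓ → Fin (H.r + 1)) :
    ∃ ρ : ℝ≥0 → ℝ, (∀ t, 0 ≤ ρ t) ∧ (∃ b, ∀ t, ρ t ≤ b) ∧ Tendsto ρ atTop (𝓝 0) ∧
      ((∀ i, (H.lam 0).re < 2 * (H.lam (ν i)).re) →
        ∀ (d : Fin ℓ → ℕ) (f : Fin ℓ → BddFun E), (∀ i, H.IsDominatedBy (ν i) (d i) (f i)) →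
        ∀ (t : ℝ≥0) (x : E),
        ‖Complex.exp (-(∑ i, H.lam (ν i)) * (t : ℝ)) *
            (((∏ i, (1 + (t : ℝ)) ^ d i)⁻¹ : ℝ) : ℂ) *
            psiProd Pr X t (fun i => (f i : E → ℂ)) x -
          (∏ i, ((d i).factorial : ℂ)⁻¹) *
            limitL Pr X γ off H.toSpectralData ν Finset.univ (fun i => (H.N ^ d i) (f i)) x‖ ≤
          ρ t) := by
  by_cases hlarge : ∀ i, (H.lam 0).re < 2 * (H.lam (ν i)).re
  swap
  · exact ⟨fun _ => 0, fun _ => le_rfl, ⟨0, fun _ => le_rfl⟩, tendsto_const_nhds,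
      fun h' => absurd h' hlarge⟩
  obtain ⟨κ, hκ, hgap⟩ := H.exists_gap
  have hν := fun i => hgap (ν i) (hlarge i)
  have hne : (Finset.univ : Finset (Fin ℓ)).Nonempty := ⟨⟨0, hℓ⟩, Finset.mem_univ _⟩
  have hcard : (Finset.univ : Finset (Fin ℓ)).card ≤ k := by simpa using hℓk
  obtain ⟨η, hη0, hη, hηt, hrate⟩ := H.exists_momentRate h hξ hX hκ hν le_rfl
  obtain ⟨b, hb, hL⟩ := H.exists_norm_limitL_expN_sub_le h hκ hν hne hcard
  have h1t : ∀ t : ℝ≥0, 1 ≤ 1 + (t : ℝ) := fun t => by linarith [t.coe_nonneg]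
  refine ⟨fun t => η t + b / (1 + t), fun t => add_nonneg (hη0 t) (by positivity),
    ⟨η 0 + b, fun t => add_le_add (hη t.coe_nonneg) (div_le_self hb (h1t t))⟩, ?_,
    fun _ d f hf t x => ?_⟩
  · have e1 : Tendsto (fun t : ℝ≥0 => (t : ℝ)) atTop atTop := NNReal.tendsto_coe_atTop.2 tendsto_id
    have e2 : Tendsto (fun t : ℝ≥0 => b / (1 + (t : ℝ))) atTop (𝓝 0) :=
      tendsto_const_nhds.div_atTop (tendsto_atTop_add_const_left _ _ e1)
    simpa using (hηt.comp e1).add e2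
  · set w : ℝ := ∏ i, (1 + (t : ℝ)) ^ d i with hw
    have hwpos : 0 < w := Finset.prod_pos fun i _ => by positivity
    have h1 := hrate _ hne hcard d f hf t x
    have h2 := hL d f hf t x
    rw [← exp_neg_sum_mul, ← hw] at h1
    rw [← hw] at h2
    have h3 : ‖((w⁻¹ : ℝ) : ℂ) * (Complex.exp (-(∑ i, H.lam (ν i)) * (t : ℝ)) *
        prodMoment Pr X (fun i => (f i : E → ℂ)) Finset.univ t x -
        limitL Pr X γ off H.toSpectralData ν Finset.univ (fun i => H.expN t (f i)) x)‖ ≤ η t := by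
      rw [norm_mul, Complex.norm_real, Real.norm_of_nonneg (by positivity),
        inv_mul_le_iff₀ hwpos, mul_comm w]
      exact h1
    refine le_trans (le_of_eq ?_) ((norm_add_le _ _).trans (add_le_add h3 h2))
    congr 1
    rw [show psiProd Pr X t (fun i => (f i : E → ℂ)) x =
      prodMoment Pr X (fun i => (f i : E → ℂ)) Finset.univ t x from rfl]
    ring

/-- The indices `ν(f_i)` depend on `f`, but they range over a finite set, so the sum of the rates
over all index vectors is uniform in `f`. -/
lemma exists_rate_Delta (h : MomentBounds γ off Pr X k C M β)
    (hξ : Measurable fun q : ℝ≥0 × Ω₀ => ξ q.1 q.2)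
    (hX : IsBranchingMarkovProcess P ξ γ off Pr X) (hℓ : 1 ≤ ℓ) (hℓk : ℓ ≤ k) :
    ∃ ρ : ℝ≥0 → ℝ, (∃ b, ∀ t, ρ t ≤ b) ∧ Tendsto ρ atTop (𝓝 0) ∧
      ∀ t, Delta Pr X γ off H.toSpectralData ℓ t ≤ ENNReal.ofReal (ρ t) := by
  choose ρ hρ0 hρb hρt hρ using fun ν => H.exists_rate_of_indices h hξ hX hℓ hℓk ν
  choose b hb using hρb
  refine ⟨fun t => ∑ ν, ρ ν t, ⟨∑ ν, b ν, fun t => Finset.sum_le_sum fun ν _ => hb ν t⟩, ?_,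
    fun t => iSup_le fun x => iSup_le fun f => iSup_le fun hf => ?_⟩
  · simpa using tendsto_finsetSum Finset.univ fun ν _ => hρt ν
  · have hdom := fun i => H.isDominatedBy_of_mem (hf i)
    have h1 := hρ (fun i => H.nu (f i)) (fun i => (H.mem_Ei_nu (hf i)).2)
      (fun i => H.pIndex (f i) - 1) f (fun i => (hdom i).2) t x
    -- The natural subtraction `p(f_i) - 1` is not truncated because `p(f_i) ≥ 1`.
    have hexponent : (∑ i, (H.pIndex (f i) : ℤ)) - (ℓ : ℤ) =
        ((∑ i, (H.pIndex (f i) - 1) : ℕ) : ℤ) := by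
      have e1 : ∀ i, ((H.pIndex (f i) - 1 : ℕ) : ℤ) = (H.pIndex (f i) : ℤ) - 1 := fun i => by
        rw [Nat.cast_sub (hdom i).1, Nat.cast_one]
      rw [Nat.cast_sum]
      simp_rw [e1]
      simp
    have hpow : ((1 + (t : ℝ) : ℝ) : ℂ) ^ (-((∑ i, (H.pIndex (f i) : ℤ)) - (ℓ : ℤ))) =
        (((∏ i, (1 + (t : ℝ)) ^ (H.pIndex (f i) - 1))⁻¹ : ℝ) : ℂ) := by
      rw [hexponent, zpow_neg, zpow_natCast, Finset.prod_pow_eq_pow_sum]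
      push_cast
      rfl
    rw [hpow, ← ofReal_norm]
    refine ENNReal.ofReal_le_ofReal (h1.trans ?_)
    exact Finset.single_le_sum (f := fun ν => ρ ν t) (fun ν _ => hρ0 ν t)
      (Finset.mem_univ (fun i => H.nu (f i)))

end Final

end AssumptionH1


/-! ### Uniform moment bounds from the hypotheses -/

section Main

variable {E Ω₀ Ω : Type*} [MeasurableSpace E] [MeasurableSpace Ω₀] [MeasurableSpace Ω]
  {P : Kernel E Ω₀} {ξ : ℝ≥0 → Ω₀ → E ⊕ Unit} {γ : E → ℝ≥0}
  {off : Kernel E (Config E)} [IsMarkovKernel off] {Pr : Kernel E Ω}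
  {X : ℝ≥0 → Ω → Config E}

lemma integrable_card_pow_and_integral_le {α : Type*} [MeasurableSpace α] {μ : Measure α}
    {Y : α → Config E} (hY : Measurable Y) {k : ℕ} {b : ℝ} (hb : 0 ≤ b)
    (h : ∫⁻ a, ((Y a).1 : ℝ≥0∞) ^ k ∂μ ≤ ENNReal.ofReal b) :
    Integrable (fun a => ((Y a).1 : ℝ) ^ k) μ ∧ ∫ a, ((Y a).1 : ℝ) ^ k ∂μ ≤ b := by
  have hm : Measurable fun a => ((Y a).1 : ℝ) ^ k :=
    ((measurable_from_nat (f := fun n => (n : ℝ))).comp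
      (measurable_config_card.comp hY)).pow_const k
  have he : ∀ a, ‖((Y a).1 : ℝ) ^ k‖ₑ = ((Y a).1 : ℝ≥0∞) ^ k := fun a => by
    rw [Real.enorm_of_nonneg (by positivity), ENNReal.ofReal_pow (by positivity),
      ENNReal.ofReal_natCast]
  have hint : Integrable (fun a => ((Y a).1 : ℝ) ^ k) μ := by
    refine ⟨hm.aestronglyMeasurable, ?_⟩
    rw [HasFiniteIntegral]
    simp_rw [he]
    exact h.trans_lt ENNReal.ofReal_lt_top
  refine ⟨hint, ?_⟩
  rw [← ENNReal.ofReal_le_ofReal_iff hb,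
    ofReal_integral_eq_lintegral_ofReal hint (ae_of_all _ fun a => by positivity)]
  refine le_trans (le_of_eq (lintegral_congr fun a => ?_)) h
  rw [ENNReal.ofReal_pow (by positivity), ENNReal.ofReal_natCast]

lemma exists_momentBounds (hξ : IsMarkovMotion P ξ) (hγ : Measurable γ)
    (hγb : ∃ C : ℝ≥0, ∀ y, γ y ≤ C) (hX : IsBranchingMarkovProcess P ξ γ off Pr X) {k : ℕ}
    (hk : 1 ≤ k) (hmom : ⨆ x, ∫⁻ c, (c.1 : ℝ≥0∞) ^ k ∂(off x) < ⊤) :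
    ∃ (C : ℝ≥0) (M β : ℝ), MomentBounds γ off Pr X k C M β := by
  obtain ⟨C, hC⟩ := hγb
  obtain ⟨m, rfl⟩ := Nat.exists_eq_add_of_le' hk
  have := hξ.isMarkovKernel
  have := hX.isMarkovKernel
  set M : ℝ≥0 := (⨆ x, ∫⁻ c, (c.1 : ℝ≥0∞) ^ (m + 1) ∂(off x)).toNNReal with hM
  have hle : ∀ y, ∫⁻ c, (c.1 : ℝ≥0∞) ^ (m + 1) ∂(off y) ≤ M := fun y => by
    rw [hM, ENNReal.coe_toNNReal hmom.ne]
    exact le_iSup (fun x => ∫⁻ c, (c.1 : ℝ≥0∞) ^ (m + 1) ∂(off x)) y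
  have hcard : ∀ t x, _ := fun t x =>
    integrable_card_pow_and_integral_le (μ := Pr x) (Y := X t) (k := m + 1)
      (b := 2 * Real.exp ((2 * (C * M) + 1) * t))
      (hX.measurable.comp (f := fun ω => (t, ω)) (by fun_prop)) (by positivity) (by
        rw [ENNReal.ofReal_mul zero_le_two, ENNReal.ofReal_ofNat]
        exact lintegral_card_pow_le hξ.measurable hγ hC hX hle t x)
  -- The growth exponent `β` is the Grönwall exponent `2L + 1` with `L = C * M`.
  refine ⟨C, M, 2 * (C * M) + 1, hX.measurable, hγ, hC, hk, by positivity, fun y => ?_,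
    fun t x => (hcard t x).1, fun t x => (hcard t x).2⟩
  exact integrable_card_pow_and_integral_le (Y := fun c : Config E => c) measurable_id
    M.coe_nonneg (by rw [ENNReal.ofReal_coe_nnreal]; exact hle y)

end Main

end BMP

theorem theorem2p1 {E Ω₀ Ω : Type*} [TopologicalSpace E] [PolishSpace E] [MeasurableSpace E]
    [BorelSpace E] [MeasurableSpace Ω₀] [MeasurableSpace Ω]
    (P : Kernel E Ω₀) (ξ : ℝ≥0 → Ω₀ → E ⊕ Unit) (hξ : BMP.IsMarkovMotion P ξ)
    (γ : E → ℝ≥0) (hγ : Measurable γ) (hγb : ∃ C : ℝ≥0, ∀ y, γ y ≤ C)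
    (offspring : Kernel E (BMP.Config E)) [IsMarkovKernel offspring]
    (Pr : Kernel E Ω) (X : ℝ≥0 → Ω → BMP.Config E)
    (hX : BMP.IsBranchingMarkovProcess P ξ γ offspring Pr X)
    (H : BMP.AssumptionH1 (BMP.psi Pr X))
    (k : ℕ) (hk : 2 ≤ k)
    (hmom : ⨆ x, ∫⁻ c, (c.1 : ℝ≥0∞) ^ k ∂(offspring x) < ⊤) :
    ∀ ℓ : ℕ, 1 ≤ ℓ → ℓ ≤ k →
      -- the moments and the functions `L_A` are well defined
      (∀ (f : Fin ℓ → BMP.BddFun E) (t : ℝ≥0) (x : E),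
        Integrable (fun ω => ∏ i, BMP.pair (X t ω) (f i : E → ℂ)) (Pr x)) ∧
      (∀ (ν : Fin ℓ → Fin (H.r + 1)), (∀ i, (H.lam 0).re < 2 * (H.lam (ν i)).re) →
        ∀ (h : Fin ℓ → BMP.BddFun E) (A : Finset (Fin ℓ)), A.Nonempty →
          BMP.limitL Pr X γ offspring H.toSpectralData ν A h ∈ BMP.BddFun E ∧
          (2 ≤ A.card → ∀ x, IntegrableOn
            (BMP.limitIntegrand Pr X γ offspring H.toSpectralData ν A
              (fun s B => BMP.limitL Pr X γ offspring H.toSpectralData ν B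
                (fun i => H.expN (-s) (h i))) x) (Set.Ioi 0))) ∧
      -- uniform boundedness and convergence
      (⨆ t : ℝ≥0, BMP.Delta Pr X γ offspring H.toSpectralData ℓ t) < ⊤ ∧
      Tendsto (fun t : ℝ≥0 => BMP.Delta Pr X γ offspring H.toSpectralData ℓ t) atTop (𝓝 0) := by
  intro ℓ hℓ hℓk
  have hP := hξ.isMarkovKernel
  have hPr := hX.isMarkovKernel
  have hS := BMP.isFiniteKernel_killedKernel (P := P) hξ.measurable hγ
  obtain ⟨C, M, β, h⟩ := BMP.exists_momentBounds hξ hγ hγb hX (by omega) hmom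
  refine ⟨fun f t x => ?_, fun ν hν f A hA => ?_, ?_⟩
  · choose m hm hfm using fun i => BMP.BddFun.exists_bound (f i)
    have hle : ∀ i, m i ≤ ∑ j, m j := fun i =>
      Finset.single_le_sum (fun j _ => hm j) (Finset.mem_univ i)
    exact h.integrable_prod_pair (A := Finset.univ) (D := max 1 (∑ i, m i))
      (fun i => BMP.BddFun.measurable (f i)) (le_max_left _ _)
      (fun i y => (hfm i y).trans ((hle i).trans (le_max_right _ _))) (by simpa using hℓk) t x
  · obtain ⟨κ, hκ, hgap⟩ := H.exists_gap
    have hν' := fun i => hgap (ν i) (hν i)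
    have hAk : A.card ≤ k := (Finset.card_le_univ A).trans (by simpa using hℓk)
    exact ⟨H.limitL_mem_bddFun h hκ hν' hA hAk f,
      fun hA2 x => H.integrableOn_limitIntegrand h hκ hν' hA2 hAk f x⟩
  · obtain ⟨ρ, ⟨b, hb⟩, hρ, hΔ⟩ := H.exists_rate_Delta h hξ.measurable hX hℓ hℓk
    refine ⟨(iSup_le fun t => (hΔ t).trans (ENNReal.ofReal_le_ofReal (hb t))).trans_lt
      ENNReal.ofReal_lt_top, ?_⟩
    have h0 : Tendsto (fun t => ENNReal.ofReal (ρ t)) atTop (𝓝 0) := by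
      simpa using ENNReal.tendsto_ofReal hρ
    exact tendsto_of_tendsto_of_tendsto_of_le_of_le tendsto_const_nhds h0
      (fun _ => zero_le) hΔ
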